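/- Let $\Sigma_1,\Sigma_2$ be smooth manifolds of dimensions $n$ and $m$ with smooth Riemannian metrics $g_1,g_2$ of constant curvature $k_1,k_2$, and let $M=\Sigma_1\times\Sigma_2$ carry the product metric $\langle\cdot,\cdot\rangle$ with Levi-Civita connection $\nabla^M$. Let $\Sigma$ be a smooth $n$-manifold and let $F_t:\Sigma\to M$, $t\in[0,\varepsilon)$, be a mean curvature flow: a smooth family of immersions with $\partial F_t/\partial t=H_t$, the mean curvature vector of $\Sigma_t=F_t(\Sigma)$, where $F_0$ is a smooth embedding. Suppose that for every $t\in[0,\varepsilon)$, $\Sigma_t$ is locally a graph over $\Sigma_1$: every point of $\Sigma$ has an open neighbourhood $U$ such that $F_t(U)$ is the graph of a smooth map $f_t:V\to\Sigma_2$ on an open set $V\subset\Sigma_1$. Let $\Omega_1$ be the volume form of $\Sigma_1$, and let $*\Omega_1=\Omega_1(\pi_1 e_1,\dots,\pi_1 e_n)$ for an orthonormal basis $e_1,\dots,e_n$ of the tangent space of $\Sigma_t$, oriented so that $*\Omega_1\ge 0$; that is, $*\Omega_1$ is the Jacobian of the projection from $\Sigma_t$ to $\Sigma_1$. View $*\Omega_1$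 as a function of $p\in\Sigma$ and $t$. For fixed $t$ it is smooth and positive on $\Sigma$. Fix $t\in[0,\varepsilon)$, $p\in\Sigma$ and a local map $f_t$ as above near $p$, and put $x=\pi_1(F_t(p))$. There are orthonormal bases $a_1,\dots,a_n$ of $T_x\Sigma_1$ and $a_{n+1},\dots,a_{n+m}$ of $T_{f_t(x)}\Sigma_2$ and numbers $\lambda_1,\dots,\lambda_n\ge0$ (the singular values of $df_t$ at $x$, that is, the eigenvalues of $\sqrt{(df_t)^Tdf_t}$) with $df_t(a_i)=\lambda_i a_{n+i}$ for $i\le m$, and $\lambda_i=0$, $df_t(a_i)=0$ for $i>m$. For every such choice put $$e_i=\frac{a_i+df_t(a_i)}{\sqrt{1+\lambda_i^2}}\quad(1\le i\le n),\qquad e_{n+\alpha}=\frac{a_{n+\alpha}-\lambda_\alpha a_\alpha}{\sqrt{1+\lambda_\alpha^2}}\quad(1\le\alpha\le m),$$ where $\lambda_\alpha a_\alpha$ and $\lambda_\alpha$ are read as $0$ for $\alpha>n$. These are orthonormal bases of the tangent and the normal space of $\Sigma_t$ at $F_t(p)$. Let $h_{n+\alpha,ik}=\langle\nabla^M_{e_i}e_k,e_{n+\alpha}\rangle$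 be the components of the second fundamental form, with $h_{n+\alpha,ik}$ read as $0$ for $\alpha>m$. Then, at $(p,t)$, $$\begin{aligned}\frac{d}{dt}{*\Omega_1}=\Delta{*\Omega_1}+{*\Omega_1}\Big\{&\sum_{\alpha=1}^m\sum_{i,k=1}^n h_{n+\alpha,ik}^2-2\sum_{k}\sum_{i<j}\lambda_i\lambda_j\,h_{n+i,ik}h_{n+j,jk}+2\sum_{k}\sum_{i<j}\lambda_i\lambda_j\,h_{n+j,ik}h_{n+i,jk}\\&+\sum_i\frac{\lambda_i^2}{1+\lambda_i^2}\Big[k_1\sum_{j\ne i}\frac1{1+\lambda_j^2}+k_2\Big(1-n+\sum_{j\ne i}\frac1{1+\lambda_j^2}\Big)\Big]\Big\},\end{aligned}$$ where $\Delta$ is the Laplacian of the metric induced by $F_t$ on $\Sigma$, and $d/dt$ is taken at fixed $p$ (one-sided at $t=0$). -/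

import Mathlib

open Set Topology Manifold
open scoped ContDiff Manifold

noncomputable section

namespace GraphFlow

/-! ## Linear algebra of bilinear forms -/

section LinearAlgebra

variable {n : ℕ} {W : Type*} [AddCommGroup W] [Module ℝ W]

/-- The Gram matrix `B(∂ᵢ, ∂ⱼ)` in the standard coordinate basis of `ℝⁿ`. -/
def gram (B : EuclideanSpace ℝ (Fin n) →L[ℝ] EuclideanSpace ℝ (Fin n) →L[ℝ] ℝ) :
    Matrix (Fin n) (Fin n) ℝ :=
  Matrix.of fun i j => B (EuclideanSpace.basisFun (Fin n) ℝ i) (EuclideanSpace.basisFun (Fin n) ℝ j)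

/-- The trace `Bⁱʲ T(∂ᵢ, ∂ⱼ)` of a bilinear map `T` with respect to the inner product `B`. -/
def metricTrace (B : EuclideanSpace ℝ (Fin n) →L[ℝ] EuclideanSpace ℝ (Fin n) →L[ℝ] ℝ)
    (T : EuclideanSpace ℝ (Fin n) → EuclideanSpace ℝ (Fin n) → W) : W :=
  ∑ i, ∑ j, (gram B)⁻¹ i j •
    T (EuclideanSpace.basisFun (Fin n) ℝ i) (EuclideanSpace.basisFun (Fin n) ℝ j)

/-- The volume form `√(det gᵢⱼ) dx¹ ∧ ⋯ ∧ dxⁿ` of an inner product `B` on `ℝⁿ`, for the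
standard orientation. -/
def volumeForm (B : EuclideanSpace ℝ (Fin n) →L[ℝ] EuclideanSpace ℝ (Fin n) →L[ℝ] ℝ) :
    EuclideanSpace ℝ (Fin n) [⋀^Fin n]→ₗ[ℝ] ℝ :=
  √(gram B).det • (EuclideanSpace.basisFun (Fin n) ℝ).toBasis.det

/-- Orthonormality of a finite family with respect to a bilinear form. -/
def IsOrthonormal {E : Type*} [NormedAddCommGroup E] [NormedSpace ℝ E]
    (B : E →L[ℝ] E →L[ℝ] ℝ) {N : ℕ} (v : Fin N → E) : Prop :=
  ∀ i j, B (v i) (v j) = if i = j then 1 else 0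

/-- A family indexed by `Fin N`, continued by zero to all indices. -/
def extendZero {V : Type*} [Zero V] {N : ℕ} (v : Fin N → V) (k : ℕ) : V :=
  if h : k < N then v ⟨k, h⟩ else 0

end LinearAlgebra

/-! ## Riemannian geometry in coordinates -/

section Local

variable {E : Type*} [NormedAddCommGroup E] [NormedSpace ℝ E]

/-- The Christoffel symbol of the first kind, as a covector:
`Γ(u, v; w) = (∂ᵤ G(v, w) + ∂ᵥ G(u, w) - ∂_w G(u, v)) / 2`. -/
def christoffelFirst (G : E → E →L[ℝ] E →L[ℝ] ℝ) (x u v : E) : E →L[ℝ] ℝ :=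
  (1 / 2 : ℝ) • (fderiv ℝ G x u v + fderiv ℝ G x v u - ((fderiv ℝ G x).flip u).flip v)

/-- The Christoffel symbol of the second kind: the vector `Γ(u, v)` with
`G(Γ(u, v), w) = Γ(u, v; w)` for all `w`. -/
def christoffel (G : E → E →L[ℝ] E →L[ℝ] ℝ) (x u v : E) : E :=
  (G x).inverse (christoffelFirst G x u v)

/-- The curvature tensor
`R(u, v) w = ∂ᵤ Γ(v, w) - ∂ᵥ Γ(u, w) + Γ(u, Γ(v, w)) - Γ(v, Γ(u, w))`. -/
def curvature (G : E → E →L[ℝ] E →L[ℝ] ℝ) (x u v w : E) : E :=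
  fderiv ℝ (fun y => christoffel G y v w) x u - fderiv ℝ (fun y => christoffel G y u w) x v
    + christoffel G x u (christoffel G x v w) - christoffel G x v (christoffel G x u w)

end Local

/-! ## Riemannian geometry on manifolds

As in Mathlib, the tangent space at `p` is the model space, a tangent vector being given by its
coordinates in the preferred chart at `p`. -/

section Manifolds

variable {E H N : Type*} [NormedAddCommGroup E] [NormedSpace ℝ E] [TopologicalSpace H]
  [TopologicalSpace N] [ChartedSpace H N]

/-- A field of bilinear forms on the tangent spaces. -/
abbrev MetricField (I : ModelWithCorners ℝ E H) (N : Type*) [TopologicalSpace N]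
    [ChartedSpace H N] :=
  (x : N) → TangentSpace I x →L[ℝ] TangentSpace I x →L[ℝ] ℝ

/-- The value of a metric at `x`, as a bilinear form on the model space. -/
def MetricField.form {I : ModelWithCorners ℝ E H} (g : MetricField I N) (x : N) :
    E →L[ℝ] E →L[ℝ] ℝ := g x

/-- The metric in the preferred chart at `p`: the components at the coordinate point `y`. -/
def localMetric (I : ModelWithCorners ℝ E H) (g : MetricField I N) (p : N) (y : E) :
    E →L[ℝ] E →L[ℝ] ℝ :=
  ContinuousLinearMap.bilinearComp (MetricField.form g ((extChartAt I p).symm y))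
    (mfderiv 𝓘(ℝ, E) I (extChartAt I p).symm y : E →L[ℝ] E)
    (mfderiv 𝓘(ℝ, E) I (extChartAt I p).symm y : E →L[ℝ] E)

/-- Constant (sectional) curvature `k`: `R(u, v) w = k (⟨v, w⟩ u - ⟨u, w⟩ v)` at every point. -/
def HasConstantCurvature (I : ModelWithCorners ℝ E H) (g : MetricField I N) (k : ℝ) : Prop :=
  ∀ (p : N) (u v w : E),
    curvature (localMetric I g p) (extChartAt I p p) u v w =
      k • (MetricField.form g p v w • u - MetricField.form g p u w • v)

variable {E' H' N' : Type*} [NormedAddCommGroup E'] [NormedSpace ℝ E'] [TopologicalSpace H']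
  [TopologicalSpace N'] [ChartedSpace H' N']

/-- The Riemannian product metric on `N × N'`. -/
def productMetric {I : ModelWithCorners ℝ E H} {I' : ModelWithCorners ℝ E' H'}
    (g : MetricField I N) (g' : MetricField I' N') : MetricField (I.prod I') (N × N') :=
  fun x =>
    (ContinuousLinearMap.bilinearComp (MetricField.form g x.1)
        (ContinuousLinearMap.fst ℝ E E') (ContinuousLinearMap.fst ℝ E E')
      + ContinuousLinearMap.bilinearComp (MetricField.form g' x.2)
        (ContinuousLinearMap.snd ℝ E E') (ContinuousLinearMap.snd ℝ E E') :
      E × E' →L[ℝ] E × E' →L[ℝ] ℝ)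

/-- The differential of `F` at `p`, as a map between model spaces. -/
def differential (I : ModelWithCorners ℝ E H) (I' : ModelWithCorners ℝ E' H') (F : N → N') (p : N) :
    E →L[ℝ] E' :=
  mfderiv I I' F p

/-- The induced metric `F^* g`. -/
def inducedMetric (I : ModelWithCorners ℝ E H) {I' : ModelWithCorners ℝ E' H'}
    (g : MetricField I' N') (F : N → N') : MetricField I N :=
  fun p => (ContinuousLinearMap.bilinearComp (MetricField.form g (F p))
    (differential I I' F p) (differential I I' F p) : E →L[ℝ] E →L[ℝ] ℝ)

/-- The normal part of a vector `w` at `F p`: it is `w - dF(X)`, where `X` is the tangent vector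
with `⟨dF X, dF Y⟩ = ⟨w, dF Y⟩` for all `Y`. -/
def normalPart (I : ModelWithCorners ℝ E H) {I' : ModelWithCorners ℝ E' H'}
    (g : MetricField I' N') (F : N → N') (p : N) (w : E') : E' :=
  w - differential I I' F p ((MetricField.form (inducedMetric I g F) p).inverse
    ((MetricField.form g (F p) w).comp (differential I I' F p)))

/-- `∇_X dF(Y)` at `p`, where `X`, `Y` have constant coordinates in the preferred chart at `p` and
`∇` is the Levi-Civita connection of `g`: `∂_X ∂_Y F + Γ(dF X, dF Y)`. -/
def covariantHessian (I : ModelWithCorners ℝ E H) {I' : ModelWithCorners ℝ E' H'}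
    (g : MetricField I' N') (F : N → N') (p : N) (X Y : E) : E' :=
  fderiv ℝ (fderiv ℝ (extChartAt I' (F p) ∘ F ∘ (extChartAt I p).symm)) (extChartAt I p p) X Y
    + christoffel (localMetric I' g (F p)) (extChartAt I' (F p) (F p))
        (differential I I' F p X) (differential I I' F p Y)

/-- The second fundamental form `(∇_X dF(Y))^⊥` of an immersion `F`. -/
def secondFundamentalForm (I : ModelWithCorners ℝ E H) {I' : ModelWithCorners ℝ E' H'}
    (g : MetricField I' N') (F : N → N') (p : N) (X Y : E) : E' :=
  normalPart I g F p (covariantHessian I g F p X Y)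

end Manifolds

/-! ## Mean curvature flow of `n`-dimensional submanifolds -/

section MeanCurvatureFlow

variable {S : Type*} [TopologicalSpace S]

/-- The Laplace-Beltrami operator `Δu = gⁱʲ (∂ᵢ∂ⱼ u - Γᵏᵢⱼ ∂ₖ u)`, in the preferred chart at
`p`. -/
def laplacian {n : ℕ} [ChartedSpace (EuclideanSpace ℝ (Fin n)) S]
    (g : MetricField (𝓡 n) S) (u : S → ℝ) (p : S) : ℝ :=
  metricTrace (MetricField.form g p) fun X Y =>
    fderiv ℝ (fderiv ℝ (u ∘ (extChartAt (𝓡 n) p).symm)) (extChartAt (𝓡 n) p p) X Y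
      - fderiv ℝ (u ∘ (extChartAt (𝓡 n) p).symm) (extChartAt (𝓡 n) p p)
          (christoffel (localMetric (𝓡 n) g p) (extChartAt (𝓡 n) p p) X Y)

variable {E' H' M : Type*} [NormedAddCommGroup E'] [NormedSpace ℝ E'] [TopologicalSpace H']
  {J : ModelWithCorners ℝ E' H'} [TopologicalSpace M] [ChartedSpace H' M]

/-- The mean curvature vector: the trace of the second fundamental form. -/
def meanCurvatureVector (n : ℕ) [ChartedSpace (EuclideanSpace ℝ (Fin n)) S]
    (g : MetricField J M) (F : S → M) (p : S) : E' :=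
  metricTrace (MetricField.form (inducedMetric (𝓡 n) g F) p)
    (secondFundamentalForm (𝓡 n) g F p)

/-- `F` is a mean curvature flow for `t ∈ [0, ε)`: a smooth family of immersions `F t` with
`∂F/∂t = H`. -/
structure IsMeanCurvatureFlow (n : ℕ) [ChartedSpace (EuclideanSpace ℝ (Fin n)) S]
    (g : MetricField J M) (F : ℝ → S → M) (ε : ℝ) : Prop where
  smooth : ContMDiffOn (𝓘(ℝ, ℝ).prod (𝓡 n)) J ∞ (Function.uncurry F) (Ico 0 ε ×ˢ univ)
  immersion : ∀ t ∈ Ico 0 ε, ∀ p, Function.Injective (differential (𝓡 n) J (F t) p)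
  velocity : ∀ t ∈ Ico 0 ε, ∀ p,
    (mfderivWithin 𝓘(ℝ, ℝ) J (fun s => F s p) (Ico 0 ε) t : ℝ →L[ℝ] E') 1
      = meanCurvatureVector n g (F t) p

end MeanCurvatureFlow

/-! ## Submanifolds of a product that are locally graphs over the first factor -/

section Graphs

variable {S S₁ S₂ : Type*} [TopologicalSpace S] [TopologicalSpace S₁] [TopologicalSpace S₂]

/-- Near `p`, the image of `F` is the graph of the smooth map `f` defined on the open set `V`. -/
structure IsGraphNear (n m : ℕ) [ChartedSpace (EuclideanSpace ℝ (Fin n)) S₁]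
    [ChartedSpace (EuclideanSpace ℝ (Fin m)) S₂] (F : S → S₁ × S₂) (p : S) (U : Set S) (V : Set S₁) (f : S₁ → S₂) :
    Prop where
  isOpen_U : IsOpen U
  mem_U : p ∈ U
  isOpen_V : IsOpen V
  smooth : ContMDiffOn (𝓡 n) (𝓡 m) ∞ f V
  image_eq : F '' U = (fun x => (x, f x)) '' V

/-- The image of `F` is locally a graph over the first factor. -/
def IsLocallyGraph (n m : ℕ) [ChartedSpace (EuclideanSpace ℝ (Fin n)) S₁]
    [ChartedSpace (EuclideanSpace ℝ (Fin m)) S₂] (F : S → S₁ × S₂) : Prop :=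
  ∀ p, ∃ (U : Set S) (V : Set S₁) (f : S₁ → S₂), IsGraphNear n m F p U V f

variable {n m : ℕ} [ChartedSpace (EuclideanSpace ℝ (Fin n)) S]
  [ChartedSpace (EuclideanSpace ℝ (Fin n)) S₁] [ChartedSpace (EuclideanSpace ℝ (Fin m)) S₂]

/-- The function `*Ω₁` on the submanifold `F : S → S₁ × S₂`, where `Ω₁` is the volume form of the
first factor: `Ω₁(π₁ ∂₁F, …, π₁ ∂ₙF) / √(det Λᵢⱼ)` with `Λᵢⱼ = ⟨∂ᵢF, ∂ⱼF⟩`, which is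
`Ω₁(e₁, …, eₙ)` for an orthonormal basis of the tangent space. The absolute value means that the
tangent spaces are oriented so that `*Ω₁ ≥ 0`; it makes `*Ω₁` the Jacobian of the projection to
the first factor and independent of the orientation of that factor. -/
def starOmega (g₁ : MetricField (𝓡 n) S₁) (g₂ : MetricField (𝓡 m) S₂) (F : S → S₁ × S₂)
    (p : S) : ℝ :=
  |volumeForm (MetricField.form g₁ (F p).1) fun i =>
      (differential (𝓡 n) ((𝓡 n).prod (𝓡 m)) F p (EuclideanSpace.basisFun (Fin n) ℝ i)).1|
    / √(gram (MetricField.form (inducedMetric (𝓡 n) (productMetric g₁ g₂) F) p)).det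

/-- Adapted orthonormal frames at the point `p` of a submanifold that is the graph of `f` near
`p`. With `x = π₁(F p)`, the families `a` and `b` are orthonormal bases of `T_x S₁` and
`T_{f x} S₂` that put `df` into diagonal form, `df(aᵢ) = λᵢ bᵢ` (with `λᵢ bᵢ` read as `0` for
`i ≥ m`); so the `λᵢ` are the singular values of `df`. The `τᵢ` are the vectors tangent to `S`
with `dF(τᵢ) = eᵢ := (aᵢ + df(aᵢ)) / √(1 + λᵢ²)`. -/
structure IsAdaptedFrame (g₁ : MetricField (𝓡 n) S₁) (g₂ : MetricField (𝓡 m) S₂)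
    (F : S → S₁ × S₂) (p : S) (f : S₁ → S₂) (a : Fin n → EuclideanSpace ℝ (Fin n))
    (b : Fin m → EuclideanSpace ℝ (Fin m)) (lam : Fin n → ℝ)
    (τ : Fin n → EuclideanSpace ℝ (Fin n)) : Prop where
  orthonormal_a : IsOrthonormal (MetricField.form g₁ (F p).1) a
  orthonormal_b : IsOrthonormal (MetricField.form g₂ (f (F p).1)) b
  lam_nonneg : ∀ i, 0 ≤ lam i
  lam_eq_zero : ∀ i : Fin n, m ≤ (i : ℕ) → lam i = 0
  df_a : ∀ i, differential (𝓡 n) (𝓡 m) f (F p).1 (a i) = lam i • extendZero b i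
  dF_τ : ∀ i, differential (𝓡 n) ((𝓡 n).prod (𝓡 m)) F p (τ i) =
    (1 / √(1 + lam i ^ 2)) • (a i, differential (𝓡 n) (𝓡 m) f (F p).1 (a i))

/-- The vectors `e_{n+α} = (b_α - λ_α a_α) / √(1 + λ_α²)` of the adapted frame of the normal space;
`λ_α` and `a_α` are read as `0` for `α ≥ n`. -/
def normalFrame (a : Fin n → EuclideanSpace ℝ (Fin n)) (b : Fin m → EuclideanSpace ℝ (Fin m))
    (lam : Fin n → ℝ) (α : Fin m) : EuclideanSpace ℝ (Fin n) × EuclideanSpace ℝ (Fin m) :=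
  (1 / √(1 + extendZero lam α ^ 2)) • (-(extendZero lam α • extendZero a α), b α)

/-- The components `h_{n+α, i k} = ⟨II(eᵢ, eₖ), e_{n+α}⟩` of the second fundamental form of `F` in
an adapted frame, read as `0` for `α ≥ m`. -/
def frameSFF (g₁ : MetricField (𝓡 n) S₁) (g₂ : MetricField (𝓡 m) S₂) (F : S → S₁ × S₂) (p : S)
    (a : Fin n → EuclideanSpace ℝ (Fin n)) (b : Fin m → EuclideanSpace ℝ (Fin m))
    (lam : Fin n → ℝ) (τ : Fin n → EuclideanSpace ℝ (Fin n)) (α : ℕ) (i k : Fin n) : ℝ :=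
  extendZero (fun β : Fin m =>
    MetricField.form (productMetric g₁ g₂) (F p)
      (secondFundamentalForm (𝓡 n) (productMetric g₁ g₂) (F := F) p (τ i) (τ k))
      (normalFrame a b lam β)) α

end Graphs

end GraphFlow

end

open GraphFlow

/-! In coordinates `*Ω₁` is `projJacobian`, the square root of a quotient of two Gram determinants:
that of the first metric pulled back by the projected immersion, over that of the induced metric.
Its logarithmic derivative, in space or in time, is therefore half the difference of two metric
traces (`hasDerivWithinAt_sqrt_gram_det_div`).

Because the submanifold is locally a graph, `π₁` is invertible on its tangent spaces. Let `P` be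
`π₁` followed by this inverse, so that `P (dF X) = X`, let `A` be the second fundamental form, and
put `S(X) = P A(X, ·)` (`shape`). In space, `d log *Ω₁ (X) = tr S(X)` (`fderiv_projJacobian`). The
projection is parallel for the product connection, so a second derivative gives `Δ*Ω₁ / *Ω₁ = ∑ᵢ (tr
S(eᵢ))² - ∑ᵢ tr (S(eᵢ)²) + ∑ᵢₖ ⟨P (∇ᵢA)(eₖ, eᵢ), eₖ⟩`. In time, the flow gives `∂ₜ log *Ω₁ = ∑ᵢₖ ⟨P
(∇ₖA)(eᵢ, eᵢ), eₖ⟩ + |H|²`. The Codazzi equation exchanges the two derivatives of `A` at the cost of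
ambient curvature and of a tangent vector, which `P` returns as the intrinsic curvature; the Gauss
equation rewrites the latter as ambient curvature, `|H|²` and `|A|²`. The terms `∇A` and `|H|²`
cancel. What survives is `|A|²`, the sum of `tr S² - (tr S)²`, and ambient curvature: this is
`hasDerivWithinAt_projJacobian`.

The rest of the formula is linear algebra in the adapted frame. A normal vector `v` satisfies `P v =
-∑ⱼ λⱼ ⟨v, eₙ₊ⱼ⟩ eⱼ` (`inverse_fst`); this yields the quadratic terms (`trace_comp_sub_sq`), and the
explicit curvature of the factors yields the last sum (`curvature_sum`).

The geometric objects are defined at each point in the preferred charts there, whereas the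
calculation needs one pair of charts for all nearby points and times. Independence of the charts
comes from `starOmega_eq` for the Jacobian and from `meanCurvatureVector_eq` for the velocity. Time
and space derivatives are interchanged up to the boundary time `0` by `hasDerivWithinAt_fderiv`. -/

noncomputable section

set_option maxSynthPendingDepth 3
set_option linter.unusedSectionVars false

namespace GraphFlow


/-! ### Inner products on a finite-dimensional space -/

section InnerForms

variable {E : Type*} [NormedAddCommGroup E] [NormedSpace ℝ E]

/-- Symmetric positive definite bilinear forms. -/
structure IsInner (B : E →L[ℝ] E →L[ℝ] ℝ) : Prop where
  symm : ∀ u v, B u v = B v u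
  pos : ∀ v, v ≠ 0 → 0 < B v v

theorem IsInner.eq_zero {B : E →L[ℝ] E →L[ℝ] ℝ} (hB : IsInner B) {v : E} (h : B v v = 0) :
    v = 0 := by
  by_contra hv
  exact (hB.pos v hv).ne' h

theorem IsInner.ext {B : E →L[ℝ] E →L[ℝ] ℝ} (hB : IsInner B) {v w : E}
    (h : ∀ z, B v z = B w z) : v = w := by
  rw [← sub_eq_zero]
  apply hB.eq_zero
  simp [h]

theorem IsInner.isInvertible [FiniteDimensional ℝ E] {B : E →L[ℝ] E →L[ℝ] ℝ} (hB : IsInner B) :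
    B.IsInvertible := by
  have hinj : Function.Injective B := fun v w h => hB.ext fun z => by rw [h]
  have hfr : Module.finrank ℝ E = Module.finrank ℝ (E →L[ℝ] ℝ) := by
    rw [← LinearMap.toContinuousLinearMap.finrank_eq (R := ℝ) (M := E →ₗ[ℝ] ℝ),
      Subspace.dual_finrank_eq]
  refine ⟨(LinearEquiv.ofInjectiveOfFinrankEq (B : E →ₗ[ℝ] E →L[ℝ] ℝ)
    hinj hfr).toContinuousLinearEquiv, ?_⟩
  ext v w
  rfl

theorem IsInner.apply_inverse [FiniteDimensional ℝ E] {B : E →L[ℝ] E →L[ℝ] ℝ} (hB : IsInner B)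
    (ℓ : E →L[ℝ] ℝ) (w : E) : B (B.inverse ℓ) w = ℓ w := by
  rw [hB.isInvertible.self_apply_inverse]

theorem IsInner.inverse_eq [FiniteDimensional ℝ E] {B : E →L[ℝ] E →L[ℝ] ℝ} (hB : IsInner B)
    {ℓ : E →L[ℝ] ℝ} {v : E} (h : ∀ w, B v w = ℓ w) : B.inverse ℓ = v :=
  hB.ext fun w => by rw [hB.apply_inverse, h]

theorem IsInner.bilinearComp {E' : Type*} [NormedAddCommGroup E'] [NormedSpace ℝ E']
    {B : E →L[ℝ] E →L[ℝ] ℝ} (hB : IsInner B) {T : E' →L[ℝ] E} (hT : Function.Injective T) :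
    IsInner (B.bilinearComp T T) where
  symm u v := by simpa using hB.symm _ _
  pos v hv := by
    simpa using hB.pos (T v) (by simpa using hT.ne hv)

end InnerForms

/-! ### Orthonormal frames, Gram matrices and metric traces. -/

section Frames

variable {n : ℕ} {B : EuclideanSpace ℝ (Fin n) →L[ℝ] EuclideanSpace ℝ (Fin n) →L[ℝ] ℝ}

theorem IsOrthonormal.linearIndependent {E : Type*} [NormedAddCommGroup E] [NormedSpace ℝ E]
    {B : E →L[ℝ] E →L[ℝ] ℝ} {N : ℕ} {v : Fin N → E} (hv : IsOrthonormal B v) :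
    LinearIndependent ℝ v := by
  rw [Fintype.linearIndependent_iff]
  intro c hc i
  have := congrArg (fun z => B z (v i)) hc
  simpa [hv _ _] using this

theorem IsInner.exists_isOrthonormal (hB : IsInner B) :
    ∃ τ : Fin n → EuclideanSpace ℝ (Fin n), IsOrthonormal B τ := by
  let B' : LinearMap.BilinForm ℝ (EuclideanSpace ℝ (Fin n)) := B.toBilinForm
  have hsymm : LinearMap.IsSymm B' := ⟨fun x y => hB.symm x y⟩
  obtain ⟨v, hv⟩ := LinearMap.BilinForm.exists_orthogonal_basis (B := B') hsymm
  have hfin : Module.finrank ℝ (EuclideanSpace ℝ (Fin n)) = n := by simp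
  let v' := v.reindex (finCongr hfin)
  have hpos : ∀ i, 0 < B (v' i) (v' i) := fun i => hB.pos _ (v'.ne_zero i)
  refine ⟨fun i => (√(B (v' i) (v' i)))⁻¹ • v' i, fun i j => ?_⟩
  split_ifs with h
  · subst h
    have := Real.mul_self_sqrt (hpos i).le
    have h0 := (Real.sqrt_pos.2 (hpos i)).ne'
    simp only [map_smul, smul_eq_mul, smul_apply]
    nth_rewrite 3 [← this]
    field_simp
  · have : B (v' i) (v' j) = 0 := by
      simp only [v', Module.Basis.reindex_apply]
      exact hv (i := (finCongr hfin).symm i) (j := (finCongr hfin).symm j) (by simpa using h)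
    simp [this]

/-- An orthonormal family of `n` vectors in `ℝⁿ`, as a basis. -/
def IsOrthonormal.basis {v : Fin n → EuclideanSpace ℝ (Fin n)} (hv : IsOrthonormal B v) :
    Module.Basis (Fin n) ℝ (EuclideanSpace ℝ (Fin n)) :=
  basisOfLinearIndependentOfCardEqFinrank' v hv.linearIndependent (by simp)

@[simp] theorem IsOrthonormal.basis_apply {v : Fin n → EuclideanSpace ℝ (Fin n)}
    (hv : IsOrthonormal B v) (i : Fin n) : hv.basis i = v i := by
  simp [IsOrthonormal.basis]

theorem IsOrthonormal.repr {v : Fin n → EuclideanSpace ℝ (Fin n)} (hv : IsOrthonormal B v)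
    (x : EuclideanSpace ℝ (Fin n)) (i : Fin n) : hv.basis.repr x i = B x (v i) := by
  conv_rhs => rw [← hv.basis.sum_repr x]
  simp [hv _ _]

theorem IsOrthonormal.sum_smul {v : Fin n → EuclideanSpace ℝ (Fin n)} (hv : IsOrthonormal B v)
    (x : EuclideanSpace ℝ (Fin n)) : ∑ i, B x (v i) • v i = x := by
  conv_rhs => rw [← hv.basis.sum_repr x]
  simp [hv.repr]

theorem IsOrthonormal.trace_eq {v : Fin n → EuclideanSpace ℝ (Fin n)} (hv : IsOrthonormal B v)
    (K : EuclideanSpace ℝ (Fin n) →ₗ[ℝ] EuclideanSpace ℝ (Fin n)) :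
    LinearMap.trace ℝ _ K = ∑ i, B (K (v i)) (v i) := by
  rw [LinearMap.trace_eq_matrix_trace ℝ hv.basis, Matrix.trace]
  simp [LinearMap.toMatrix_apply, hv.repr]

theorem apply_eq_sum_gram (B : EuclideanSpace ℝ (Fin n) →L[ℝ] EuclideanSpace ℝ (Fin n) →L[ℝ] ℝ)
    (x y : EuclideanSpace ℝ (Fin n)) :
    B x y = ∑ i, ∑ j, x i * gram B i j * y j := by
  have hx := (EuclideanSpace.basisFun (Fin n) ℝ).sum_repr x
  have hy := (EuclideanSpace.basisFun (Fin n) ℝ).sum_repr y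
  conv_lhs => rw [← hx, ← hy]
  simp only [map_sum, map_smul, sum_apply, smul_apply,
    smul_eq_mul, gram, Matrix.of_apply, EuclideanSpace.basisFun_repr, Finset.mul_sum]
  rw [Finset.sum_comm]
  refine Finset.sum_congr rfl fun i _ => Finset.sum_congr rfl fun j _ => by ring

theorem IsInner.gram_posDef (hB : IsInner B) : (gram B).PosDef := by
  refine Matrix.PosDef.of_dotProduct_mulVec_pos ?_ ?_
  · ext i j
    simpa [gram] using hB.symm _ _
  · intro x hx
    have h := hB.pos (WithLp.toLp 2 x) (by simpa using hx)
    rw [apply_eq_sum_gram] at h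
    simpa [dotProduct, Matrix.mulVec, Finset.mul_sum, mul_assoc] using h

theorem IsInner.gram_det_pos (hB : IsInner B) : 0 < (gram B).det := hB.gram_posDef.det_pos

theorem gram_bilinearComp
    (B : EuclideanSpace ℝ (Fin n) →L[ℝ] EuclideanSpace ℝ (Fin n) →L[ℝ] ℝ)
    (T : EuclideanSpace ℝ (Fin n) →L[ℝ] EuclideanSpace ℝ (Fin n)) :
    gram (B.bilinearComp T T) =
      (LinearMap.toMatrix (EuclideanSpace.basisFun (Fin n) ℝ).toBasis
          (EuclideanSpace.basisFun (Fin n) ℝ).toBasis (T : _ →ₗ[ℝ] _)).transpose * gram B *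
        LinearMap.toMatrix (EuclideanSpace.basisFun (Fin n) ℝ).toBasis
          (EuclideanSpace.basisFun (Fin n) ℝ).toBasis (T : _ →ₗ[ℝ] _) := by
  ext i j
  rw [gram, Matrix.of_apply, ContinuousLinearMap.bilinearComp_apply, apply_eq_sum_gram,
    Finset.sum_comm]
  simp [Matrix.mul_apply, LinearMap.toMatrix_apply, Finset.sum_mul]

/-- Gram determinants of all metrics scale by the same squared determinant under a change of
coordinates, so their quotients are invariant. -/
theorem gram_bilinearComp_det
    (B : EuclideanSpace ℝ (Fin n) →L[ℝ] EuclideanSpace ℝ (Fin n) →L[ℝ] ℝ)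
    (T : EuclideanSpace ℝ (Fin n) →L[ℝ] EuclideanSpace ℝ (Fin n)) :
    (gram (B.bilinearComp T T)).det =
      LinearMap.det (T : EuclideanSpace ℝ (Fin n) →ₗ[ℝ] EuclideanSpace ℝ (Fin n)) ^ 2 *
        (gram B).det := by
  rw [gram_bilinearComp, Matrix.det_mul, Matrix.det_mul, Matrix.det_transpose,
    LinearMap.det_toMatrix]
  ring

/-- If `C` has the frame vectors as columns, orthonormality is `Cᵀ * gram B * C = 1`, whence the
inverse Gram matrix is `C * Cᵀ`. This converts traces taken with the inverse metric into sums over a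
frame. -/
theorem IsOrthonormal.inv_gram_apply {v : Fin n → EuclideanSpace ℝ (Fin n)}
    (hv : IsOrthonormal B v) (i j : Fin n) : (gram B)⁻¹ i j = ∑ k, v k i * v k j := by
  let C : Matrix (Fin n) (Fin n) ℝ := Matrix.of fun i k => v k i
  have hC : C.transpose * gram B * C = 1 := by
    ext k l
    have := hv k l
    rw [apply_eq_sum_gram, Finset.sum_comm] at this
    simpa [C, Matrix.mul_apply, Finset.sum_mul, Matrix.one_apply] using this
  have h1 : C * (C.transpose * gram B) = 1 := mul_eq_one_comm.1 hC
  rw [Matrix.inv_eq_left_inv (B := C * C.transpose) (by rw [Matrix.mul_assoc, h1])]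
  rfl

theorem bilin_apply_eq_sum {W : Type*} [NormedAddCommGroup W] [NormedSpace ℝ W]
    (T : EuclideanSpace ℝ (Fin n) →L[ℝ] EuclideanSpace ℝ (Fin n) →L[ℝ] W)
    (x y : EuclideanSpace ℝ (Fin n)) :
    T x y = ∑ i, ∑ j, (x i * y j) •
      T (EuclideanSpace.basisFun (Fin n) ℝ i) (EuclideanSpace.basisFun (Fin n) ℝ j) := by
  have hx := (EuclideanSpace.basisFun (Fin n) ℝ).sum_repr x
  have hy := (EuclideanSpace.basisFun (Fin n) ℝ).sum_repr y
  conv_lhs => rw [← hx, ← hy]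
  simp only [map_sum, map_smul, sum_apply, smul_apply, Finset.smul_sum, smul_smul,
    EuclideanSpace.basisFun_repr]
  rw [Finset.sum_comm]
  refine Finset.sum_congr rfl fun i _ => Finset.sum_congr rfl fun j _ => by rw [mul_comm]

theorem IsOrthonormal.metricTrace_eq {W : Type*} [NormedAddCommGroup W] [NormedSpace ℝ W]
    {v : Fin n → EuclideanSpace ℝ (Fin n)} (hv : IsOrthonormal B v)
    (T : EuclideanSpace ℝ (Fin n) →L[ℝ] EuclideanSpace ℝ (Fin n) →L[ℝ] W) :
    metricTrace B (fun X Y => T X Y) = ∑ i, T (v i) (v i) := by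
  simp only [fun k => bilin_apply_eq_sum T (v k) (v k), metricTrace, hv.inv_gram_apply,
    Finset.sum_smul]
  conv_rhs => rw [Finset.sum_comm]
  refine Finset.sum_congr rfl fun i _ => ?_
  conv_rhs => rw [Finset.sum_comm]

/-- `K` carries a frame orthonormal for the pulled-back form to one orthonormal for `B`. It is used
to change the chart of the submanifold. -/
theorem IsInner.metricTrace_bilinearComp {W : Type*} [NormedAddCommGroup W] [NormedSpace ℝ W]
    (hB : IsInner B) {K : EuclideanSpace ℝ (Fin n) →L[ℝ] EuclideanSpace ℝ (Fin n)}
    (hK : Function.Injective K)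
    (T : EuclideanSpace ℝ (Fin n) →L[ℝ] EuclideanSpace ℝ (Fin n) →L[ℝ] W) :
    metricTrace (B.bilinearComp K K) (fun X Y => T (K X) (K Y)) =
      metricTrace B (fun X Y => T X Y) := by
  obtain ⟨v, hv⟩ := (hB.bilinearComp hK).exists_isOrthonormal
  have hv' : IsOrthonormal B (fun i => K (v i)) := fun i j => by simpa using hv i j
  rw [hv'.metricTrace_eq T]
  exact hv.metricTrace_eq (T.bilinearComp K K)

/-- In an orthonormal frame each diagonal value of `B'` is `2 B (K v) v`. With `B'` the derivative
of a metric and `K` a connection operator compatible with it, half the metric trace is `tr K`. -/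
theorem IsInner.metricTrace_compat (hB : IsInner B)
    (K : EuclideanSpace ℝ (Fin n) →L[ℝ] EuclideanSpace ℝ (Fin n))
    {B' : EuclideanSpace ℝ (Fin n) →L[ℝ] EuclideanSpace ℝ (Fin n) →L[ℝ] ℝ}
    (h : ∀ X Y, B' X Y = B (K X) Y + B X (K Y)) :
    metricTrace B (fun X Y => B' X Y) = 2 * LinearMap.trace ℝ (EuclideanSpace ℝ (Fin n)) K := by
  obtain ⟨v, hv⟩ := hB.exists_isOrthonormal
  rw [hv.metricTrace_eq, hv.trace_eq, Finset.mul_sum]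
  refine Finset.sum_congr rfl fun i _ => ?_
  rw [h, hB.symm (v i)]
  simp only [ContinuousLinearMap.coe_coe]
  ring

end Frames


/-! ### Derivatives of determinants and traces -/

section MatrixCalculus

variable {n : ℕ} {s : Set ℝ} {t : ℝ}

/-- Jacobi's formula: differentiating the Leibniz expansion replaces one column at a time by that of
`M'`, and by Cramer's rule the determinant with column `i` replaced is the `i`-th diagonal entry of
`adjugate * M'`. -/
theorem hasDerivWithinAt_det {M : ℝ → Matrix (Fin n) (Fin n) ℝ} {M' : Matrix (Fin n) (Fin n) ℝ}
    (h : ∀ i j, HasDerivWithinAt (fun t => M t i j) (M' i j) s t) :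
    HasDerivWithinAt (fun t => (M t).det) ((M t).adjugate * M').trace s t := by
  have h1 : HasDerivWithinAt (fun t => (M t).det)
      (∑ σ : Equiv.Perm (Fin n), Equiv.Perm.sign σ •
        ∑ i, (∏ j ∈ Finset.univ.erase i, M t (σ j) j) • M' (σ i) i) s t := by
    simp only [Matrix.det_apply]
    refine HasDerivWithinAt.fun_sum fun σ _ => ?_
    have := HasDerivWithinAt.fun_finsetProd (u := Finset.univ)
      (f := fun i t => M t (σ i) i) (f' := fun i => M' (σ i) i) (fun i _ => h (σ i) i)
    simpa [Units.smul_def, Int.smul_one_eq_cast] using this.const_mul ((Equiv.Perm.sign σ : ℤ) : ℝ)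
  convert h1 using 1
  have h2 : ∀ i, ((M t).adjugate * M') i i = ((M t).updateCol i (fun k => M' k i)).det := fun i => by
    rw [← Matrix.cramer_apply, Matrix.cramer_eq_adjugate_mulVec]
    rfl
  simp only [Matrix.trace, Matrix.diag, h2, Matrix.det_apply, Finset.smul_sum]
  rw [Finset.sum_comm]
  refine Finset.sum_congr rfl fun σ _ => Finset.sum_congr rfl fun i _ => ?_
  congr 1
  rw [← Finset.prod_erase_mul _ _ (Finset.mem_univ i), smul_eq_mul]
  congr 1
  · refine Finset.prod_congr rfl fun j hj => ?_
    simp [Finset.ne_of_mem_erase hj]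
  · simp

theorem hasDerivWithinAt_matrix_inv {M : ℝ → Matrix (Fin n) (Fin n) ℝ}
    {M' : Matrix (Fin n) (Fin n) ℝ} (h0 : IsUnit (M t).det)
    (h : ∀ i j, HasDerivWithinAt (fun t => M t i j) (M' i j) s t) (i j : Fin n) :
    HasDerivWithinAt (fun t => (M t)⁻¹ i j) (-((M t)⁻¹ * M' * (M t)⁻¹) i j) s t := by
  -- A submultiplicative norm is chosen only to differentiate inversion; hypothesis and conclusion
  -- are entrywise and do not depend on it.
  let : NormedRing (Matrix (Fin n) (Fin n) ℝ) := Matrix.linftyOpNormedRing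
  let : NormedAlgebra ℝ (Matrix (Fin n) (Fin n) ℝ) := Matrix.linftyOpNormedAlgebra
  obtain ⟨U, hU⟩ := (Matrix.isUnit_iff_isUnit_det _).2 h0
  have hM : HasDerivWithinAt M M' s t := by
    have h1 : HasDerivWithinAt (fun t => ∑ i, ∑ j, M t i j • Matrix.single i j (1 : ℝ))
        (∑ i, ∑ j, M' i j • Matrix.single i j (1 : ℝ)) s t :=
      HasDerivWithinAt.fun_sum fun i _ => HasDerivWithinAt.fun_sum fun j _ => (h i j).smul_const _
    have h2 : ∀ A : Matrix (Fin n) (Fin n) ℝ, ∑ i, ∑ j, A i j • Matrix.single i j (1 : ℝ) = A :=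
      fun A => by
        conv_rhs => rw [Matrix.matrix_eq_sum_single A]
        simp
    simpa only [h2] using h1
  have h1 : HasFDerivAt (Ring.inverse : Matrix (Fin n) (Fin n) ℝ → _) _ (M t) :=
    hU ▸ hasFDerivAt_ringInverse (𝕜 := ℝ) U
  have h2 := h1.comp_hasDerivWithinAt t hM
  let L : Matrix (Fin n) (Fin n) ℝ →L[ℝ] ℝ := LinearMap.toContinuousLinearMap
    { toFun := fun A => A i j, map_add' := fun _ _ => rfl, map_smul' := fun _ _ => rfl }
  have h3 := (L.hasFDerivAt (x := Ring.inverse (M t))).comp_hasDerivWithinAt t h2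
  have h4 : ((U⁻¹ : (Matrix (Fin n) (Fin n) ℝ)ˣ) : Matrix (Fin n) (Fin n) ℝ) = (M t)⁻¹ := by
    rw [← hU, Matrix.coe_units_inv]
  have h5 : (fun t => (M t)⁻¹ i j) = L ∘ (Ring.inverse ∘ M) := by
    funext t
    rw [Matrix.nonsing_inv_eq_ringInverse]
    rfl
  rw [h5, ← h4]
  exact h3

variable {W : Type*} [NormedAddCommGroup W] [NormedSpace ℝ W]
  {B : ℝ → EuclideanSpace ℝ (Fin n) →L[ℝ] EuclideanSpace ℝ (Fin n) →L[ℝ] ℝ}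
  {B' : EuclideanSpace ℝ (Fin n) →L[ℝ] EuclideanSpace ℝ (Fin n) →L[ℝ] ℝ}

theorem hasDerivWithinAt_apply₂ {E : Type*} [NormedAddCommGroup E] [NormedSpace ℝ E]
    {T : ℝ → E →L[ℝ] E →L[ℝ] W} {T' : E →L[ℝ] E →L[ℝ] W} (h : HasDerivWithinAt T T' s t) (X Y : E) :
    HasDerivWithinAt (fun t => T t X Y) (T' X Y) s t := by
  have h1 := h.clm_apply (hasDerivWithinAt_const t s X)
  simpa using h1.clm_apply (hasDerivWithinAt_const t s Y)

theorem hasDerivWithinAt_gram_det (hB : IsInner (B t)) (h : HasDerivWithinAt B B' s t) :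
    HasDerivWithinAt (fun t => (gram (B t)).det)
      ((gram (B t)).det * metricTrace (B t) (fun X Y => B' X Y)) s t := by
  have h0 := hB.gram_det_pos.ne'
  have h1 := hasDerivWithinAt_det (M := fun t => gram (B t)) (M' := gram B') (s := s) (t := t)
    (fun i j => hasDerivWithinAt_apply₂ h _ _)
  convert h1 using 1
  have hadj : (gram (B t)).adjugate = (gram (B t)).det • (gram (B t))⁻¹ := by
    rw [Matrix.inv_def, smul_smul, Ring.mul_inverse_cancel _ (isUnit_iff_ne_zero.2 h0), one_smul]
  -- The matrix trace pairs the entry `(i, j)` of the inverse with the entry `(j, i)` of `B'`, the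
  -- metric trace pairs equal positions; symmetry of the inverse reconciles them.
  have hsymm : ((gram (B t))⁻¹).transpose = (gram (B t))⁻¹ := by
    rw [Matrix.transpose_nonsing_inv]
    congr 1
    ext i j
    simpa [gram] using hB.symm _ _
  rw [hadj, Matrix.smul_mul, Matrix.trace_smul, smul_eq_mul, metricTrace, Matrix.trace]
  congr 1
  simp only [Matrix.diag, Matrix.mul_apply, smul_eq_mul]
  rw [Finset.sum_comm]
  refine Finset.sum_congr rfl fun i _ => Finset.sum_congr rfl fun j _ => ?_
  rw [← hsymm, Matrix.transpose_apply, hsymm]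
  rfl

/-- The logarithmic derivative of each determinant is a metric trace, and the square root halves
their difference. Both the space and the time derivative of `*Ω₁` come from here. -/
theorem hasDerivWithinAt_sqrt_gram_det_div
    {P : ℝ → EuclideanSpace ℝ (Fin n) →L[ℝ] EuclideanSpace ℝ (Fin n) →L[ℝ] ℝ}
    {P' : EuclideanSpace ℝ (Fin n) →L[ℝ] EuclideanSpace ℝ (Fin n) →L[ℝ] ℝ}
    (hP : IsInner (P t)) (hB : IsInner (B t))
    (hP' : HasDerivWithinAt P P' s t) (hB' : HasDerivWithinAt B B' s t) :
    HasDerivWithinAt (fun t => √((gram (P t)).det / (gram (B t)).det))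
      (√((gram (P t)).det / (gram (B t)).det) *
        ((metricTrace (P t) (fun X Y => P' X Y) - metricTrace (B t) (fun X Y => B' X Y)) / 2))
      s t := by
  have h1 := hP.gram_det_pos
  have h2 := hB.gram_det_pos
  have h3 := ((hasDerivWithinAt_gram_det hP hP').fun_div (hasDerivWithinAt_gram_det hB hB')
    h2.ne').sqrt (div_pos h1 h2).ne'
  convert h3 using 1
  have h4 := Real.mul_self_sqrt (div_pos h1 h2).le
  have h5 := (Real.sqrt_pos.2 (div_pos h1 h2)).ne'
  generalize √((gram (P t)).det / (gram (B t)).det) = r at *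
  field_simp at h4 ⊢
  linear_combination
    (metricTrace (P t) (fun X Y => P' X Y) - metricTrace (B t) (fun X Y => B' X Y)) * h4

/-- The inverse metric varies by `-B⁻¹ B' B⁻¹`; once `B'` is written through `K`, this subtracts
`T(K v, v) + T(v, K v)`. For `K` a Levi-Civita operator the summand is the connection-corrected
derivative of `T`, so trace and covariant derivative commute. -/
theorem hasDerivWithinAt_metricTrace (hB : IsInner (B t)) (hB' : HasDerivWithinAt B B' s t)
    {T : ℝ → EuclideanSpace ℝ (Fin n) →L[ℝ] EuclideanSpace ℝ (Fin n) →L[ℝ] W}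
    {T' : EuclideanSpace ℝ (Fin n) →L[ℝ] EuclideanSpace ℝ (Fin n) →L[ℝ] W}
    (hT : HasDerivWithinAt T T' s t)
    {K : EuclideanSpace ℝ (Fin n) →L[ℝ] EuclideanSpace ℝ (Fin n)}
    (hK : ∀ X Y, B' X Y = B t (K X) Y + B t X (K Y))
    {v : Fin n → EuclideanSpace ℝ (Fin n)} (hv : IsOrthonormal (B t) v) :
    HasDerivWithinAt (fun t => metricTrace (B t) (fun X Y => T t X Y))
      (∑ i, (T' (v i) (v i) - T t (K (v i)) (v i) - T t (v i) (K (v i)))) s t := by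
  have h1 : HasDerivWithinAt (fun t => metricTrace (B t) (fun X Y => T t X Y)) _ s t :=
    HasDerivWithinAt.fun_sum fun i (_ : i ∈ Finset.univ) =>
      HasDerivWithinAt.fun_sum fun j (_ : j ∈ Finset.univ) =>
        (hasDerivWithinAt_matrix_inv (M := fun t => gram (B t)) (M' := gram B')
          (isUnit_iff_ne_zero.2 hB.gram_det_pos.ne') (fun i j => hasDerivWithinAt_apply₂ hB' _ _)
          i j).fun_smul (hasDerivWithinAt_apply₂ hT (EuclideanSpace.basisFun (Fin n) ℝ i)
            (EuclideanSpace.basisFun (Fin n) ℝ j))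
  convert h1 using 1
  -- With `B⁻¹ = C * Cᵀ` the triple product regroups as `C * (Cᵀ B' C) * Cᵀ`, whose middle factor is
  -- the matrix of `B'` in the frame.
  have h2 : ∀ i j, ((gram (B t))⁻¹ * gram B' * (gram (B t))⁻¹) i j =
      ∑ k, ∑ l, (v k i * v l j) * B' (v k) (v l) := fun i j => by
    let C : Matrix (Fin n) (Fin n) ℝ := Matrix.of fun i k => v k i
    have hN : (gram (B t))⁻¹ = C * C.transpose := by
      ext i j
      rw [hv.inv_gram_apply]
      rfl
    have hQ : C.transpose * gram B' * C = Matrix.of fun k l => B' (v k) (v l) := by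
      ext k l
      rw [Matrix.of_apply, apply_eq_sum_gram, Finset.sum_comm]
      simp [C, Matrix.mul_apply, Finset.sum_mul]
    have : C * C.transpose * gram B' * (C * C.transpose) =
        C * (C.transpose * gram B' * C) * C.transpose := by
      simp only [Matrix.mul_assoc]
    rw [hN, this, hQ]
    simp only [Matrix.mul_apply, Matrix.of_apply, Finset.sum_mul, Matrix.transpose_apply, C]
    rw [Finset.sum_comm]
    refine Finset.sum_congr rfl fun k _ => Finset.sum_congr rfl fun l _ => by ring
  have h3 : ∑ k, ∑ l, B' (v k) (v l) • T t (v k) (v l) =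
      ∑ k, (T t (K (v k)) (v k) + T t (v k) (K (v k))) := by
    simp only [hK, add_smul, Finset.sum_add_distrib]
    rw [add_comm]
    congr 1
    · rw [Finset.sum_comm]
      refine Finset.sum_congr rfl fun l _ => ?_
      conv_rhs => rw [← hv.sum_smul (K (v l))]
      simp [hB.symm]
    · refine Finset.sum_congr rfl fun k _ => ?_
      conv_rhs => rw [← hv.sum_smul (K (v k))]
      simp
  have h4 : ∑ i, ∑ j, ((gram (B t))⁻¹ * gram B' * (gram (B t))⁻¹) i j •
      T t (EuclideanSpace.basisFun (Fin n) ℝ i) (EuclideanSpace.basisFun (Fin n) ℝ j) =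
      ∑ k, ∑ l, B' (v k) (v l) • T t (v k) (v l) := by
    simp only [h2, fun k l => bilin_apply_eq_sum (T t) (v k) (v l), Finset.smul_sum, smul_smul,
      Finset.sum_smul]
    conv_lhs => enter [2, i]; rw [Finset.sum_comm]
    rw [Finset.sum_comm]
    refine Finset.sum_congr rfl fun k _ => ?_
    conv_lhs => enter [2, i]; rw [Finset.sum_comm]
    rw [Finset.sum_comm]
    refine Finset.sum_congr rfl fun l _ => Finset.sum_congr rfl fun i _ =>
      Finset.sum_congr rfl fun j _ => by rw [mul_comm]
  have h5 := hv.metricTrace_eq T'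
  simp only [Finset.sum_add_distrib, neg_smul, Finset.sum_neg_distrib]
  rw [h4, h3, ← sub_eq_add_neg]
  change _ = metricTrace (B t) (fun X Y => T' X Y) - _
  rw [h5, ← Finset.sum_sub_distrib]
  refine Finset.sum_congr rfl fun i _ => by abel

end MatrixCalculus


/-! ### Riemannian metrics on open subsets of a vector space -/

section LocalMetrics

variable {D E F W : Type*} [NormedAddCommGroup D] [NormedSpace ℝ D]
  [NormedAddCommGroup E] [NormedSpace ℝ E] [NormedAddCommGroup F] [NormedSpace ℝ F]
  [NormedAddCommGroup W] [NormedSpace ℝ W]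

theorem fderiv_apply₂ {T : D → E →L[ℝ] F →L[ℝ] W} {q : D} (hT : DifferentiableAt ℝ T q)
    (X : E) (Y : F) (Z : D) : fderiv ℝ (fun q => T q X Y) q Z = fderiv ℝ T q Z X Y := by
  have h1 := hT.hasFDerivAt.clm_apply (hasFDerivAt_const X q)
  have h2 := h1.clm_apply (hasFDerivAt_const Y q)
  rw [h2.fderiv]
  simp

/-- The swapping of the arguments of a bilinear map, as a continuous linear map. -/
def flipCLM (E F W : Type*) [NormedAddCommGroup E] [NormedSpace ℝ E] [NormedAddCommGroup F]
    [NormedSpace ℝ F] [NormedAddCommGroup W] [NormedSpace ℝ W] :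
    (E →L[ℝ] F →L[ℝ] W) →L[ℝ] F →L[ℝ] E →L[ℝ] W :=
  ((ContinuousLinearMap.flipₗᵢ ℝ E F W).toContinuousLinearEquiv :
    (E →L[ℝ] F →L[ℝ] W) →L[ℝ] F →L[ℝ] E →L[ℝ] W)

@[simp] theorem flipCLM_apply (B : E →L[ℝ] F →L[ℝ] W) : flipCLM E F W B = B.flip := rfl

theorem _root_.ContDiffOn.bilinearComp {B : D → F →L[ℝ] F →L[ℝ] W} {S : D → E →L[ℝ] F} {O : Set D}
    {k : ℕ∞ω} (hB : ContDiffOn ℝ k B O) (hS : ContDiffOn ℝ k S O) :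
    ContDiffOn ℝ k (fun q => (B q).bilinearComp (S q) (S q)) O := by
  have h1 : ContDiffOn ℝ k (fun q => (((B q).comp (S q)).flip.comp (S q)).flip) O := by
    refine (flipCLM E E W).contDiff.comp_contDiffOn ?_
    refine ContDiffOn.clm_comp ?_ hS
    exact (flipCLM E F W).contDiff.comp_contDiffOn (hB.clm_comp hS)
  exact h1

theorem fderiv_bilinearComp {B : D → F →L[ℝ] F →L[ℝ] W} {S : D → E →L[ℝ] F} {q : D}
    (hB : DifferentiableAt ℝ B q) (hS : DifferentiableAt ℝ S q)
    (hBS : DifferentiableAt ℝ (fun q => (B q).bilinearComp (S q) (S q)) q) (Z : D) (X Y : E) :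
    fderiv ℝ (fun q => (B q).bilinearComp (S q) (S q)) q Z X Y =
      fderiv ℝ B q Z (S q X) (S q Y) + B q (fderiv ℝ S q Z X) (S q Y)
        + B q (S q X) (fderiv ℝ S q Z Y) := by
  rw [← fderiv_apply₂ hBS]
  have h1 := hS.hasFDerivAt.clm_apply (hasFDerivAt_const X q)
  have h2 := hS.hasFDerivAt.clm_apply (hasFDerivAt_const Y q)
  have h3 := (hB.hasFDerivAt.clm_apply h1).clm_apply h2
  simp only [ContinuousLinearMap.bilinearComp_apply]
  rw [h3.fderiv]
  simp
  abel

/-- A smooth Riemannian metric on an open subset of a vector space. -/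
structure IsLocalMetric (G : E → E →L[ℝ] E →L[ℝ] ℝ) (U : Set E) : Prop where
  isOpen : IsOpen U
  smooth : ContDiffOn ℝ ∞ G U
  inner : ∀ y ∈ U, IsInner (G y)

/-- The Christoffel symbols as a continuous bilinear map. -/
def christoffelL (G : E → E →L[ℝ] E →L[ℝ] ℝ) (x : E) : E →L[ℝ] E →L[ℝ] E :=
  (ContinuousLinearMap.compL ℝ E (E →L[ℝ] ℝ) E (G x).inverse).comp
    ((1 / 2 : ℝ) • (fderiv ℝ G x + (fderiv ℝ G x).flip
      - (flipCLM E E ℝ).comp (fderiv ℝ G x).flip))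

theorem christoffelL_apply (G : E → E →L[ℝ] E →L[ℝ] ℝ) (x u v : E) :
    christoffelL G x u v = christoffel G x u v := rfl

namespace IsLocalMetric

variable {G : E → E →L[ℝ] E →L[ℝ] ℝ} {U : Set E} {x : E}

theorem contDiffAt (h : IsLocalMetric G U) (hx : x ∈ U) : ContDiffAt ℝ ∞ G x :=
  h.smooth.contDiffAt (h.isOpen.mem_nhds hx)

theorem differentiableAt (h : IsLocalMetric G U) (hx : x ∈ U) : DifferentiableAt ℝ G x :=
  (h.contDiffAt hx).differentiableAt (by simp)

theorem fderiv_symm (h : IsLocalMetric G U) (hx : x ∈ U) (u v w : E) :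
    fderiv ℝ G x u v w = fderiv ℝ G x u w v := by
  rw [← fderiv_apply₂ (h.differentiableAt hx), ← fderiv_apply₂ (h.differentiableAt hx)]
  congr 1
  apply Filter.EventuallyEq.fderiv_eq
  filter_upwards [h.isOpen.mem_nhds hx] with y hy
  exact (h.inner y hy).symm v w

theorem christoffelFirst_symm (h : IsLocalMetric G U) (hx : x ∈ U) (u v : E) :
    christoffelFirst G x u v = christoffelFirst G x v u := by
  ext w
  simp only [christoffelFirst, smul_apply, sub_apply, add_apply, ContinuousLinearMap.flip_apply]
  rw [h.fderiv_symm hx w u v, add_comm]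

theorem christoffel_symm (h : IsLocalMetric G U) (hx : x ∈ U) (u v : E) :
    christoffel G x u v = christoffel G x v u := by
  rw [christoffel, h.christoffelFirst_symm hx, christoffel]

theorem smooth_christoffel [FiniteDimensional ℝ E] (h : IsLocalMetric G U) :
    ContDiffOn ℝ ∞ (christoffelL G) U := by
  have h1 : ContDiffOn ℝ ∞ (fderiv ℝ G) U := h.smooth.fderiv_of_isOpen h.isOpen (by simp)
  have h2 : ContDiffOn ℝ ∞ (fun x => (fderiv ℝ G x).flip) U :=
    (flipCLM E E (E →L[ℝ] ℝ)).contDiff.comp_contDiffOn h1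
  have h3 : ContDiffOn ℝ ∞ (fun x => (G x).inverse) U := fun x hx =>
    ((h.inner x hx).isInvertible.contDiffAt_map_inverse (n := ∞)).comp_contDiffWithinAt x
      (h.smooth x hx)
  refine ContDiffOn.clm_comp ?_ ?_
  · exact (ContinuousLinearMap.compL ℝ E (E →L[ℝ] ℝ) E).contDiff.comp_contDiffOn h3
  · exact ContDiffOn.const_smul _ ((h1.add h2).sub (contDiffOn_const.clm_comp h2))

theorem apply_christoffel [FiniteDimensional ℝ E] (h : IsLocalMetric G U) (hx : x ∈ U)
    (u v w : E) : G x (christoffel G x u v) w = christoffelFirst G x u v w :=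
  (h.inner x hx).apply_inverse _ _

/-- In the sum of the two symbols of the first kind the derivatives in the directions `u` and `v`
cancel and the two halves of `∂_z G(u, v)` add up: the Levi-Civita connection is metric. -/
theorem compat [FiniteDimensional ℝ E] (h : IsLocalMetric G U) (hx : x ∈ U) (z u v : E) :
    fderiv ℝ G x z u v = G x (christoffel G x z u) v + G x u (christoffel G x z v) := by
  rw [(h.inner x hx).symm u, h.apply_christoffel hx, h.apply_christoffel hx]
  simp only [christoffelFirst, smul_apply, sub_apply, add_apply, ContinuousLinearMap.flip_apply,
    smul_eq_mul]
  rw [h.fderiv_symm hx z v u, h.fderiv_symm hx v z u, h.fderiv_symm hx u z v]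
  ring

theorem curvature_eq [FiniteDimensional ℝ E] (h : IsLocalMetric G U) (hx : x ∈ U) (u v w : E) :
    curvature G x u v w = fderiv ℝ (christoffelL G) x u v w - fderiv ℝ (christoffelL G) x v u w
      + christoffelL G x u (christoffelL G x v w) - christoffelL G x v (christoffelL G x u w) := by
  have hd : DifferentiableAt ℝ (christoffelL G) x :=
    (h.smooth_christoffel.contDiffAt (h.isOpen.mem_nhds hx)).differentiableAt (by simp)
  rw [← fderiv_apply₂ hd, ← fderiv_apply₂ hd]
  rfl

end IsLocalMetric

end LocalMetrics

/-! ### Immersed submanifolds in coordinates -/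

section LocalImmersions

variable {E E' : Type*} [NormedAddCommGroup E'] [NormedSpace ℝ E']
  [NormedAddCommGroup E] [NormedSpace ℝ E]

/-- The pull-back of a metric. -/
def pullMetric (u : E → E') (G : E' → E' →L[ℝ] E' →L[ℝ] ℝ) (q : E) : E →L[ℝ] E →L[ℝ] ℝ :=
  (G (u q)).bilinearComp (fderiv ℝ u q) (fderiv ℝ u q)

/-- A smooth immersion of an open set into a Riemannian open set. -/
structure IsLocalImmersion (u : E → E') (O : Set E) (G : E' → E' →L[ℝ] E' →L[ℝ] ℝ) (U : Set E') :
    Prop where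
  metric : IsLocalMetric G U
  isOpen : IsOpen O
  smooth : ContDiffOn ℝ ∞ u O
  mapsTo : MapsTo u O U
  injective : ∀ q ∈ O, Function.Injective (fderiv ℝ u q)

/-- The second derivative of a map, corrected by the Christoffel symbols of the target. -/
def covHess (u : E → E') (G : E' → E' →L[ℝ] E' →L[ℝ] ℝ) (q : E) : E →L[ℝ] E →L[ℝ] E' :=
  fderiv ℝ (fderiv ℝ u) q + (christoffelL G (u q)).bilinearComp (fderiv ℝ u q) (fderiv ℝ u q)

/-- The second fundamental form `∇du` of an immersion. -/
def sff (u : E → E') (G : E' → E' →L[ℝ] E' →L[ℝ] ℝ) (q : E) : E →L[ℝ] E →L[ℝ] E' :=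
  covHess u G q -
    (ContinuousLinearMap.compL ℝ E E E' (fderiv ℝ u q)).comp (christoffelL (pullMetric u G) q)

/-- The covariant derivative `(∇_Z A)(X, Y)` of the second fundamental form `A`. -/
def nablaSff (u : E → E') (G : E' → E' →L[ℝ] E' →L[ℝ] ℝ) (q Z X Y : E) : E' :=
  fderiv ℝ (sff u G) q Z X Y + christoffelL G (u q) (fderiv ℝ u q Z) (sff u G q X Y)
    - sff u G q (christoffelL (pullMetric u G) q Z X) Y
    - sff u G q X (christoffelL (pullMetric u G) q Z Y)

theorem pullMetric_apply (u : E → E') (G : E' → E' →L[ℝ] E' →L[ℝ] ℝ) (q X Y : E) :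
    pullMetric u G q X Y = G (u q) (fderiv ℝ u q X) (fderiv ℝ u q Y) := rfl

theorem covHess_apply (u : E → E') (G : E' → E' →L[ℝ] E' →L[ℝ] ℝ) (q X Y : E) :
    covHess u G q X Y = fderiv ℝ (fderiv ℝ u) q X Y
      + christoffelL G (u q) (fderiv ℝ u q X) (fderiv ℝ u q Y) := rfl

theorem sff_apply (u : E → E') (G : E' → E' →L[ℝ] E' →L[ℝ] ℝ) (q X Y : E) :
    sff u G q X Y = covHess u G q X Y
      - fderiv ℝ u q (christoffelL (pullMetric u G) q X Y) := rfl

namespace IsLocalImmersion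

variable {u : E → E'} {O : Set E} {G : E' → E' →L[ℝ] E' →L[ℝ] ℝ} {U : Set E'} {q : E}

theorem contDiffAt (h : IsLocalImmersion u O G U) (hq : q ∈ O) : ContDiffAt ℝ ∞ u q :=
  h.smooth.contDiffAt (h.isOpen.mem_nhds hq)

theorem differentiableAt (h : IsLocalImmersion u O G U) (hq : q ∈ O) : DifferentiableAt ℝ u q :=
  (h.contDiffAt hq).differentiableAt (by simp)

theorem smooth_fderiv (h : IsLocalImmersion u O G U) : ContDiffOn ℝ ∞ (fderiv ℝ u) O :=
  h.smooth.fderiv_of_isOpen h.isOpen (by simp)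

theorem smooth_fderiv₂ (h : IsLocalImmersion u O G U) :
    ContDiffOn ℝ ∞ (fderiv ℝ (fderiv ℝ u)) O :=
  h.smooth_fderiv.fderiv_of_isOpen h.isOpen (by simp)

theorem differentiableAt_of_smooth {W : Type*} [NormedAddCommGroup W] [NormedSpace ℝ W]
    {f : E → W} (h : IsLocalImmersion u O G U) (hf : ContDiffOn ℝ ∞ f O) (hq : q ∈ O) :
    DifferentiableAt ℝ f q :=
  (hf.contDiffAt (h.isOpen.mem_nhds hq)).differentiableAt (by simp)

theorem fderiv₂_symm (h : IsLocalImmersion u O G U) (hq : q ∈ O) (X Y : E) :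
    fderiv ℝ (fderiv ℝ u) q X Y = fderiv ℝ (fderiv ℝ u) q Y X :=
  (h.contDiffAt hq).isSymmSndFDerivAt (by simpa using ENat.LEInfty.out) X Y

theorem fderiv₃_symm (h : IsLocalImmersion u O G U) (hq : q ∈ O) (Z X Y : E) :
    fderiv ℝ (fderiv ℝ (fderiv ℝ u)) q Z X Y = fderiv ℝ (fderiv ℝ (fderiv ℝ u)) q X Z Y := by
  have := (h.smooth_fderiv.contDiffAt (h.isOpen.mem_nhds hq)).isSymmSndFDerivAt (by simpa using ENat.LEInfty.out) Z X
  rw [this]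

theorem smooth_metric_comp (h : IsLocalImmersion u O G U) : ContDiffOn ℝ ∞ (fun q => G (u q)) O :=
  h.metric.smooth.comp h.smooth h.mapsTo

theorem isLocalMetric (h : IsLocalImmersion u O G U) : IsLocalMetric (pullMetric u G) O where
  isOpen := h.isOpen
  smooth := h.smooth_metric_comp.bilinearComp h.smooth_fderiv
  inner q hq := (h.metric.inner _ (h.mapsTo hq)).bilinearComp (h.injective q hq)

theorem fderiv_pullMetric (h : IsLocalImmersion u O G U) (hq : q ∈ O) (Z X Y : E) :
    fderiv ℝ (pullMetric u G) q Z X Y =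
      fderiv ℝ G (u q) (fderiv ℝ u q Z) (fderiv ℝ u q X) (fderiv ℝ u q Y)
      + G (u q) (fderiv ℝ (fderiv ℝ u) q Z X) (fderiv ℝ u q Y)
      + G (u q) (fderiv ℝ u q X) (fderiv ℝ (fderiv ℝ u) q Z Y) := by
  have h1 := fderiv_bilinearComp (h.differentiableAt_of_smooth h.smooth_metric_comp hq)
    (h.differentiableAt_of_smooth h.smooth_fderiv hq) (h.isLocalMetric.differentiableAt hq) Z X Y
  have h2 : fderiv ℝ (fun q => G (u q)) q = (fderiv ℝ G (u q)).comp (fderiv ℝ u q) :=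
    fderiv_fun_comp q (h.metric.differentiableAt (h.mapsTo hq)) (h.differentiableAt hq)
  rw [h2] at h1
  exact h1

variable [FiniteDimensional ℝ E] [FiniteDimensional ℝ E']

/-- Each of the three metric derivatives yields two terms with second derivatives of `u`. Symmetry
cancels four of the six, and the remaining two combine to `∂_X ∂_Y u`. -/
theorem christoffelFirst_pullMetric (h : IsLocalImmersion u O G U) (hq : q ∈ O) (X Y Z : E) :
    christoffelFirst (pullMetric u G) q X Y Z = G (u q) (covHess u G q X Y) (fderiv ℝ u q Z) := by
  have hs := (h.metric.inner _ (h.mapsTo hq)).symm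
  rw [covHess_apply, map_add, add_apply, christoffelL_apply,
    h.metric.apply_christoffel (h.mapsTo hq)]
  simp only [christoffelFirst, smul_apply, sub_apply, add_apply, ContinuousLinearMap.flip_apply,
    smul_eq_mul, h.fderiv_pullMetric hq]
  rw [h.fderiv₂_symm hq Y X, h.fderiv₂_symm hq Z X, h.fderiv₂_symm hq Z Y, hs (fderiv ℝ u q Y),
    hs (fderiv ℝ u q X)]
  ring

theorem apply_covHess (h : IsLocalImmersion u O G U) (hq : q ∈ O) (X Y Z : E) :
    G (u q) (covHess u G q X Y) (fderiv ℝ u q Z) =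
      pullMetric u G q (christoffelL (pullMetric u G) q X Y) Z := by
  rw [christoffelL_apply, h.isLocalMetric.apply_christoffel hq, h.christoffelFirst_pullMetric hq]

/-- By `apply_covHess` the tangential part of `covHess` is given by the Christoffel symbols of the
induced metric, and `sff` subtracts exactly these (the Gauss formula). -/
theorem apply_sff (h : IsLocalImmersion u O G U) (hq : q ∈ O) (X Y Z : E) :
    G (u q) (sff u G q X Y) (fderiv ℝ u q Z) = 0 := by
  rw [sff_apply, map_sub, sub_apply, h.apply_covHess hq, pullMetric_apply, sub_self]

theorem sff_symm (h : IsLocalImmersion u O G U) (hq : q ∈ O) (X Y : E) :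
    sff u G q X Y = sff u G q Y X := by
  simp only [sff_apply, covHess_apply, christoffelL_apply]
  rw [h.fderiv₂_symm hq, h.metric.christoffel_symm (h.mapsTo hq), h.isLocalMetric.christoffel_symm hq]

theorem smooth_christoffel_comp (h : IsLocalImmersion u O G U) :
    ContDiffOn ℝ ∞ (fun q => christoffelL G (u q)) O :=
  h.metric.smooth_christoffel.comp h.smooth h.mapsTo

theorem smooth_covHess (h : IsLocalImmersion u O G U) : ContDiffOn ℝ ∞ (covHess u G) O :=
  h.smooth_fderiv₂.add (h.smooth_christoffel_comp.bilinearComp h.smooth_fderiv)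

theorem smooth_sff (h : IsLocalImmersion u O G U) : ContDiffOn ℝ ∞ (sff u G) O :=
  h.smooth_covHess.sub (ContDiffOn.clm_comp
    ((ContinuousLinearMap.compL ℝ E E E').contDiff.comp_contDiffOn h.smooth_fderiv)
    h.isLocalMetric.smooth_christoffel)

theorem fderiv_sff (h : IsLocalImmersion u O G U) (hq : q ∈ O) (Z X Y : E) :
    fderiv ℝ (sff u G) q Z X Y =
      fderiv ℝ (fderiv ℝ (fderiv ℝ u)) q Z X Y
      + (fderiv ℝ (christoffelL G) (u q) (fderiv ℝ u q Z) (fderiv ℝ u q X) (fderiv ℝ u q Y)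
        + christoffelL G (u q) (fderiv ℝ (fderiv ℝ u) q Z X) (fderiv ℝ u q Y)
        + christoffelL G (u q) (fderiv ℝ u q X) (fderiv ℝ (fderiv ℝ u) q Z Y))
      - (fderiv ℝ (fderiv ℝ u) q Z (christoffelL (pullMetric u G) q X Y)
        + fderiv ℝ u q (fderiv ℝ (christoffelL (pullMetric u G)) q Z X Y)) := by
  have d0 := h.differentiableAt_of_smooth h.smooth_fderiv hq
  have d1 := h.differentiableAt_of_smooth h.smooth_fderiv₂ hq
  have d2 := h.differentiableAt_of_smooth h.smooth_christoffel_comp hq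
  have d3 := h.differentiableAt_of_smooth (h.smooth_christoffel_comp.bilinearComp h.smooth_fderiv) hq
  have d4 := h.differentiableAt_of_smooth h.isLocalMetric.smooth_christoffel hq
  have h2 : fderiv ℝ (fun q => christoffelL G (u q)) q =
      (fderiv ℝ (christoffelL G) (u q)).comp (fderiv ℝ u q) :=
    fderiv_fun_comp q ((h.metric.smooth_christoffel.contDiffAt
      (h.metric.isOpen.mem_nhds (h.mapsTo hq))).differentiableAt (by simp)) (h.differentiableAt hq)
  have h3 := fderiv_bilinearComp d2 d0 d3 Z X Y
  rw [h2] at h3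
  have e1 := (d1.hasFDerivAt.clm_apply (hasFDerivAt_const X q)).clm_apply (hasFDerivAt_const Y q)
  have e2 := (d3.hasFDerivAt.clm_apply (hasFDerivAt_const X q)).clm_apply (hasFDerivAt_const Y q)
  have e3 := (d4.hasFDerivAt.clm_apply (hasFDerivAt_const X q)).clm_apply (hasFDerivAt_const Y q)
  have e4 := (e1.fun_add e2).fun_sub (d0.hasFDerivAt.clm_apply e3)
  rw [← fderiv_apply₂ (h.differentiableAt_of_smooth h.smooth_sff hq)]
  have e5 : (fun q => sff u G q X Y) = fun q => fderiv ℝ (fderiv ℝ u) q X Y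
      + (christoffelL G (u q)).bilinearComp (fderiv ℝ u q) (fderiv ℝ u q) X Y
      - fderiv ℝ u q (christoffelL (pullMetric u G) q X Y) := rfl
  rw [e5, e4.fderiv]
  simp at h3 ⊢
  rw [h3]
  abel

/-- The Codazzi equation. -/
theorem codazzi (h : IsLocalImmersion u O G U) (hq : q ∈ O) (Z X Y : E) :
    nablaSff u G q Z X Y - nablaSff u G q X Z Y =
      curvature G (u q) (fderiv ℝ u q Z) (fderiv ℝ u q X) (fderiv ℝ u q Y)
        - fderiv ℝ u q (curvature (pullMetric u G) q Z X Y) := by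
  -- Third derivatives of `u` cancel by symmetry, and the derivatives of the two Christoffel fields
  -- assemble into the two curvature tensors. No normal projection is taken, so the tangential part
  -- of the identity contains the Gauss equation.
  rw [h.metric.curvature_eq (h.mapsTo hq), h.isLocalMetric.curvature_eq hq]
  simp only [nablaSff, h.fderiv_sff hq]
  rw [h.fderiv₃_symm hq Z X, h.fderiv₂_symm hq Z X]
  simp only [christoffelL_apply (pullMetric u G)]
  rw [h.isLocalMetric.christoffel_symm hq Z X]
  simp only [sff_apply, covHess_apply, map_add, map_sub, christoffelL_apply (pullMetric u G)]
  abel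

/-- Differentiate `⟨A(X, Y), du V⟩ = 0`. The derivative `nablaSff` uses the full ambient connection,
hence it has this tangential part. -/
theorem apply_nablaSff (h : IsLocalImmersion u O G U) (hq : q ∈ O) (Z X Y V : E) :
    G (u q) (nablaSff u G q Z X Y) (fderiv ℝ u q V) =
      - G (u q) (sff u G q X Y) (sff u G q Z V) := by
  have d0 := h.differentiableAt_of_smooth h.smooth_fderiv hq
  have d1 := h.differentiableAt_of_smooth h.smooth_sff hq
  have d2 := h.differentiableAt_of_smooth h.smooth_metric_comp hq
  have e1 := (d1.hasFDerivAt.clm_apply (hasFDerivAt_const X q)).clm_apply (hasFDerivAt_const Y q)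
  have e2 := d0.hasFDerivAt.clm_apply (hasFDerivAt_const V q)
  have e3 := (d2.hasFDerivAt.clm_apply e1).clm_apply e2
  have h0 : (fun q => G (u q) (sff u G q X Y) (fderiv ℝ u q V)) =ᶠ[𝓝 q] fun _ => 0 := by
    filter_upwards [h.isOpen.mem_nhds hq] with y hy
    exact h.apply_sff hy X Y V
  have h1 := h0.fderiv_eq (𝕜 := ℝ)
  have h2 : fderiv ℝ (fun q => G (u q)) q = (fderiv ℝ G (u q)).comp (fderiv ℝ u q) :=
    fderiv_fun_comp q (h.metric.differentiableAt (h.mapsTo hq)) (h.differentiableAt hq)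
  rw [e3.fderiv, h2] at h1
  have h3 := DFunLike.congr_fun h1 Z
  simp [h.metric.compat (h.mapsTo hq)] at h3
  have h4 := h.apply_sff hq (christoffelL (pullMetric u G) q Z X) Y V
  have h5 := h.apply_sff hq X (christoffelL (pullMetric u G) q Z Y) V
  have h6 := h.apply_sff hq X Y (christoffelL (pullMetric u G) q Z V)
  simp only [nablaSff, map_sub, map_add, sub_apply, add_apply]
  rw [h4, h5, sff_apply u G q Z V, map_sub, h6, covHess_apply, map_add]
  simp only [christoffelL_apply] at *
  linarith

end IsLocalImmersion

end LocalImmersions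


/-! ### Product metrics -/

section ProductMetrics

variable {E₁ E₂ : Type*} [NormedAddCommGroup E₁] [NormedSpace ℝ E₁] [NormedAddCommGroup E₂]
  [NormedSpace ℝ E₂]

/-- The orthogonal sum of two bilinear forms. -/
def prodForm (B₁ : E₁ →L[ℝ] E₁ →L[ℝ] ℝ) (B₂ : E₂ →L[ℝ] E₂ →L[ℝ] ℝ) :
    E₁ × E₂ →L[ℝ] E₁ × E₂ →L[ℝ] ℝ :=
  B₁.bilinearComp (ContinuousLinearMap.fst ℝ E₁ E₂) (ContinuousLinearMap.fst ℝ E₁ E₂)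
    + B₂.bilinearComp (ContinuousLinearMap.snd ℝ E₁ E₂) (ContinuousLinearMap.snd ℝ E₁ E₂)

theorem prodForm_apply (B₁ : E₁ →L[ℝ] E₁ →L[ℝ] ℝ) (B₂ : E₂ →L[ℝ] E₂ →L[ℝ] ℝ) (v w : E₁ × E₂) :
    prodForm B₁ B₂ v w = B₁ v.1 w.1 + B₂ v.2 w.2 := rfl

theorem IsInner.prodForm {B₁ : E₁ →L[ℝ] E₁ →L[ℝ] ℝ} {B₂ : E₂ →L[ℝ] E₂ →L[ℝ] ℝ} (h₁ : IsInner B₁)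
    (h₂ : IsInner B₂) : IsInner (prodForm B₁ B₂) where
  symm u v := by rw [prodForm_apply, prodForm_apply, h₁.symm, h₂.symm]
  pos v hv := by
    have nonneg₁ : 0 ≤ B₁ v.1 v.1 := by
      by_cases h : v.1 = 0
      · simp [h]
      · exact (h₁.pos _ h).le
    have nonneg₂ : 0 ≤ B₂ v.2 v.2 := by
      by_cases h : v.2 = 0
      · simp [h]
      · exact (h₂.pos _ h).le
    rw [prodForm_apply]
    by_cases h : v.1 = 0
    · have := h₂.pos v.2 fun h' => hv (Prod.ext h h')
      linarith
    · have := h₁.pos v.1 h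
      linarith

/-- The product of two local metrics. -/
def prodMetric (G₁ : E₁ → E₁ →L[ℝ] E₁ →L[ℝ] ℝ) (G₂ : E₂ → E₂ →L[ℝ] E₂ →L[ℝ] ℝ) (y : E₁ × E₂) :
    E₁ × E₂ →L[ℝ] E₁ × E₂ →L[ℝ] ℝ :=
  prodForm (G₁ y.1) (G₂ y.2)

variable {G₁ : E₁ → E₁ →L[ℝ] E₁ →L[ℝ] ℝ} {G₂ : E₂ → E₂ →L[ℝ] E₂ →L[ℝ] ℝ} {U₁ : Set E₁}
  {U₂ : Set E₂}

theorem IsLocalMetric.prodMetric (h₁ : IsLocalMetric G₁ U₁) (h₂ : IsLocalMetric G₂ U₂) :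
    IsLocalMetric (prodMetric G₁ G₂) (U₁ ×ˢ U₂) where
  isOpen := h₁.isOpen.prod h₂.isOpen
  smooth := (ContDiffOn.bilinearComp (S := fun _ => ContinuousLinearMap.fst ℝ E₁ E₂)
      (h₁.smooth.comp contDiff_fst.contDiffOn fun _ h => h.1) contDiffOn_const).add
    (ContDiffOn.bilinearComp (S := fun _ => ContinuousLinearMap.snd ℝ E₁ E₂)
      (h₂.smooth.comp contDiff_snd.contDiffOn fun _ h => h.2) contDiffOn_const)
  inner y hy := (h₁.inner y.1 hy.1).prodForm (h₂.inner y.2 hy.2)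

theorem IsLocalMetric.fderiv_prodMetric (h₁ : IsLocalMetric G₁ U₁) (h₂ : IsLocalMetric G₂ U₂)
    {y : E₁ × E₂} (hy : y ∈ U₁ ×ˢ U₂) (z v w : E₁ × E₂) :
    fderiv ℝ (GraphFlow.prodMetric G₁ G₂) y z v w =
      fderiv ℝ G₁ y.1 z.1 v.1 w.1 + fderiv ℝ G₂ y.2 z.2 v.2 w.2 := by
  rw [← fderiv_apply₂ ((h₁.prodMetric h₂).differentiableAt hy)]
  have e₁ := ((((h₁.differentiableAt hy.1).hasFDerivAt.comp y hasFDerivAt_fst).clm_apply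
    (hasFDerivAt_const v.1 y)).clm_apply (hasFDerivAt_const w.1 y))
  have e₂ := ((((h₂.differentiableAt hy.2).hasFDerivAt.comp y hasFDerivAt_snd).clm_apply
    (hasFDerivAt_const v.2 y)).clm_apply (hasFDerivAt_const w.2 y))
  have e₃ : (fun q => GraphFlow.prodMetric G₁ G₂ q v w) =
    fun q : E₁ × E₂ => (G₁ ∘ Prod.fst) q v.1 w.1 + (G₂ ∘ Prod.snd) q v.2 w.2 := rfl
  rw [e₃, (e₁.fun_add e₂).fderiv]
  simp

variable [FiniteDimensional ℝ E₁] [FiniteDimensional ℝ E₂]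

theorem IsLocalMetric.christoffel_prodMetric (h₁ : IsLocalMetric G₁ U₁) (h₂ : IsLocalMetric G₂ U₂)
    {y : E₁ × E₂} (hy : y ∈ U₁ ×ˢ U₂) (u v : E₁ × E₂) :
    christoffel (GraphFlow.prodMetric G₁ G₂) y u v =
      (christoffel G₁ y.1 u.1 v.1, christoffel G₂ y.2 u.2 v.2) := by
  apply ((h₁.prodMetric h₂).inner y hy).ext
  intro w
  rw [(h₁.prodMetric h₂).apply_christoffel hy]
  change _ = G₁ y.1 (christoffel G₁ y.1 u.1 v.1) w.1 + G₂ y.2 (christoffel G₂ y.2 u.2 v.2) w.2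
  rw [h₁.apply_christoffel hy.1, h₂.apply_christoffel hy.2]
  simp only [christoffelFirst, smul_apply, sub_apply, add_apply, ContinuousLinearMap.flip_apply,
    smul_eq_mul, h₁.fderiv_prodMetric h₂ hy]
  ring

theorem IsLocalMetric.curvature_prodMetric (h₁ : IsLocalMetric G₁ U₁) (h₂ : IsLocalMetric G₂ U₂)
    {y : E₁ × E₂} (hy : y ∈ U₁ ×ˢ U₂) (u v w : E₁ × E₂) :
    curvature (GraphFlow.prodMetric G₁ G₂) y u v w =
      (curvature G₁ y.1 u.1 v.1 w.1, curvature G₂ y.2 u.2 v.2 w.2) := by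
  have key : ∀ u v w : E₁ × E₂, fderiv ℝ (fun y => christoffel (GraphFlow.prodMetric G₁ G₂) y v w) y u =
      (fderiv ℝ (fun y => christoffel G₁ y v.1 w.1) y.1 u.1,
        fderiv ℝ (fun y => christoffel G₂ y v.2 w.2) y.2 u.2) := fun u v w => by
    have e₀ : (fun y => christoffel (GraphFlow.prodMetric G₁ G₂) y v w) =ᶠ[𝓝 y]
        fun y => (christoffel G₁ y.1 v.1 w.1, christoffel G₂ y.2 v.2 w.2) := by
      filter_upwards [(h₁.isOpen.prod h₂.isOpen).mem_nhds hy] with z hz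
      exact h₁.christoffel_prodMetric h₂ hz v w
    have d₁ : DifferentiableAt ℝ (fun y => christoffelL G₁ y v.1 w.1) y.1 :=
      (((h₁.smooth_christoffel.contDiffAt (h₁.isOpen.mem_nhds hy.1)).differentiableAt
        (by simp)).clm_apply (differentiableAt_const _)).clm_apply (differentiableAt_const _)
    have d₂ : DifferentiableAt ℝ (fun y => christoffelL G₂ y v.2 w.2) y.2 :=
      (((h₂.smooth_christoffel.contDiffAt (h₂.isOpen.mem_nhds hy.2)).differentiableAt
        (by simp)).clm_apply (differentiableAt_const _)).clm_apply (differentiableAt_const _)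
    have e₁ := d₁.hasFDerivAt.comp y hasFDerivAt_fst
    have e₂ := d₂.hasFDerivAt.comp y hasFDerivAt_snd
    have e₃ := e₁.prodMk e₂
    rw [e₀.fderiv_eq]
    exact congrArg (fun L : E₁ × E₂ →L[ℝ] E₁ × E₂ => L u) e₃.fderiv
  simp only [curvature, key, h₁.christoffel_prodMetric h₂ hy]
  rfl

end ProductMetrics


/-! ### Derivatives of the induced metric and along lines. -/

section Auxiliary

variable {E E' : Type*} [NormedAddCommGroup E] [NormedSpace ℝ E]
  [NormedAddCommGroup E'] [NormedSpace ℝ E'] [FiniteDimensional ℝ E] [FiniteDimensional ℝ E']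

theorem IsLocalImmersion.fderiv_pullMetric_eq {u : E → E'} {O : Set E}
    {G : E' → E' →L[ℝ] E' →L[ℝ] ℝ} {U : Set E'} {q : E} (h : IsLocalImmersion u O G U) (hq : q ∈ O)
    (Z X Y : E) :
    fderiv ℝ (pullMetric u G) q Z X Y =
      G (u q) (covHess u G q Z X) (fderiv ℝ u q Y) + G (u q) (fderiv ℝ u q X) (covHess u G q Z Y) := by
  rw [h.fderiv_pullMetric hq, h.metric.compat (h.mapsTo hq), covHess_apply, covHess_apply]
  simp only [map_add, add_apply, christoffelL_apply]
  ring

theorem IsLocalImmersion.nablaSff_symm {u : E → E'} {O : Set E}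
    {G : E' → E' →L[ℝ] E' →L[ℝ] ℝ} {U : Set E'} {q : E} (h : IsLocalImmersion u O G U) (hq : q ∈ O)
    (Z X Y : E) : nablaSff u G q Z X Y = nablaSff u G q Z Y X := by
  have d := h.differentiableAt_of_smooth h.smooth_sff hq
  have e : fderiv ℝ (sff u G) q Z X Y = fderiv ℝ (sff u G) q Z Y X := by
    rw [← fderiv_apply₂ d, ← fderiv_apply₂ d]
    congr 1
    apply Filter.EventuallyEq.fderiv_eq
    filter_upwards [h.isOpen.mem_nhds hq] with y hy
    exact h.sff_symm hy X Y
  simp only [nablaSff]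
  rw [e, h.sff_symm hq X Y, h.sff_symm hq (christoffelL (pullMetric u G) q Z X) Y,
    h.sff_symm hq X]
  abel

/-- The calculus of determinants and traces is stated for one real parameter. Restriction to a line
makes it available for space derivatives, with `univ` in place of the time interval. -/
theorem hasDerivAt_line {W : Type*} [NormedAddCommGroup W] [NormedSpace ℝ W] {f : E → W} {q : E}
    (hf : DifferentiableAt ℝ f q) (X : E) :
    HasDerivWithinAt (fun s : ℝ => f (q + s • X)) (fderiv ℝ f q X) univ 0 := by
  rw [hasDerivWithinAt_univ]
  have h1 : HasDerivAt (fun s : ℝ => q + s • X) X 0 := by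
    simpa using ((hasDerivAt_id (0 : ℝ)).smul_const X).const_add q
  have h2 : HasFDerivAt f (fderiv ℝ f q) (q + (0 : ℝ) • X) := by simpa using hf.hasFDerivAt
  exact h2.comp_hasDerivAt 0 h1

end Auxiliary

/-! ### The Jacobian of the projection to the first factor -/

section Jacobian

variable {n : ℕ} {E₂ : Type*} [NormedAddCommGroup E₂] [NormedSpace ℝ E₂]

/-- The model space of an `n`-dimensional manifold. -/
abbrev Euc (n : ℕ) := EuclideanSpace ℝ (Fin n)

/-- The trace, as a continuous linear functional. -/
def traceL (n : ℕ) :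
    (EuclideanSpace ℝ (Fin n) →L[ℝ] EuclideanSpace ℝ (Fin n)) →L[ℝ] ℝ :=
  LinearMap.toContinuousLinearMap
    ((LinearMap.trace ℝ (EuclideanSpace ℝ (Fin n))).comp (ContinuousLinearMap.coeLM ℝ))

theorem traceL_apply (K : Euc n →L[ℝ] Euc n) : traceL n K = LinearMap.trace ℝ (Euc n) (K : Euc n →ₗ[ℝ] Euc n) := rfl

theorem traceL_comp_comm (K L : Euc n →L[ℝ] Euc n) : traceL n (K.comp L) = traceL n (L.comp K) :=
  LinearMap.trace_mul_comm ℝ (K : Euc n →ₗ[ℝ] Euc n) (L : Euc n →ₗ[ℝ] Euc n)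

/-- The differential of the first component of a map to a product. -/
def jac (u : Euc n → Euc n × E₂) (q : Euc n) : Euc n →L[ℝ] Euc n :=
  (ContinuousLinearMap.fst ℝ (Euc n) E₂).comp (fderiv ℝ u q)

/-- The first component of the second fundamental form, carried back to the tangent space by the
differential of the projection. -/
def shape (u : Euc n → Euc n × E₂) (G : Euc n × E₂ → Euc n × E₂ →L[ℝ] Euc n × E₂ →L[ℝ] ℝ) (q : Euc n) :
    (Euc n) →L[ℝ] Euc n →L[ℝ] Euc n :=
  (ContinuousLinearMap.compL ℝ (Euc n) (Euc n) (Euc n) (jac u q).inverse).comp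
    ((ContinuousLinearMap.compL ℝ (Euc n) (Euc n × E₂) (Euc n) (ContinuousLinearMap.fst ℝ (Euc n) E₂)).comp
      (sff u G q))

theorem shape_apply (u : Euc n → Euc n × E₂) (G : Euc n × E₂ → Euc n × E₂ →L[ℝ] Euc n × E₂ →L[ℝ] ℝ)
    (q X Y : Euc n) : shape u G q X Y = (jac u q).inverse (sff u G q X Y).1 := rfl

/-- The Jacobian of the projection to the first factor. -/
def projJacobian (u : Euc n → Euc n × E₂) (G₁ : Euc n → Euc n →L[ℝ] Euc n →L[ℝ] ℝ)
    (G₂ : E₂ → E₂ →L[ℝ] E₂ →L[ℝ] ℝ) (q : Euc n) : ℝ :=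
  √((gram (pullMetric (fun q => (u q).1) G₁ q)).det /
    (gram (pullMetric u (prodMetric G₁ G₂) q)).det)

/-- An immersion into a product whose projection to the first factor is an immersion. -/
structure IsLocalGraphImmersion (u : Euc n → Euc n × E₂) (O : Set (Euc n)) (G₁ : Euc n → Euc n →L[ℝ] Euc n →L[ℝ] ℝ)
    (G₂ : E₂ → E₂ →L[ℝ] E₂ →L[ℝ] ℝ) (U₁ : Set (Euc n)) (U₂ : Set E₂) : Prop where
  metric₁ : IsLocalMetric G₁ U₁
  metric₂ : IsLocalMetric G₂ U₂
  isOpen : IsOpen O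
  smooth : ContDiffOn ℝ ∞ u O
  mapsTo : MapsTo u O (U₁ ×ˢ U₂)
  injective_jac : ∀ q ∈ O, Function.Injective (jac u q)

theorem isInvertible_of_injective {K : Euc n →L[ℝ] (Euc n)} (hK : Function.Injective K) :
    K.IsInvertible :=
  ⟨(LinearEquiv.ofInjectiveEndo (K : Euc n →ₗ[ℝ] Euc n) hK).toContinuousLinearEquiv, by ext v; rfl⟩

namespace IsLocalGraphImmersion

variable {u : Euc n → Euc n × E₂} {O : Set (Euc n)} {G₁ : Euc n → Euc n →L[ℝ] Euc n →L[ℝ] ℝ}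
  {G₂ : E₂ → E₂ →L[ℝ] E₂ →L[ℝ] ℝ} {U₁ : Set (Euc n)} {U₂ : Set E₂} {q : (Euc n)}

theorem isLocalImmersion (h : IsLocalGraphImmersion u O G₁ G₂ U₁ U₂) :
    IsLocalImmersion u O (prodMetric G₁ G₂) (U₁ ×ˢ U₂) where
  metric := h.metric₁.prodMetric h.metric₂
  isOpen := h.isOpen
  smooth := h.smooth
  mapsTo := h.mapsTo
  injective q hq := fun X Y hXY => h.injective_jac q hq (congrArg Prod.fst hXY)

theorem fderiv_fst (h : IsLocalGraphImmersion u O G₁ G₂ U₁ U₂) (hq : q ∈ O) :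
    fderiv ℝ (fun q => (u q).1) q = jac u q :=
  (hasFDerivAt_fst.comp q (h.isLocalImmersion.differentiableAt hq).hasFDerivAt).fderiv

theorem isLocalImmersion_fst (h : IsLocalGraphImmersion u O G₁ G₂ U₁ U₂) :
    IsLocalImmersion (fun q => (u q).1) O G₁ U₁ where
  metric := h.metric₁
  isOpen := h.isOpen
  smooth := contDiff_fst.comp_contDiffOn h.smooth
  mapsTo _ hq := (h.mapsTo hq).1
  injective q hq := by
    rw [h.fderiv_fst hq]
    exact h.injective_jac q hq

theorem isInvertible_jac (h : IsLocalGraphImmersion u O G₁ G₂ U₁ U₂) (hq : q ∈ O) :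
    (jac u q).IsInvertible :=
  isInvertible_of_injective (h.injective_jac q hq)

theorem jac_inverse (h : IsLocalGraphImmersion u O G₁ G₂ U₁ U₂) (hq : q ∈ O) (X : Euc n) :
    jac u q ((jac u q).inverse X) = X :=
  (h.isInvertible_jac hq).self_apply_inverse X

theorem inverse_jac (h : IsLocalGraphImmersion u O G₁ G₂ U₁ U₂) (hq : q ∈ O) (X : Euc n) :
    (jac u q).inverse (fderiv ℝ u q X).1 = X :=
  (h.isInvertible_jac hq).inverse_apply_self X

theorem smooth_jac (h : IsLocalGraphImmersion u O G₁ G₂ U₁ U₂) : ContDiffOn ℝ ∞ (jac u) O :=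
  contDiffOn_const.clm_comp h.isLocalImmersion.smooth_fderiv

theorem fderiv_jac (h : IsLocalGraphImmersion u O G₁ G₂ U₁ U₂) (hq : q ∈ O) (X Y : Euc n) :
    fderiv ℝ (jac u) q X Y = (fderiv ℝ (fderiv ℝ u) q X Y).1 := by
  have d := h.isLocalImmersion.differentiableAt_of_smooth h.isLocalImmersion.smooth_fderiv hq
  have e := (hasFDerivAt_const (ContinuousLinearMap.fst ℝ (Euc n) E₂) q).clm_comp d.hasFDerivAt
  have e' : fderiv ℝ (jac u) q = _ := e.fderiv
  rw [e']
  simp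

theorem smooth_inverse_jac (h : IsLocalGraphImmersion u O G₁ G₂ U₁ U₂) :
    ContDiffOn ℝ ∞ (fun q => (jac u q).inverse) O := fun q hq =>
  ((h.isInvertible_jac hq).contDiffAt_map_inverse (n := ∞)).comp_contDiffWithinAt q
    (h.smooth_jac q hq)

/-- Differentiate `jac (jac⁻¹ Y) = Y` and solve for the derivative of the inverse. -/
theorem fderiv_inverse_jac (h : IsLocalGraphImmersion u O G₁ G₂ U₁ U₂) (hq : q ∈ O) (X Y : Euc n) :
    fderiv ℝ (fun q => (jac u q).inverse) q X Y =
      -(jac u q).inverse (fderiv ℝ (jac u) q X ((jac u q).inverse Y)) := by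
  have d₁ := h.isLocalImmersion.differentiableAt_of_smooth h.smooth_jac hq
  have d₂ := h.isLocalImmersion.differentiableAt_of_smooth h.smooth_inverse_jac hq
  have e := d₁.hasFDerivAt.clm_apply (d₂.hasFDerivAt.clm_apply (hasFDerivAt_const Y q))
  have e' : (fun q => jac u q ((jac u q).inverse Y)) =ᶠ[𝓝 q] fun _ => Y := by
    filter_upwards [h.isOpen.mem_nhds hq] with y hy
    exact h.jac_inverse hy Y
  have e₂ := e'.fderiv_eq (𝕜 := ℝ)
  rw [e.fderiv] at e₂
  have e₃ := DFunLike.congr_fun e₂ X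
  simp at e₃
  have e₄ := congrArg (jac u q).inverse (eq_neg_of_add_eq_zero_left e₃)
  rw [map_neg, (h.isInvertible_jac hq).inverse_apply_self] at e₄
  exact e₄

variable [FiniteDimensional ℝ E₂]

theorem smooth_shape (h : IsLocalGraphImmersion u O G₁ G₂ U₁ U₂) :
    ContDiffOn ℝ ∞ (shape u (prodMetric G₁ G₂)) O :=
  ContDiffOn.clm_comp
    ((ContinuousLinearMap.compL ℝ (Euc n) (Euc n) (Euc n)).contDiff.comp_contDiffOn h.smooth_inverse_jac)
    (contDiffOn_const.clm_comp h.isLocalImmersion.smooth_sff)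

/-- The Christoffel symbols of a product split, so the projection commutes with the covariant
Hessian: this is where `π₁` being parallel enters. -/
theorem covHess_fst (h : IsLocalGraphImmersion u O G₁ G₂ U₁ U₂) (hq : q ∈ O) (X Y : Euc n) :
    covHess (fun q => (u q).1) G₁ q X Y = (covHess u (prodMetric G₁ G₂) q X Y).1 := by
  have e : fderiv ℝ (fun q => (u q).1) =ᶠ[𝓝 q] jac u := by
    filter_upwards [h.isOpen.mem_nhds hq] with y hy
    exact h.fderiv_fst hy
  rw [covHess_apply, covHess_apply, e.fderiv_eq, h.fderiv_jac hq, h.fderiv_fst hq,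
    christoffelL_apply, christoffelL_apply,
    h.metric₁.christoffel_prodMetric h.metric₂ (h.mapsTo hq)]
  rfl

theorem gram_det_pos (h : IsLocalGraphImmersion u O G₁ G₂ U₁ U₂) (hq : q ∈ O) :
    0 < (gram (pullMetric u (prodMetric G₁ G₂) q)).det :=
  (h.isLocalImmersion.isLocalMetric.inner q hq).gram_det_pos

theorem gram_fst_det_pos (h : IsLocalGraphImmersion u O G₁ G₂ U₁ U₂) (hq : q ∈ O) :
    0 < (gram (pullMetric (fun q => (u q).1) G₁ q)).det :=
  (h.isLocalImmersion_fst.isLocalMetric.inner q hq).gram_det_pos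

theorem projJacobian_pos (h : IsLocalGraphImmersion u O G₁ G₂ U₁ U₂) (hq : q ∈ O) :
    0 < projJacobian u G₁ G₂ q :=
  Real.sqrt_pos.2 (div_pos (h.gram_fst_det_pos hq) (h.gram_det_pos hq))

theorem contDiffOn_gram_det {W : Type*} [NormedAddCommGroup W] [NormedSpace ℝ W] {O : Set W}
    {B : W → Euc n →L[ℝ] Euc n →L[ℝ] ℝ} (hB : ContDiffOn ℝ ∞ B O) :
    ContDiffOn ℝ ∞ (fun q => (gram (B q)).det) O := by
  simp only [Matrix.det_apply]
  refine ContDiffOn.sum fun σ _ => ?_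
  refine ContDiffOn.const_smul _ ?_
  refine contDiffOn_prod fun i _ => ?_
  exact (hB.clm_apply contDiffOn_const).clm_apply contDiffOn_const

theorem smooth_projJacobian (h : IsLocalGraphImmersion u O G₁ G₂ U₁ U₂) :
    ContDiffOn ℝ ∞ (projJacobian u G₁ G₂) O := by
  refine ContDiffOn.sqrt (ContDiffOn.div ?_ ?_ fun q hq => (h.gram_det_pos hq).ne')
    fun q hq => (div_pos (h.gram_fst_det_pos hq) (h.gram_det_pos hq)).ne'
  · exact contDiffOn_gram_det h.isLocalImmersion_fst.isLocalMetric.smooth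
  · exact contDiffOn_gram_det h.isLocalImmersion.isLocalMetric.smooth

/-- Along `X`, the projected metric varies through the operator `jac⁻¹ π₁ covHess(X, ·)` and the
induced metric through its Christoffel operator. Their difference is `jac⁻¹ π₁ A(X, ·)`, that is,
`shape`. -/
theorem fderiv_projJacobian (h : IsLocalGraphImmersion u O G₁ G₂ U₁ U₂) (hq : q ∈ O) (X : Euc n) :
    fderiv ℝ (projJacobian u G₁ G₂) q X =
      projJacobian u G₁ G₂ q * traceL n (shape u (prodMetric G₁ G₂) q X) := by
  have hm := h.isLocalImmersion.isLocalMetric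
  have hm₁ := h.isLocalImmersion_fst.isLocalMetric
  have d := hasDerivAt_line
    (h.isLocalImmersion.differentiableAt_of_smooth h.smooth_projJacobian hq) X
  have e := hasDerivWithinAt_sqrt_gram_det_div (s := univ) (t := 0)
    (P := fun s : ℝ => pullMetric (fun q => (u q).1) G₁ (q + s • X))
    (B := fun s : ℝ => pullMetric u (prodMetric G₁ G₂) (q + s • X))
    (by simpa using hm₁.inner q hq) (by simpa using hm.inner q hq)
    (hasDerivAt_line (hm₁.differentiableAt hq) X) (hasDerivAt_line (hm.differentiableAt hq) X)
  rw [hasDerivWithinAt_univ] at d e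
  rw [d.unique e]
  simp only [zero_smul, add_zero]
  rw [(hm₁.inner q hq).metricTrace_compat ((jac u q).inverse.comp
      ((ContinuousLinearMap.fst ℝ (Euc n) E₂).comp (covHess u (prodMetric G₁ G₂) q X))),
    (hm.inner q hq).metricTrace_compat (christoffelL (pullMetric u (prodMetric G₁ G₂)) q X)
      (fun Y Z => hm.compat hq X Y Z)]
  · rw [← mul_sub, mul_div_cancel_left₀ _ two_ne_zero, ← traceL_apply, ← traceL_apply,
      ← map_sub]
    unfold projJacobian
    congr 2
    ext1 Y
    rw [shape_apply, sff_apply]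
    simp [h.inverse_jac hq]
  · intro Y Z
    rw [h.isLocalImmersion_fst.fderiv_pullMetric_eq hq, h.covHess_fst hq, h.covHess_fst hq,
      pullMetric_apply, pullMetric_apply, h.fderiv_fst hq]
    simp [h.jac_inverse hq]

end IsLocalGraphImmersion

end Jacobian


/-! ### Second derivatives of the Jacobian and its evolution in coordinates. -/

section Evolution

variable {n : ℕ} {E₂ : Type*} [NormedAddCommGroup E₂] [NormedSpace ℝ E₂] [FiniteDimensional ℝ E₂]

namespace IsLocalGraphImmersion

variable {u : Euc n → Euc n × E₂} {O : Set (Euc n)} {G₁ : Euc n → Euc n →L[ℝ] Euc n →L[ℝ] ℝ}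
  {G₂ : E₂ → E₂ →L[ℝ] E₂ →L[ℝ] ℝ} {U₁ : Set (Euc n)} {U₂ : Set E₂} {q : Euc n}

theorem fderiv_shape_apply (h : IsLocalGraphImmersion u O G₁ G₂ U₁ U₂) (hq : q ∈ O)
    (X Y Z : Euc n) :
    fderiv ℝ (shape u (prodMetric G₁ G₂)) q X Y Z =
      (jac u q).inverse (fderiv ℝ (sff u (prodMetric G₁ G₂)) q X Y Z).1
        - (jac u q).inverse (fderiv ℝ (fderiv ℝ u) q X (shape u (prodMetric G₁ G₂) q Y Z)).1 := by
  have d₁ := h.isLocalImmersion.differentiableAt_of_smooth h.smooth_inverse_jac hq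
  have d₂ := h.isLocalImmersion.differentiableAt_of_smooth h.isLocalImmersion.smooth_sff hq
  rw [← fderiv_apply₂ (h.isLocalImmersion.differentiableAt_of_smooth h.smooth_shape hq)]
  have e₁ := (d₂.hasFDerivAt.clm_apply (hasFDerivAt_const Y q)).clm_apply (hasFDerivAt_const Z q)
  have e₂ := d₁.hasFDerivAt.clm_apply (hasFDerivAt_fst.comp q e₁)
  have e₃ : (fun q => shape u (prodMetric G₁ G₂) q Y Z) = fun y => (jac u y).inverse
    (((Prod.fst : Euc n × E₂ → Euc n) ∘ fun q => sff u (prodMetric G₁ G₂) q Y Z) y) := rfl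
  rw [e₃, e₂.fderiv]
  simp [h.fderiv_inverse_jac hq, h.fderiv_jac hq, shape_apply]
  abel

/-- Replaces coordinate derivatives by covariant ones under the trace. The corrections are a
Christoffel term in the argument `Y`, a commutator of `shape` with the Christoffel operator, which
has trace zero, and the derivative of `jac⁻¹`, which produces `-tr (S(X) S(Y))`. -/
theorem trace_fderiv_shape (h : IsLocalGraphImmersion u O G₁ G₂ U₁ U₂) (hq : q ∈ O)
    {τ : Fin n → Euc n} (hτ : IsOrthonormal (pullMetric u (prodMetric G₁ G₂) q) τ) (X Y : Euc n) :
    traceL n (fderiv ℝ (shape u (prodMetric G₁ G₂)) q X Y) =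
      ∑ k, pullMetric u (prodMetric G₁ G₂) q
          ((jac u q).inverse (nablaSff u (prodMetric G₁ G₂) q X Y (τ k)).1) (τ k)
        + traceL n (shape u (prodMetric G₁ G₂) q
            (christoffelL (pullMetric u (prodMetric G₁ G₂)) q X Y))
        - traceL n ((shape u (prodMetric G₁ G₂) q X).comp (shape u (prodMetric G₁ G₂) q Y)) := by
  have e₂ := traceL_comp_comm (shape u (prodMetric G₁ G₂) q Y)
    (christoffelL (pullMetric u (prodMetric G₁ G₂)) q X)
  have e₃ : ∀ K : Euc n →L[ℝ] Euc n, traceL n K =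
      ∑ k, pullMetric u (prodMetric G₁ G₂) q (K (τ k)) (τ k) := fun K => hτ.trace_eq _
  have e₄ : traceL n (fderiv ℝ (shape u (prodMetric G₁ G₂)) q X Y)
      = ∑ k, pullMetric u (prodMetric G₁ G₂) q
          ((jac u q).inverse (nablaSff u (prodMetric G₁ G₂) q X Y (τ k)).1) (τ k)
        + traceL n (shape u (prodMetric G₁ G₂) q
            (christoffelL (pullMetric u (prodMetric G₁ G₂)) q X Y))
        - traceL n ((shape u (prodMetric G₁ G₂) q X).comp (shape u (prodMetric G₁ G₂) q Y))
        + (traceL n ((shape u (prodMetric G₁ G₂) q Y).comp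
            (christoffelL (pullMetric u (prodMetric G₁ G₂)) q X)) -
          traceL n ((christoffelL (pullMetric u (prodMetric G₁ G₂)) q X).comp
            (shape u (prodMetric G₁ G₂) q Y))) := by
    simp only [e₃, ← Finset.sum_add_distrib, ← Finset.sum_sub_distrib]
    refine Finset.sum_congr rfl fun k _ => ?_
    rw [h.fderiv_shape_apply hq]
    have e₅ : fderiv ℝ (sff u (prodMetric G₁ G₂)) q X Y (τ k) =
      nablaSff u (prodMetric G₁ G₂) q X Y (τ k)
        - christoffelL (prodMetric G₁ G₂) (u q) (fderiv ℝ u q X)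
            (sff u (prodMetric G₁ G₂) q Y (τ k))
        + sff u (prodMetric G₁ G₂) q
            (christoffelL (pullMetric u (prodMetric G₁ G₂)) q X Y) (τ k)
        + sff u (prodMetric G₁ G₂) q Y
            (christoffelL (pullMetric u (prodMetric G₁ G₂)) q X (τ k)) := by
      rw [nablaSff]
      abel
    have e₆ : fderiv ℝ (fderiv ℝ u) q X (shape u (prodMetric G₁ G₂) q Y (τ k)) =
        sff u (prodMetric G₁ G₂) q X (shape u (prodMetric G₁ G₂) q Y (τ k))
        - christoffelL (prodMetric G₁ G₂) (u q) (fderiv ℝ u q X)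
          (fderiv ℝ u q (shape u (prodMetric G₁ G₂) q Y (τ k)))
        + fderiv ℝ u q (christoffelL (pullMetric u (prodMetric G₁ G₂)) q X
          (shape u (prodMetric G₁ G₂) q Y (τ k))) := by
      rw [sff_apply, covHess_apply]
      abel
    -- The first component of the product Christoffel symbol sees only first components, and `du
    -- (shape Y τₖ)` and `A(Y, τₖ)` have the same one. The two ambient Christoffel terms therefore
    -- cancel.
    have e₇ : (christoffelL (prodMetric G₁ G₂) (u q) (fderiv ℝ u q X)
          (fderiv ℝ u q (shape u (prodMetric G₁ G₂) q Y (τ k)))).1 =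
        (christoffelL (prodMetric G₁ G₂) (u q) (fderiv ℝ u q X)
            (sff u (prodMetric G₁ G₂) q Y (τ k))).1 := by
      simp only [christoffelL_apply, h.metric₁.christoffel_prodMetric h.metric₂ (h.mapsTo hq)]
      rw [← h.jac_inverse hq (sff u (prodMetric G₁ G₂) q Y (τ k)).1]
      rfl
    simp only [shape_apply] at e₇
    rw [e₅, e₆]
    simp only [Prod.fst_add, Prod.fst_sub, map_add, map_sub, h.inverse_jac hq, e₇,
      ContinuousLinearMap.comp_apply, shape_apply, add_apply, sub_apply]
    ring
  rw [e₄, e₂]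
  ring

theorem fderiv₂_projJacobian (h : IsLocalGraphImmersion u O G₁ G₂ U₁ U₂) (hq : q ∈ O)
    (X Y : Euc n) :
    fderiv ℝ (fderiv ℝ (projJacobian u G₁ G₂)) q X Y =
      projJacobian u G₁ G₂ q * (traceL n (shape u (prodMetric G₁ G₂) q X) *
        traceL n (shape u (prodMetric G₁ G₂) q Y)
        + traceL n (fderiv ℝ (shape u (prodMetric G₁ G₂)) q X Y)) := by
  have d₁ := h.isLocalImmersion.differentiableAt_of_smooth h.smooth_projJacobian hq
  have d₂ := h.isLocalImmersion.differentiableAt_of_smooth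
    (h.smooth_projJacobian.fderiv_of_isOpen h.isOpen (m := ∞) (by simp)) hq
  have d₃ := h.isLocalImmersion.differentiableAt_of_smooth h.smooth_shape hq
  have e₁ : (fun q => fderiv ℝ (projJacobian u G₁ G₂) q Y) =ᶠ[𝓝 q] fun q =>
      projJacobian u G₁ G₂ q * traceL n (shape u (prodMetric G₁ G₂) q Y) := by
    filter_upwards [h.isOpen.mem_nhds hq] with y hy
    exact h.fderiv_projJacobian hy Y
  have e₂ := d₁.hasFDerivAt.mul ((traceL n).hasFDerivAt.comp q
    (d₃.hasFDerivAt.clm_apply (hasFDerivAt_const Y q)))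
  have e₃ : fderiv ℝ (fun q => fderiv ℝ (projJacobian u G₁ G₂) q Y) q X =
      fderiv ℝ (fderiv ℝ (projJacobian u G₁ G₂)) q X Y := by
    rw [(d₂.hasFDerivAt.clm_apply (hasFDerivAt_const Y q)).fderiv]
    simp
  have e₄ : fderiv ℝ (fun q => projJacobian u G₁ G₂ q *
    traceL n (shape u (prodMetric G₁ G₂) q Y)) q = _ := e₂.fderiv
  rw [← e₃, e₁.fderiv_eq, e₄]
  simp [h.fderiv_projJacobian hq]
  ring

end IsLocalGraphImmersion

/-- The covariant derivative along a map `u` of a vector field `V` along `u`. -/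
def nablaAlong {E E' : Type*} [NormedAddCommGroup E] [NormedSpace ℝ E] [NormedAddCommGroup E']
    [NormedSpace ℝ E'] (u : E → E') (G : E' → E' →L[ℝ] E' →L[ℝ] ℝ) (V : E → E') (q : E) :
    E →L[ℝ] E' :=
  fderiv ℝ V q + ((christoffelL G (u q)).flip (V q)).comp (fderiv ℝ u q)

theorem nablaAlong_apply {E E' : Type*} [NormedAddCommGroup E] [NormedSpace ℝ E]
    [NormedAddCommGroup E'] [NormedSpace ℝ E'] (u : E → E') (G : E' → E' →L[ℝ] E' →L[ℝ] ℝ)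
    (V : E → E') (q X : E) : nablaAlong u G V q X =
      fderiv ℝ V q X + christoffelL G (u q) (fderiv ℝ u q X) (V q) := rfl

theorem _root_.HasDerivWithinAt.bilinearComp {E F W : Type*} [NormedAddCommGroup E]
    [NormedSpace ℝ E] [NormedAddCommGroup F] [NormedSpace ℝ F] [NormedAddCommGroup W]
    [NormedSpace ℝ W] {B : ℝ → F →L[ℝ] F →L[ℝ] W} {B' : F →L[ℝ] F →L[ℝ] W} {S : ℝ → E →L[ℝ] F}
    {S' : E →L[ℝ] F} {I : Set ℝ} {t : ℝ} (hB : HasDerivWithinAt B B' I t)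
    (hS : HasDerivWithinAt S S' I t) :
    HasDerivWithinAt (fun s => (B s).bilinearComp (S s) (S s))
      (B'.bilinearComp (S t) (S t) + (B t).bilinearComp S' (S t) + (B t).bilinearComp (S t) S')
      I t := by
  have e₁ := hB.clm_comp hS
  have e₂ := (flipCLM E F W).hasFDerivAt.comp_hasDerivWithinAt t e₁
  have e₃ := e₂.clm_comp hS
  have e₄ := (flipCLM E E W).hasFDerivAt.comp_hasDerivWithinAt t e₃
  refine (e₄.congr_deriv ?_)
  ext X Y
  simp

/-- The hypothesis on `fderiv` is the interchange of `∂ₜ` with the space derivative. Metric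
compatibility produces `Γ(V, du X)`, and symmetry of `Γ` turns it into the term `Γ(du X, V)` of the
covariant derivative of the velocity along `u`. -/
theorem hasDerivWithinAt_pullMetric {E E' : Type*} [NormedAddCommGroup E] [NormedSpace ℝ E]
    [NormedAddCommGroup E'] [NormedSpace ℝ E'] [FiniteDimensional ℝ E'] {u : ℝ → E → E'}
    {G : E' → E' →L[ℝ] E' →L[ℝ] ℝ} {U : Set E'} (hG : IsLocalMetric G U) {V : E → E'} {q : E}
    {I : Set ℝ} {t : ℝ} (hU : u t q ∈ U) (hV : HasDerivWithinAt (fun s => u s q) (V q) I t)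
    (hV' : HasDerivWithinAt (fun s => fderiv ℝ (u s) q) (fderiv ℝ V q) I t) :
    ∃ B' : E →L[ℝ] E →L[ℝ] ℝ, HasDerivWithinAt (fun s => pullMetric (u s) G q) B' I t ∧
      ∀ X Y, B' X Y = G (u t q) (nablaAlong (u t) G V q X) (fderiv ℝ (u t) q Y)
        + G (u t q) (fderiv ℝ (u t) q X) (nablaAlong (u t) G V q Y) := by
  have e₁ := (hG.differentiableAt hU).hasFDerivAt.comp_hasDerivWithinAt t hV
  refine ⟨_, e₁.bilinearComp hV', fun X Y => ?_⟩
  simp only [add_apply, ContinuousLinearMap.bilinearComp_apply, hG.compat hU, nablaAlong_apply,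
    map_add, Function.comp_apply, christoffelL_apply]
  rw [hG.christoffel_symm hU (V q), hG.christoffel_symm hU (V q)]
  ring

/-- The metric trace commutes with the covariant derivative: `hasDerivWithinAt_metricTrace` is
applied along a line, with the Christoffel operator of the induced metric as `K`. -/
theorem IsLocalImmersion.nablaAlong_meanCurvature {E' : Type*}
    [NormedAddCommGroup E'] [NormedSpace ℝ E'] [FiniteDimensional ℝ E'] {u : Euc n → E'}
    {O : Set (Euc n)} {G : E' → E' →L[ℝ] E' →L[ℝ] ℝ} {U : Set E'} {q : Euc n}
    (h : IsLocalImmersion u O G U) (hq : q ∈ O) {V : Euc n → E'}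
    (hV : ∀ᶠ y in 𝓝 q, V y = metricTrace (pullMetric u G y) fun X Y => sff u G y X Y)
    (hVd : DifferentiableAt ℝ V q) {τ : Fin n → Euc n} (hτ : IsOrthonormal (pullMetric u G q) τ)
    (X : Euc n) : nablaAlong u G V q X = ∑ i, nablaSff u G q X (τ i) (τ i) := by
  have hm := h.isLocalMetric
  have e₀ : DifferentiableAt ℝ
      (fun y => metricTrace (pullMetric u G y) fun X Y => sff u G y X Y) q :=
    hVd.congr_of_eventuallyEq (by filter_upwards [hV] with y hy using hy.symm)
  have e₁ := hasDerivAt_line e₀ X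
  have e₂ := hasDerivWithinAt_metricTrace (s := univ) (t := 0)
    (B := fun s : ℝ => pullMetric u G (q + s • X)) (T := fun s : ℝ => sff u G (q + s • X))
    (by simpa using hm.inner q hq) (hasDerivAt_line (hm.differentiableAt hq) X)
    (hasDerivAt_line (h.differentiableAt_of_smooth h.smooth_sff hq) X)
    (K := christoffelL (pullMetric u G) q X)
    (fun Y Z => by simpa [christoffelL_apply] using hm.compat hq X Y Z) (by simpa using hτ)
  rw [hasDerivWithinAt_univ] at e₁ e₂
  have e₃ := e₁.unique e₂
  simp only [zero_smul, add_zero] at e₃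
  have e₄ : V =ᶠ[𝓝 q] fun y => metricTrace (pullMetric u G y) fun X Y => sff u G y X Y := hV
  rw [nablaAlong_apply, e₄.fderiv_eq, e₃, e₄.eq_of_nhds, hτ.metricTrace_eq, map_sum,
    ← Finset.sum_add_distrib]
  refine Finset.sum_congr rfl fun i _ => ?_
  rw [nablaSff]
  abel

/-- The evolution of the Jacobian of the projection to the first factor under the mean curvature
flow, in coordinates and before the curvature and the second fundamental form are expressed in
an adapted frame. -/
theorem hasDerivWithinAt_projJacobian {u : ℝ → Euc n → Euc n × E₂} {O : Set (Euc n)}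
    {G₁ : Euc n → Euc n →L[ℝ] Euc n →L[ℝ] ℝ} {G₂ : E₂ → E₂ →L[ℝ] E₂ →L[ℝ] ℝ}
    {U₁ : Set (Euc n)} {U₂ : Set E₂} {q : Euc n} {I : Set ℝ} {t : ℝ}
    (h : IsLocalGraphImmersion (u t) O G₁ G₂ U₁ U₂) (hq : q ∈ O) {V : Euc n → Euc n × E₂}
    (hu : ∀ᶠ s in 𝓝[I] t, DifferentiableAt ℝ (u s) q) (ht : t ∈ I)
    (hV : ∀ᶠ y in 𝓝 q, V y = metricTrace (pullMetric (u t) (prodMetric G₁ G₂) y)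
      fun X Y => sff (u t) (prodMetric G₁ G₂) y X Y)
    (hVd : DifferentiableAt ℝ V q)
    (hut : HasDerivWithinAt (fun s => u s q) (V q) I t)
    (hut' : HasDerivWithinAt (fun s => fderiv ℝ (u s) q) (fderiv ℝ V q) I t)
    {τ : Fin n → Euc n}
    (hτ : IsOrthonormal (pullMetric (u t) (prodMetric G₁ G₂) q) τ) :
    HasDerivWithinAt (fun s => projJacobian (u s) G₁ G₂ q)
      (∑ i, (fderiv ℝ (fderiv ℝ (projJacobian (u t) G₁ G₂)) q (τ i) (τ i)
          - fderiv ℝ (projJacobian (u t) G₁ G₂) q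
              (christoffelL (pullMetric (u t) (prodMetric G₁ G₂)) q (τ i) (τ i)))
        + projJacobian (u t) G₁ G₂ q *
          (∑ i, ∑ k, prodMetric G₁ G₂ (u t q) (sff (u t) (prodMetric G₁ G₂) q (τ i) (τ k))
              (sff (u t) (prodMetric G₁ G₂) q (τ i) (τ k))
            + ∑ i, (traceL n ((shape (u t) (prodMetric G₁ G₂) q (τ i)).comp
                (shape (u t) (prodMetric G₁ G₂) q (τ i)))
              - traceL n (shape (u t) (prodMetric G₁ G₂) q (τ i)) ^ 2)
            + ∑ i, ∑ k, (pullMetric (u t) (prodMetric G₁ G₂) q ((jac (u t) q).inverse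
                (curvature (prodMetric G₁ G₂) (u t q) (fderiv ℝ (u t) q (τ k))
                  (fderiv ℝ (u t) q (τ i)) (fderiv ℝ (u t) q (τ i))).1) (τ k)
              - prodMetric G₁ G₂ (u t q) (curvature (prodMetric G₁ G₂) (u t q)
                  (fderiv ℝ (u t) q (τ k)) (fderiv ℝ (u t) q (τ i)) (fderiv ℝ (u t) q (τ i)))
                  (fderiv ℝ (u t) q (τ k)))))
      I t := by
  set G := prodMetric G₁ G₂ with hG
  have him : IsLocalImmersion (u t) O G (U₁ ×ˢ U₂) := h.isLocalImmersion
  have hm := him.isLocalMetric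
  have hm₁ := h.isLocalImmersion_fst.isLocalMetric
  have hsymm := (him.metric.inner _ (him.mapsTo hq)).symm
  obtain ⟨B', hB', hB''⟩ := hasDerivWithinAt_pullMetric him.metric (him.mapsTo hq) hut hut'
  have hfst : ∀ᶠ s in 𝓝[I] t, fderiv ℝ (fun q => (u s q).1) q = jac (u s) q := by
    filter_upwards [hu] with s hs
    exact (hasFDerivAt_fst.comp q hs.hasFDerivAt).fderiv
  have hfst' := hfst.self_of_nhdsWithin ht
  have hV₁ : fderiv ℝ (fun q => (V q).1) q = (ContinuousLinearMap.fst ℝ (Euc n) E₂).comp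
    (fderiv ℝ V q) := (hasFDerivAt_fst.comp q hVd.hasFDerivAt).fderiv
  obtain ⟨P', hP', hP''⟩ := hasDerivWithinAt_pullMetric (u := fun s q => (u s q).1)
    (V := fun q => (V q).1) h.metric₁ (h.mapsTo hq).1
    (show HasDerivWithinAt (fun s => (u s q).1) (V q).1 I t from
      ((ContinuousLinearMap.fst ℝ (Euc n) E₂).hasFDerivAt).comp_hasDerivWithinAt t hut) (by
      rw [hV₁]
      have := ((ContinuousLinearMap.compL ℝ (Euc n) (Euc n × E₂) (Euc n)
        (ContinuousLinearMap.fst ℝ (Euc n) E₂)).hasFDerivAt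
          (x := fderiv ℝ (u t) q)).comp_hasDerivWithinAt t hut'
      exact this.congr_of_eventuallyEq hfst hfst')
  have hd := hasDerivWithinAt_sqrt_gram_det_div (hm₁.inner q hq) (hm.inner q hq) hP' hB'
  refine hd.congr_deriv ?_
  have hN : ∀ X, nablaAlong (u t) G V q X = ∑ i, nablaSff (u t) G q X (τ i) (τ i) :=
    him.nablaAlong_meanCurvature hq hV hVd hτ
  have hN₁ : ∀ X, nablaAlong (fun q => (u t q).1) G₁ (fun q => (V q).1) q X =
      (nablaAlong (u t) G V q X).1 := fun X => by
    rw [nablaAlong_apply, nablaAlong_apply, hV₁, hfst', christoffelL_apply, christoffelL_apply,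
      hG, h.metric₁.christoffel_prodMetric h.metric₂ (h.mapsTo hq)]
    rfl
  -- The variation of the projected metric is governed by the operator `jac⁻¹ π₁ ∇H`, so its metric
  -- trace is twice the trace of this operator. The trace is then evaluated in the frame of the
  -- induced metric, as it depends on no metric.
  have htr₁ : metricTrace (pullMetric (fun q => (u t q).1) G₁ q) (fun X Y => P' X Y) =
      2 * ∑ k, pullMetric (u t) G q ((jac (u t) q).inverse (nablaAlong (u t) G V q (τ k)).1)
        (τ k) := by
    rw [(hm₁.inner q hq).metricTrace_compat ((jac (u t) q).inverse.comp
      ((ContinuousLinearMap.fst ℝ (Euc n) E₂).comp (nablaAlong (u t) G V q))), hτ.trace_eq]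
    · rfl
    · intro X Y
      rw [hP'', hN₁, hN₁, pullMetric_apply, pullMetric_apply, hfst']
      simp [h.jac_inverse hq]
  -- This is `-2 |H|²`: the velocity is normal, and the tangential part of `∇H` comes from
  -- `apply_nablaSff`.
  have htr₂ : metricTrace (pullMetric (u t) G q) (fun X Y => B' X Y) =
      -(2 * ∑ i, ∑ k, G (u t q) (sff (u t) G q (τ i) (τ i)) (sff (u t) G q (τ k) (τ k))) := by
    rw [hτ.metricTrace_eq, Finset.mul_sum, ← Finset.sum_neg_distrib]
    refine Finset.sum_congr rfl fun i _ => ?_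
    rw [hB'', hsymm (fderiv ℝ (u t) q (τ i)), hN, map_sum, sum_apply, ← two_mul, ← mul_neg,
      ← Finset.sum_neg_distrib]
    congr 1
    refine Finset.sum_congr rfl fun k _ => ?_
    rw [him.apply_nablaSff hq, hsymm]
  have hL : ∀ i, fderiv ℝ (fderiv ℝ (projJacobian (u t) G₁ G₂)) q (τ i) (τ i)
          - fderiv ℝ (projJacobian (u t) G₁ G₂) q
              (christoffelL (pullMetric (u t) G) q (τ i) (τ i)) =
      projJacobian (u t) G₁ G₂ q * (traceL n (shape (u t) G q (τ i)) ^ 2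
        + ∑ k, pullMetric (u t) G q ((jac (u t) q).inverse
            (nablaSff (u t) G q (τ i) (τ k) (τ i)).1) (τ k)
        - traceL n ((shape (u t) G q (τ i)).comp (shape (u t) G q (τ i)))) := fun i => by
    rw [h.fderiv₂_projJacobian hq, h.fderiv_projJacobian hq, h.trace_fderiv_shape hq hτ]
    simp only [← hG, him.nablaSff_symm hq (τ i) (τ i)]
    ring
  have hcod : ∀ i k, nablaSff (u t) G q (τ k) (τ i) (τ i) - nablaSff (u t) G q (τ i) (τ k) (τ i) =
      curvature G (u t q) (fderiv ℝ (u t) q (τ k)) (fderiv ℝ (u t) q (τ i))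
        (fderiv ℝ (u t) q (τ i)) - fderiv ℝ (u t) q
          (curvature (pullMetric (u t) G) q (τ k) (τ i) (τ i)) := fun i k =>
    him.codazzi hq _ _ _
  -- The Gauss equation, read off by pairing the Codazzi identity with the tangent vector `du τₖ`.
  have hgauss : ∀ i k, pullMetric (u t) G q
      (curvature (pullMetric (u t) G) q (τ k) (τ i) (τ i)) (τ k) =
      G (u t q) (curvature G (u t q) (fderiv ℝ (u t) q (τ k)) (fderiv ℝ (u t) q (τ i))
        (fderiv ℝ (u t) q (τ i))) (fderiv ℝ (u t) q (τ k))
      + G (u t q) (sff (u t) G q (τ i) (τ i)) (sff (u t) G q (τ k) (τ k))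
      - G (u t q) (sff (u t) G q (τ i) (τ k)) (sff (u t) G q (τ i) (τ k)) := fun i k => by
    have e := congrArg (fun v => G (u t q) v (fderiv ℝ (u t) q (τ k))) (hcod i k)
    simp only [map_sub, sub_apply, him.apply_nablaSff hq] at e
    rw [him.sff_symm hq (τ k) (τ i)] at e
    rw [pullMetric_apply]
    linarith
  rw [htr₁, htr₂]
  change projJacobian (u t) G₁ G₂ q * _ = _
  simp only [hL, ← Finset.mul_sum]
  rw [← mul_add]
  congr 1
  -- Codazzi moves the differentiation from `τₖ` to `τᵢ`, matching the Laplacian. The tangential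
  -- term passes through `jac⁻¹ π₁` unchanged, as intrinsic curvature; substituting `hgauss` then
  -- cancels `|H|²` and leaves `|A|²`.
  have hk : ∀ k, pullMetric (u t) G q ((jac (u t) q).inverse (nablaAlong (u t) G V q (τ k)).1)
      (τ k) = ∑ i, (pullMetric (u t) G q ((jac (u t) q).inverse
          (nablaSff (u t) G q (τ i) (τ k) (τ i)).1) (τ k)
        + (pullMetric (u t) G q ((jac (u t) q).inverse (curvature G (u t q) (fderiv ℝ (u t) q (τ k))
            (fderiv ℝ (u t) q (τ i)) (fderiv ℝ (u t) q (τ i))).1) (τ k)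
          - pullMetric (u t) G q (curvature (pullMetric (u t) G) q (τ k) (τ i) (τ i)) (τ k))) :=
    fun k => by
      rw [hN, Prod.fst_sum, map_sum, map_sum, sum_apply]
      refine Finset.sum_congr rfl fun i _ => ?_
      rw [← sub_add_cancel (nablaSff (u t) G q (τ k) (τ i) (τ i))
        (nablaSff (u t) G q (τ i) (τ k) (τ i)), hcod]
      simp only [Prod.fst_add, Prod.fst_sub, map_add, map_sub, h.inverse_jac hq, add_apply,
        sub_apply]
      ring
  simp only [hk, hgauss]
  rw [Finset.sum_comm]
  simp only [Finset.sum_add_distrib, Finset.sum_sub_distrib]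
  ring

end Evolution


/-! ### Adapted frames: linear algebra -/

section AdaptedFrames

theorem extendZero_of_lt {V : Type*} [Zero V] {N : ℕ} (v : Fin N → V) {k : ℕ} (h : k < N) :
    extendZero v k = v ⟨k, h⟩ := by simp [extendZero, h]

theorem extendZero_of_le {V : Type*} [Zero V] {N : ℕ} (v : Fin N → V) {k : ℕ} (h : N ≤ k) :
    extendZero v k = 0 := by simp [extendZero, h]

@[simp] theorem extendZero_val {V : Type*} [Zero V] {N : ℕ} (v : Fin N → V) (i : Fin N) :
    extendZero v i = v i := extendZero_of_lt v i.2

/-- Allows a sum over tangential indices to be read as one over normal indices: with the zero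
conventions only indices below both `n` and `m` contribute. -/
theorem sum_fin_eq_sum_fin {n m : ℕ} (f : ℕ → ℝ) (hn : ∀ k, n ≤ k → f k = 0)
    (hm : ∀ k, m ≤ k → f k = 0) : ∑ i : Fin n, f i = ∑ i : Fin m, f i := by
  rw [Fin.sum_univ_eq_sum_range, Fin.sum_univ_eq_sum_range]
  rcases le_total n m with h | h
  · exact Finset.sum_subset (by simpa using h) fun k _ hk => hn k (by simpa using hk)
  · exact (Finset.sum_subset (by simpa using h) fun k _ hk => hm k (by simpa using hk)).symm

theorem sum_eq_two_mul_sum_Ioi {n : ℕ} (f : Fin n → Fin n → ℝ) (hf : ∀ i j, f i j = f j i)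
    (h0 : ∀ i, f i i = 0) : ∑ i, ∑ j, f i j = 2 * ∑ i, ∑ j ∈ Finset.Ioi i, f i j := by
  have h1 : ∀ i, ∑ j, f i j = ∑ j ∈ Finset.Ioi i, f i j + ∑ j ∈ Finset.Iio i, f i j := fun i => by
    rw [← Finset.sum_subset (Finset.subset_univ (Finset.univ.erase i))
      (fun j _ hj => by simp at hj; rw [hj, h0]), ← Finset.sum_union]
    · refine Finset.sum_congr ?_ fun _ _ => rfl
      ext j
      simp only [Finset.mem_erase, Finset.mem_univ, and_true, Finset.mem_union, Finset.mem_Ioi,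
        Finset.mem_Iio]
      rw [ne_comm, lt_or_lt_iff_ne]
    · rw [Finset.disjoint_left]
      intro j hj hj'
      exact lt_asymm (Finset.mem_Ioi.1 hj) (Finset.mem_Iio.1 hj')
  simp only [h1, Finset.sum_add_distrib]
  have h2 : ∑ i, ∑ j ∈ Finset.Iio i, f i j = ∑ i, ∑ j ∈ Finset.Ioi i, f i j := by
    rw [Finset.sum_comm' (t' := Finset.univ) (s' := fun j => Finset.Ioi j) (by simp)]
    exact Finset.sum_congr rfl fun i _ => Finset.sum_congr rfl fun j _ => hf _ _
  rw [h2]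
  ring

variable {n m : ℕ}

/-- The linear algebra of an adapted frame: `L` is the differential of the immersion. -/
structure IsFrame (B₁ : Euc n →L[ℝ] Euc n →L[ℝ] ℝ) (B₂ : Euc m →L[ℝ] Euc m →L[ℝ] ℝ)
    (L : Euc n →L[ℝ] Euc n × Euc m) (a : Fin n → Euc n) (b : Fin m → Euc m) (lam : Fin n → ℝ)
    (τ : Fin n → Euc n) : Prop where
  orthonormal_a : IsOrthonormal B₁ a
  orthonormal_b : IsOrthonormal B₂ b
  lam_eq_zero : ∀ i : Fin n, m ≤ (i : ℕ) → lam i = 0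
  apply_τ : ∀ i, L (τ i) = (1 / √(1 + lam i ^ 2)) • (a i, lam i • extendZero b i)
  injective : Function.Injective ((ContinuousLinearMap.fst ℝ (Euc n) (Euc m)).comp L)

/-- The components of a vector with respect to the adapted normal frame. -/
def normalComponent (B₁ : Euc n →L[ℝ] Euc n →L[ℝ] ℝ) (B₂ : Euc m →L[ℝ] Euc m →L[ℝ] ℝ)
    (a : Fin n → Euc n) (b : Fin m → Euc m) (lam : Fin n → ℝ) (v : Euc n × Euc m) (α : ℕ) : ℝ :=
  extendZero (fun β : Fin m => prodForm B₁ B₂ v (normalFrame a b lam β)) α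

namespace IsFrame

variable {B₁ : Euc n →L[ℝ] Euc n →L[ℝ] ℝ} {B₂ : Euc m →L[ℝ] Euc m →L[ℝ] ℝ}
  {L : Euc n →L[ℝ] Euc n × Euc m} {a : Fin n → Euc n} {b : Fin m → Euc m} {lam : Fin n → ℝ}
  {τ : Fin n → Euc n}

theorem scale_pos (x : ℝ) : 0 < 1 / √(1 + x ^ 2) := by positivity

theorem scale_sq (x : ℝ) : (1 / √(1 + x ^ 2)) ^ 2 = 1 / (1 + x ^ 2) := by
  rw [div_pow, Real.sq_sqrt (by positivity), one_pow]

theorem scale_sq_mul (x : ℝ) : (1 / √(1 + x ^ 2)) ^ 2 * (1 + x ^ 2) = 1 := by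
  rw [scale_sq]
  field_simp

/-- The padded family `extendZero b` fails to be orthonormal beyond index `m`, but `lam` vanishes
there, so the weighted products are diagonal at all indices. -/
theorem lam_mul_apply_b (h : IsFrame B₁ B₂ L a b lam τ) (i j : Fin n) :
    lam i * (lam j * B₂ (extendZero b i) (extendZero b j)) = if i = j then lam i ^ 2 else 0 := by
  rcases lt_or_ge (i : ℕ) m with hi | hi
  · rcases lt_or_ge (j : ℕ) m with hj | hj
    · rw [extendZero_of_lt b hi, extendZero_of_lt b hj, h.orthonormal_b]
      by_cases hij : i = j
      · subst hij
        simp [sq]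
      · simp [hij, Fin.ext_iff, Fin.val_ne_of_ne hij]
    · rw [h.lam_eq_zero j hj]
      by_cases hij : i = j
      · subst hij
        omega
      · simp [hij]
  · rw [h.lam_eq_zero i hi]
    simp

theorem isOrthonormal_τ (h : IsFrame B₁ B₂ L a b lam τ) :
    IsOrthonormal ((prodForm B₁ B₂).bilinearComp L L) τ := by
  intro i j
  rw [ContinuousLinearMap.bilinearComp_apply, h.apply_τ, h.apply_τ, prodForm_apply]
  simp only [Prod.smul_fst, Prod.smul_snd, map_smul, smul_apply, smul_eq_mul, h.orthonormal_a i j]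
  have e := h.lam_mul_apply_b i j
  by_cases hij : i = j
  · subst hij
    have := scale_sq_mul (lam i)
    simp only [if_true] at e ⊢
    linear_combination this + (1 / √(1 + lam i ^ 2)) ^ 2 * e
  · simp only [hij, if_false] at e ⊢
    linear_combination 1 / √(1 + lam i ^ 2) * (1 / √(1 + lam j ^ 2)) * e

/-- Orthogonality to `eᵢ` reads `⟨v₁, aᵢ⟩ + λᵢ ⟨v₂, bᵢ⟩ = 0`: the second component of a normal
vector determines the first. -/
theorem apply_a (h : IsFrame B₁ B₂ L a b lam τ) (v : Euc n × Euc m)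
    (hv : ∀ X, prodForm B₁ B₂ v (L X) = 0) (i : Fin n) :
    B₁ v.1 (a i) = -(lam i * extendZero (fun β => B₂ v.2 (b β)) i) := by
  have := hv (τ i)
  rw [h.apply_τ, map_smul, prodForm_apply, smul_eq_mul] at this
  have := (mul_eq_zero.1 this).resolve_left (scale_pos (lam i)).ne'
  simp only [map_smul, smul_eq_mul] at this
  rcases lt_or_ge (i : ℕ) m with hi | hi
  · rw [extendZero_of_lt _ hi] at this ⊢
    linarith
  · rw [h.lam_eq_zero i hi] at this ⊢
    linarith

/-- Inserting `apply_a` into the product with the normal frame vector gives `(1 + λ²) / √(1 + λ²)`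
times `⟨v₂, b_α⟩`. For `α ≥ n` the convention `λ = 0` makes the factor `1`. -/
theorem apply_b (h : IsFrame B₁ B₂ L a b lam τ) (v : Euc n × Euc m)
    (hv : ∀ X, prodForm B₁ B₂ v (L X) = 0) (α : ℕ) :
    extendZero (fun β => B₂ v.2 (b β)) α =
      1 / √(1 + extendZero lam α ^ 2) * normalComponent B₁ B₂ a b lam v α := by
  rcases lt_or_ge α m with hα | hα
  · rw [normalComponent, extendZero_of_lt _ hα, extendZero_of_lt _ hα, normalFrame, map_smul,
      prodForm_apply]
    simp only [map_neg, map_smul, smul_eq_mul]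
    rcases lt_or_ge α n with hα' | hα'
    · rw [extendZero_of_lt _ hα', extendZero_of_lt _ hα']
      have e₁ := h.apply_a v hv ⟨α, hα'⟩
      simp only [extendZero_of_lt _ hα] at e₁
      have e₂ := scale_sq_mul (lam ⟨α, hα'⟩)
      rw [e₁]
      linear_combination (-B₂ v.2 (b ⟨α, hα⟩)) * e₂
    · rw [extendZero_of_le _ hα', extendZero_of_le _ hα']
      simp
  · rw [normalComponent, extendZero_of_le _ hα, extendZero_of_le _ hα, mul_zero]

theorem apply_a' (h : IsFrame B₁ B₂ L a b lam τ) (v : Euc n × Euc m)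
    (hv : ∀ X, prodForm B₁ B₂ v (L X) = 0) (i : Fin n) :
    B₁ v.1 (a i) = -(lam i * (1 / √(1 + lam i ^ 2) * normalComponent B₁ B₂ a b lam v i)) := by
  rw [h.apply_a v hv, h.apply_b v hv, extendZero_val]

theorem apply_self {B₁ : Euc n →L[ℝ] Euc n →L[ℝ] ℝ} {a : Fin n → Euc n} (ha : IsOrthonormal B₁ a) (v : Euc n) :
    B₁ v v = ∑ i, B₁ v (a i) ^ 2 := by
  conv_lhs => enter [2]; rw [← ha.sum_smul v]
  simp [sq]

/-- Parseval for normal vectors, without proving that the normal frame spans: the first component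
contributes `λ² ⟨v₂, b⟩²`, the second `⟨v₂, b⟩²`, and `1 + λ²` is the normalisation in `apply_b`. -/
theorem prodForm_self (h : IsFrame B₁ B₂ L a b lam τ) (v : Euc n × Euc m)
    (hv : ∀ X, prodForm B₁ B₂ v (L X) = 0) :
    prodForm B₁ B₂ v v = ∑ α : Fin m, normalComponent B₁ B₂ a b lam v α ^ 2 := by
  rw [prodForm_apply, apply_self h.orthonormal_a, apply_self h.orthonormal_b]
  have e₁ : ∑ i, B₁ v.1 (a i) ^ 2 = ∑ i : Fin n, (fun k : ℕ => extendZero lam k ^ 2 *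
      extendZero (fun β => B₂ v.2 (b β)) k ^ 2) i := by
    refine Finset.sum_congr rfl fun i _ => ?_
    rw [h.apply_a v hv]
    simp only [extendZero_val lam]
    ring
  rw [e₁, sum_fin_eq_sum_fin (m := m) (fun k : ℕ => extendZero lam k ^ 2 *
      extendZero (fun β => B₂ v.2 (b β)) k ^ 2) (fun k hk => by simp [extendZero_of_le lam hk])
    (fun k hk => by simp [extendZero_of_le (fun β => B₂ v.2 (b β)) hk]), ← Finset.sum_add_distrib]
  refine Finset.sum_congr rfl fun α _ => ?_
  have e₂ := h.apply_b v hv α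
  have e₃ := scale_sq_mul (extendZero lam α)
  rw [extendZero_val] at e₂
  simp only [extendZero_val (fun β => B₂ v.2 (b β)), e₂]
  linear_combination (normalComponent B₁ B₂ a b lam v α) ^ 2 * e₃

theorem inverse_fst_a (h : IsFrame B₁ B₂ L a b lam τ) (i : Fin n) :
    ((ContinuousLinearMap.fst ℝ (Euc n) (Euc m)).comp L).inverse
      ((1 / √(1 + lam i ^ 2)) • a i) = τ i := by
  have := (isInvertible_of_injective h.injective).inverse_apply_self (τ i)
  rw [ContinuousLinearMap.comp_apply, h.apply_τ] at this
  exact this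

/-- Expand `v₁` in the `aⱼ`, whose coefficients are given by `apply_a'`; the scale `1 / √(1 + λⱼ²)`
is absorbed because `τⱼ` projects to `aⱼ / √(1 + λⱼ²)`. -/
theorem inverse_fst (h : IsFrame B₁ B₂ L a b lam τ) (v : Euc n × Euc m)
    (hv : ∀ X, prodForm B₁ B₂ v (L X) = 0) :
    ((ContinuousLinearMap.fst ℝ (Euc n) (Euc m)).comp L).inverse v.1 =
      -∑ j, (lam j * normalComponent B₁ B₂ a b lam v j) • τ j := by
  conv_lhs => rw [← h.orthonormal_a.sum_smul v.1]
  rw [map_sum, ← Finset.sum_neg_distrib]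
  refine Finset.sum_congr rfl fun j _ => ?_
  rw [h.apply_a' v hv, ← h.inverse_fst_a j, ← map_smul, ← map_neg]
  congr 1
  module

/-- By `inverse_fst` the matrix of `S(τₖ)` is `-x` with `xᵢⱼ = λᵢ hₙ₊ᵢ,ⱼₖ`. Then `tr x² - (tr x)²`
is the sum of `xᵢⱼ xⱼᵢ - xᵢᵢ xⱼⱼ`, which is symmetric in `i, j` and zero on the diagonal, hence
twice its part over `i < j`. -/
theorem trace_comp_sub_sq (h : IsFrame B₁ B₂ L a b lam τ)
    {A : Euc n →L[ℝ] Euc n →L[ℝ] Euc n × Euc m} (hA : ∀ X Y, A X Y = A Y X)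
    (hA' : ∀ X Y Z, prodForm B₁ B₂ (A X Y) (L Z) = 0)
    {S : Euc n →L[ℝ] Euc n →L[ℝ] Euc n}
    (hS : ∀ X Y, S X Y = ((ContinuousLinearMap.fst ℝ (Euc n) (Euc m)).comp L).inverse (A X Y).1)
    (k : Fin n) :
    traceL n ((S (τ k)).comp (S (τ k))) - traceL n (S (τ k)) ^ 2 =
      -(2 * ∑ i, ∑ j ∈ Finset.Ioi i, lam i * lam j *
          normalComponent B₁ B₂ a b lam (A (τ i) (τ k)) i *
          normalComponent B₁ B₂ a b lam (A (τ j) (τ k)) j)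
      + 2 * ∑ i, ∑ j ∈ Finset.Ioi i, lam i * lam j *
          normalComponent B₁ B₂ a b lam (A (τ i) (τ k)) j *
          normalComponent B₁ B₂ a b lam (A (τ j) (τ k)) i := by
  have hτ := h.isOrthonormal_τ
  set x : Fin n → Fin n → ℝ := fun i j =>
    lam i * normalComponent B₁ B₂ a b lam (A (τ j) (τ k)) i with hx
  have hSτ : ∀ j, S (τ k) (τ j) = -∑ i, x i j • τ i := fun j => by
    rw [hS, h.inverse_fst _ (hA' _ _), hA]
  have e₁ : traceL n (S (τ k)) = -∑ j, x j j := by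
    rw [traceL_apply, hτ.trace_eq, ← Finset.sum_neg_distrib]
    refine Finset.sum_congr rfl fun j _ => ?_
    rw [ContinuousLinearMap.coe_coe, hSτ]
    simp only [map_neg, map_sum, map_smul, neg_apply, sum_apply, smul_apply, hτ _ _]
    simp
  have e₂ : traceL n ((S (τ k)).comp (S (τ k))) = ∑ j, ∑ i, x i j * x j i := by
    rw [traceL_apply, hτ.trace_eq]
    refine Finset.sum_congr rfl fun j _ => ?_
    rw [ContinuousLinearMap.coe_coe, ContinuousLinearMap.comp_apply, hSτ]
    simp only [map_neg, map_sum, map_smul, neg_apply, sum_apply, smul_apply, hSτ, hτ _ _]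
    simp
  have e₃ : (∑ j, x j j) ^ 2 = ∑ j, ∑ i, x i i * x j j := by
    rw [sq, Finset.sum_mul_sum, Finset.sum_comm]
  have e₄ := sum_eq_two_mul_sum_Ioi (fun j i => x i j * x j i - x i i * x j j)
    (fun i j => by ring) (fun i => by ring)
  rw [e₁, e₂, neg_sq, e₃, ← Finset.sum_sub_distrib]
  simp only [← Finset.sum_sub_distrib]
  rw [e₄]
  simp only [Finset.sum_sub_distrib, hx]
  rw [mul_sub, sub_eq_neg_add]
  congr 1
  · congr 2
    refine Finset.sum_congr rfl fun i _ => Finset.sum_congr rfl fun j _ => by ring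
  · congr 1
    refine Finset.sum_congr rfl fun i _ => Finset.sum_congr rfl fun j _ => by ring

/-- The frame is orthogonal in both factors, with squared lengths `cᵢ = 1 / (1 + λᵢ²)` in the first
and `1 - cᵢ` in the second. For `k ≠ i` the summand is `k₁ cᵢ (1 - cₖ) - k₂ (1 - cᵢ)(1 - cₖ)`. -/
theorem curvature_sum (h : IsFrame B₁ B₂ L a b lam τ) {k₁ k₂ : ℝ}
    {R : Euc n × Euc m → Euc n × Euc m → Euc n × Euc m → Euc n × Euc m}
    (hR : ∀ u v w, R u v w = (k₁ • (B₁ v.1 w.1 • u.1 - B₁ u.1 w.1 • v.1),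
      k₂ • (B₂ v.2 w.2 • u.2 - B₂ u.2 w.2 • v.2))) :
    ∑ i, ∑ k, ((prodForm B₁ B₂).bilinearComp L L
        (((ContinuousLinearMap.fst ℝ (Euc n) (Euc m)).comp L).inverse
          (R (L (τ k)) (L (τ i)) (L (τ i))).1) (τ k)
        - prodForm B₁ B₂ (R (L (τ k)) (L (τ i)) (L (τ i))) (L (τ k))) =
      ∑ i, lam i ^ 2 / (1 + lam i ^ 2) *
        (k₁ * (∑ j ∈ Finset.univ.erase i, 1 / (1 + lam j ^ 2))
          + k₂ * (1 - (n : ℝ) + ∑ j ∈ Finset.univ.erase i, 1 / (1 + lam j ^ 2))) := by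
  have hτ := h.isOrthonormal_τ
  set c : Fin n → ℝ := fun i => 1 / (1 + lam i ^ 2) with hc
  have hlam : ∀ i, lam i ^ 2 / (1 + lam i ^ 2) = 1 - c i := fun i => by
    rw [hc]
    field_simp
    ring
  have h₁ : ∀ i k, B₁ (L (τ i)).1 (L (τ k)).1 = if i = k then c i else 0 := fun i k => by
    rw [h.apply_τ, h.apply_τ]
    simp only [Prod.smul_fst, map_smul, smul_apply, smul_eq_mul, h.orthonormal_a i k]
    by_cases hik : i = k
    · subst hik
      have := scale_sq (lam i)
      simp only [if_true, hc]
      linear_combination this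
    · simp [hik]
  have h₂ : ∀ i k, B₂ (L (τ i)).2 (L (τ k)).2 = if i = k then 1 - c i else 0 := fun i k => by
    have := hτ i k
    rw [ContinuousLinearMap.bilinearComp_apply, prodForm_apply, h₁] at this
    by_cases hik : i = k
    · simp only [hik, if_true] at this ⊢
      linarith
    · simpa [hik] using this
  have key : ∀ i k, (prodForm B₁ B₂).bilinearComp L L
        (((ContinuousLinearMap.fst ℝ (Euc n) (Euc m)).comp L).inverse
          (R (L (τ k)) (L (τ i)) (L (τ i))).1) (τ k)
        - prodForm B₁ B₂ (R (L (τ k)) (L (τ i)) (L (τ i))) (L (τ k)) =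
      if k = i then 0 else k₁ * (c i * (1 - c k)) - k₂ * ((1 - c i) * (1 - c k)) := fun i k => by
    have e : ∀ j, ((ContinuousLinearMap.fst ℝ (Euc n) (Euc m)).comp L).inverse (L (τ j)).1 = τ j :=
      fun j => (isInvertible_of_injective h.injective).inverse_apply_self (τ j)
    rw [hR]
    simp only [map_smul, map_sub, e, prodForm_apply, smul_apply, sub_apply, hτ _ _, h₁, h₂,
      smul_eq_mul]
    by_cases hik : k = i
    · simp [hik]
    · simp [hik]
      ring
  -- The constant `1 - n` distributes as `-1` over the `n - 1` indices other than `i`.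
  have hcard : ∀ i, 1 - (n : ℝ) + ∑ j ∈ Finset.univ.erase i, c j =
      ∑ j ∈ Finset.univ.erase i, (c j - 1) := fun i => by
    have : (Finset.univ.erase i).card = n - 1 := by simp
    have hn : 1 ≤ n := i.pos
    rw [Finset.sum_sub_distrib, Finset.sum_const, this, nsmul_eq_mul, Nat.cast_sub hn]
    push_cast
    ring
  have herase : ∀ f : Fin n → Fin n → ℝ, ∀ i, ∑ j ∈ Finset.univ.erase i, f i j =
      ∑ j, if j = i then 0 else f i j := fun f i => by
    rw [Finset.sum_ite, Finset.sum_const_zero, zero_add]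
    refine Finset.sum_congr ?_ fun _ _ => rfl
    ext j
    simp
  simp only [key, hlam, hcard]
  have lhs : ∑ i, ∑ k, (if k = i then 0 else k₁ * (c i * (1 - c k)) - k₂ * ((1 - c i) * (1 - c k)))
      = ∑ i, ∑ k, (if k = i then 0 else k₁ * (c i * (1 - c k)))
        - ∑ i, ∑ k, (if k = i then 0 else k₂ * ((1 - c i) * (1 - c k))) := by
    simp only [← Finset.sum_sub_distrib]
    refine Finset.sum_congr rfl fun i _ => Finset.sum_congr rfl fun k _ => ?_
    split_ifs <;> ring
  -- The `k₁` part carries the factor `1 - c` on its inner index; transposing the double sum moves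
  -- it to the outer index, as in the conclusion.
  rw [lhs, Finset.sum_comm, ← Finset.sum_sub_distrib]
  refine Finset.sum_congr rfl fun i _ => ?_
  rw [mul_add, ← mul_assoc, ← mul_assoc, Finset.mul_sum, Finset.mul_sum,
    herase (fun i j => (1 - c i) * k₁ * c j), herase (fun i j => (1 - c i) * k₂ * (c j - 1)),
    ← Finset.sum_sub_distrib, ← Finset.sum_add_distrib]
  refine Finset.sum_congr rfl fun k _ => ?_
  by_cases hik : k = i
  · simp [hik]
  · simp only [hik, Ne.symm hik, if_false, eq_comm]
    ring

end IsFrame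

end AdaptedFrames


/-! ### From manifolds to coordinates -/

section Charts

variable {E H N : Type*} [NormedAddCommGroup E] [NormedSpace ℝ E] [TopologicalSpace H]
  [TopologicalSpace N] [ChartedSpace H N] {I : ModelWithCorners ℝ E H} [I.Boundaryless]
  [IsManifold I ∞ N]
  {E' H' N' : Type*} [NormedAddCommGroup E'] [NormedSpace ℝ E'] [TopologicalSpace H']
  [TopologicalSpace N'] [ChartedSpace H' N'] {I' : ModelWithCorners ℝ E' H'} [I'.Boundaryless]
  [IsManifold I' ∞ N']
  {E'' H'' N'' : Type*} [NormedAddCommGroup E''] [NormedSpace ℝ E''] [TopologicalSpace H'']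
  [TopologicalSpace N''] [ChartedSpace H'' N''] {I'' : ModelWithCorners ℝ E'' H''}

theorem isManifold_one : IsManifold I 1 N := IsManifold.of_le (n := ∞) (by simp)

theorem differential_comp {f : N → N'} {g : N' → N''} (p : N)
    (hg : MDifferentiableAt I' I'' g (f p)) (hf : MDifferentiableAt I I' f p) :
    differential I I'' (g ∘ f) p = (differential I' I'' g (f p)).comp (differential I I' f p) :=
  mfderiv_comp p hg hf

theorem differential_congr {f g : N → N'} {p : N} (h : f =ᶠ[𝓝 p] g) :
    differential I I' f p = differential I I' g p :=
  h.mfderiv_eq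

theorem differential_eq_fderiv (f : E → E') (x : E) :
    differential 𝓘(ℝ, E) 𝓘(ℝ, E') f x = fderiv ℝ f x := mfderiv_eq_fderiv

theorem mdifferentiableAt_extChartAt_symm (p : N) {y : E} (hy : y ∈ (extChartAt I p).target) :
    MDifferentiableAt 𝓘(ℝ, E) I (extChartAt I p).symm y := by
  have : IsManifold I 1 N := isManifold_one (I := I)
  have := mdifferentiableWithinAt_extChartAt_symm (I := I) hy
  rwa [I.range_eq_univ, mdifferentiableWithinAt_univ] at this

theorem injective_differential_extChartAt_symm (p : N) {y : E}
    (hy : y ∈ (extChartAt I p).target) :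
    Function.Injective (differential 𝓘(ℝ, E) I (extChartAt I p).symm y) := by
  have : IsManifold I 1 N := isManifold_one (I := I)
  have := isInvertible_mfderivWithin_extChartAt_symm (I := I) hy
  rw [I.range_eq_univ, mfderivWithin_univ] at this
  exact this.injective

/-- Tangent vectors at `p` are represented in the preferred chart at `p`, so at its centre the chart
has identity differential. Hence coordinate quantities at the centre agree with the pointwise
definitions. -/
theorem differential_extChartAt_symm_self (p : N) :
    differential 𝓘(ℝ, E) I (extChartAt I p).symm (extChartAt I p p) =
      ContinuousLinearMap.id ℝ E := by
  have : IsManifold I 1 N := isManifold_one (I := I)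
  have := mfderivWithin_range_extChartAt_symm (I := I) (x := p)
  rw [I.range_eq_univ, mfderivWithin_univ] at this
  exact this

theorem localMetric_eq (g : MetricField I N) (p : N) (y : E) :
    localMetric I g p y = (MetricField.form g ((extChartAt I p).symm y)).bilinearComp
      (differential 𝓘(ℝ, E) I (extChartAt I p).symm y)
      (differential 𝓘(ℝ, E) I (extChartAt I p).symm y) := rfl

theorem localMetric_self (g : MetricField I N) (p : N) :
    localMetric I g p (extChartAt I p p) = MetricField.form g p := by
  rw [localMetric_eq, differential_extChartAt_symm_self, extChartAt_to_inv]
  rfl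

theorem differential_eq_fderiv_chart {F : N → N'} {p : N} (hF : MDifferentiableAt I I' F p) :
    differential I I' F p =
      fderiv ℝ (extChartAt I' (F p) ∘ F ∘ (extChartAt I p).symm) (extChartAt I p p) := by
  have := hF.mfderiv
  rw [I.range_eq_univ, fderivWithin_univ] at this
  exact this

/-- The coordinate representation of a map in the preferred charts at `p` and `r`. -/
def chartRep (I : ModelWithCorners ℝ E H) (I' : ModelWithCorners ℝ E' H') (F : N → N') (p : N)
    (r : N') : E → E' :=
  extChartAt I' r ∘ F ∘ (extChartAt I p).symm

theorem continuousAt_extChartAt_symm_of_mem (p : N) {y : E} (hy : y ∈ (extChartAt I p).target) :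
    ContinuousAt (extChartAt I p).symm y :=
  (mdifferentiableAt_extChartAt_symm p hy).continuousAt

theorem eventually_symm_chartRep {F : N → N'} {p : N} {r : N'} {y : E}
    (hy : y ∈ (extChartAt I p).target)
    (hr : F ((extChartAt I p).symm y) ∈ (extChartAt I' r).source)
    (hF : ContinuousAt F ((extChartAt I p).symm y)) :
    ∀ᶠ z in 𝓝 y, F ((extChartAt I p).symm z) ∈ (extChartAt I' r).source :=
  (ContinuousAt.comp (f := (extChartAt I p).symm) (g := F) hF
    (continuousAt_extChartAt_symm_of_mem p hy)).preimage_mem_nhds (extChartAt_source_mem_nhds' hr)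

theorem mdifferentiableAt_extChartAt_of_mem {r : N'} {x : N'} (hr : x ∈ (extChartAt I' r).source) :
    MDifferentiableAt I' 𝓘(ℝ, E') (extChartAt I' r) x := by
  have : IsManifold I' 1 N' := isManifold_one (I := I')
  exact mdifferentiableAt_extChartAt (by rwa [extChartAt_source] at hr)

theorem differentiableAt_chartRep {F : N → N'} {p : N} {r : N'} {y : E}
    (hy : y ∈ (extChartAt I p).target)
    (hr : F ((extChartAt I p).symm y) ∈ (extChartAt I' r).source)
    (hF : MDifferentiableAt I I' F ((extChartAt I p).symm y)) :
    DifferentiableAt ℝ (chartRep I I' F p r) y := by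
  rw [← mdifferentiableAt_iff_differentiableAt]
  exact (mdifferentiableAt_extChartAt_of_mem hr).comp y
    (hF.comp y (mdifferentiableAt_extChartAt_symm p hy))

theorem differential_chartRep {F : N → N'} {p : N} {r : N'} {y : E}
    (hy : y ∈ (extChartAt I p).target)
    (hr : F ((extChartAt I p).symm y) ∈ (extChartAt I' r).source)
    (hF : MDifferentiableAt I I' F ((extChartAt I p).symm y)) :
    (differential 𝓘(ℝ, E') I' (extChartAt I' r).symm (chartRep I I' F p r y)).comp
        (fderiv ℝ (chartRep I I' F p r) y) =
      (differential I I' F ((extChartAt I p).symm y)).comp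
        (differential 𝓘(ℝ, E) I (extChartAt I p).symm y) := by
  have hd := differentiableAt_chartRep hy hr hF
  rw [← differential_eq_fderiv, ← differential_comp, ← differential_comp]
  · apply differential_congr
    filter_upwards [eventually_symm_chartRep hy hr hF.continuousAt] with z hz
    exact (extChartAt I' r).left_inv hz
  · exact hF
  · exact mdifferentiableAt_extChartAt_symm p hy
  · exact mdifferentiableAt_extChartAt_symm r ((extChartAt I' r).map_source hr)
  · exact hd.mdifferentiableAt

/-- The chart `r` of the target is arbitrary, subject only to containing the image point; this
permits a fixed target chart for nearby points and times. -/
theorem localMetric_inducedMetric (g : MetricField I' N') {F : N → N'} {p : N} {r : N'} {y : E}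
    (hy : y ∈ (extChartAt I p).target)
    (hr : F ((extChartAt I p).symm y) ∈ (extChartAt I' r).source)
    (hF : MDifferentiableAt I I' F ((extChartAt I p).symm y)) :
    localMetric I (inducedMetric I g F) p y =
      pullMetric (chartRep I I' F p r) (localMetric I' g r) y := by
  have h := differential_chartRep hy hr hF
  have h2 : (extChartAt I' r).symm (chartRep I I' F p r y) = F ((extChartAt I p).symm y) :=
    (extChartAt I' r).left_inv hr
  ext X Y
  rw [pullMetric_apply, localMetric_eq, localMetric_eq]
  simp only [ContinuousLinearMap.bilinearComp_apply]
  have hX := fun X => DFunLike.congr_fun h X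
  simp only [ContinuousLinearMap.comp_apply] at hX
  rw [hX, hX, h2]
  rfl

end Charts

/-! ### Smoothness of Riemannian metrics in charts. -/

section SmoothMetrics

variable {E H N : Type*} [NormedAddCommGroup E] [NormedSpace ℝ E] [FiniteDimensional ℝ E]
  [TopologicalSpace H]
  [TopologicalSpace N] [ChartedSpace H N] {I : ModelWithCorners ℝ E H} [I.Boundaryless]
  [IsManifold I ∞ N]

/-- A coordinate field with constant components is the image of a constant field under the tangent
map of the inverse chart. Pairing the metric with two such fields gives its components. -/
theorem contMDiffOn_differential_symm (p : N) (v : E) :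
    haveI : IsManifold I 1 N := isManifold_one (I := I)
    ContMDiffOn 𝓘(ℝ, E) I.tangent ∞
      (fun y => (⟨(extChartAt I p).symm y,
        differential 𝓘(ℝ, E) I (extChartAt I p).symm y v⟩ : TangentBundle I N))
      (extChartAt I p).target := by
  have : IsManifold I 1 N := isManifold_one (I := I)
  have h1 := (contMDiffOn_extChartAt_symm (I := I) (n := ∞) p).contMDiffOn_tangentMapWithin
    (m := ∞) (by simp) (isOpen_extChartAt_target (I := I) p).uniqueMDiffOn
  have h2 : ContMDiff 𝓘(ℝ, E) (𝓘(ℝ, E)).tangent ∞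
      (fun y : E => (⟨y, v⟩ : TangentBundle 𝓘(ℝ, E) E)) :=
    contMDiff_vectorSpace_iff_contDiff.2 contDiff_const
  have h3 := h1.comp (h2.contMDiffOn (s := (extChartAt I p).target)) (fun y hy => hy)
  refine h3.congr fun y hy => ?_
  have := mfderivWithin_of_isOpen (I := 𝓘(ℝ, E)) (I' := I) (f := (extChartAt I p).symm)
    (isOpen_extChartAt_target (I := I) p) hy
  simp only [Function.comp_apply, tangentMapWithin, this]
  rfl

theorem isLocalMetric_localMetric
    (g : Bundle.ContMDiffRiemannianMetric I ∞ E (fun x : N => TangentSpace I x)) (p : N) :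
    IsLocalMetric (localMetric I g.inner p) (extChartAt I p).target where
  isOpen := isOpen_extChartAt_target p
  smooth := by
    rw [contDiffOn_clm_apply]
    intro v
    rw [contDiffOn_clm_apply]
    intro w
    have : IsManifold I 1 N := isManifold_one (I := I)
    have h := ContMDiffOn.clm_bundle_apply₂ (F₁ := E) (F₂ := E) (F₃ := ℝ) (E₁ := TangentSpace I)
      (E₂ := TangentSpace I) (E₃ := Bundle.Trivial N ℝ)
      (b := (extChartAt I p).symm) (g.contMDiff.comp_contMDiffOn (contMDiffOn_extChartAt_symm p))
      (contMDiffOn_differential_symm p v) (contMDiffOn_differential_symm p w)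
    intro y hy
    have h1 := h y hy
    simp only [Bundle.contMDiffWithinAt_totalSpace] at h1
    exact h1.2.contDiffWithinAt
  inner y hy := by
    refine IsInner.bilinearComp (B := MetricField.form g.inner _) ⟨fun u v => ?_, fun v hv => ?_⟩
      (injective_differential_extChartAt_symm p hy)
    · exact g.symm _ _ _
    · exact g.pos _ _ hv

end SmoothMetrics


/-! ### Invariance of the second fundamental form -/

section Invariance

variable {E E' E'' : Type*} [NormedAddCommGroup E] [NormedSpace ℝ E]
  [NormedAddCommGroup E'] [NormedSpace ℝ E'] [NormedAddCommGroup E''] [NormedSpace ℝ E'']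

theorem IsLocalMetric.congr {G G' : E → E →L[ℝ] E →L[ℝ] ℝ} {U : Set E} (h : IsLocalMetric G U)
    (hG : EqOn G' G U) : IsLocalMetric G' U where
  isOpen := h.isOpen
  smooth := h.smooth.congr hG
  inner y hy := by
    rw [hG hy]
    exact h.inner y hy

theorem christoffelL_congr {G G' : E → E →L[ℝ] E →L[ℝ] ℝ} {x : E} (h : G =ᶠ[𝓝 x] G') :
    christoffelL G x = christoffelL G' x := by
  rw [christoffelL, christoffelL, h.fderiv_eq, h.eq_of_nhds]

theorem pullMetric_congr {u v : E → E'} {G G' : E' → E' →L[ℝ] E' →L[ℝ] ℝ} {q : E}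
    (h : u =ᶠ[𝓝 q] v) (hu : ContinuousAt u q) (hG : G =ᶠ[𝓝 (u q)] G') :
    pullMetric u G =ᶠ[𝓝 q] pullMetric v G' := by
  filter_upwards [h.eventuallyEq_nhds, hu.eventually hG] with y hy hy'
  rw [pullMetric, pullMetric, hy.fderiv_eq, hy', hy.eq_of_nhds]

theorem sff_congr {u v : E → E'} {G G' : E' → E' →L[ℝ] E' →L[ℝ] ℝ} {q : E}
    (h : u =ᶠ[𝓝 q] v) (hu : ContinuousAt u q) (hG : G =ᶠ[𝓝 (u q)] G') :
    sff u G q = sff v G' q := by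
  rw [sff, sff, covHess, covHess, christoffelL_congr hG, h.fderiv.fderiv_eq, h.fderiv_eq,
    christoffelL_congr (pullMetric_congr h hu hG), h.eq_of_nhds]

theorem pullMetric_comp {u : E → E'} {φ : E' → E''} {G : E'' → E'' →L[ℝ] E'' →L[ℝ] ℝ} {q : E}
    (hu : DifferentiableAt ℝ u q) (hφ : DifferentiableAt ℝ φ (u q)) :
    pullMetric (φ ∘ u) G q = pullMetric u (pullMetric φ G) q := by
  ext X Y
  simp only [pullMetric_apply, fderiv_comp q hφ hu, Function.comp_apply,
    ContinuousLinearMap.comp_apply]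

theorem fderiv₂_comp {u : E → E'} {φ : E' → E''} {q : E} (hu : ContDiffAt ℝ 2 u q)
    (hφ : ContDiffAt ℝ 2 φ (u q)) (X Y : E) :
    fderiv ℝ (fderiv ℝ (φ ∘ u)) q X Y =
      fderiv ℝ (fderiv ℝ φ) (u q) (fderiv ℝ u q X) (fderiv ℝ u q Y)
        + fderiv ℝ φ (u q) (fderiv ℝ (fderiv ℝ u) q X Y) := by
  have e : fderiv ℝ (φ ∘ u) =ᶠ[𝓝 q] fun y => (fderiv ℝ φ (u y)).comp (fderiv ℝ u y) := by
    filter_upwards [hu.eventually (by simp),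
      hu.continuousAt.eventually (hφ.eventually (by simp))] with y h1 h2
    exact fderiv_comp y (h2.differentiableAt (by simp)) (h1.differentiableAt (by simp))
  have d1 : DifferentiableAt ℝ (fderiv ℝ u) q :=
    (hu.fderiv_right (m := 1) (by norm_num)).differentiableAt (by simp)
  have d2 : DifferentiableAt ℝ (fderiv ℝ φ) (u q) :=
    (hφ.fderiv_right (m := 1) (by norm_num)).differentiableAt (by simp)
  have d3 := (d2.hasFDerivAt.comp q (hu.differentiableAt (by simp)).hasFDerivAt).clm_comp
    d1.hasFDerivAt
  rw [e.fderiv_eq]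
  erw [d3.fderiv]
  simp [add_comm]

variable [FiniteDimensional ℝ E] [FiniteDimensional ℝ E'] [FiniteDimensional ℝ E'']
  {u : E → E'} {φ : E' → E''} {O : Set E} {O' : Set E'} {U : Set E''}
  {G : E'' → E'' →L[ℝ] E'' →L[ℝ] ℝ} {q : E}

/-- The chain rule for second derivatives; the Christoffel terms of the intermediate metric
`pullMetric φ G` cancel between the two summands. -/
theorem sff_comp (h : IsLocalImmersion u O (pullMetric φ G) O') (hφ : IsLocalImmersion φ O' G U)
    (hq : q ∈ O) (X Y : E) :
    sff (φ ∘ u) G q X Y = fderiv ℝ φ (u q) (sff u (pullMetric φ G) q X Y)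
      + sff φ G (u q) (fderiv ℝ u q X) (fderiv ℝ u q Y) := by
  have e : pullMetric (φ ∘ u) G =ᶠ[𝓝 q] pullMetric u (pullMetric φ G) := by
    filter_upwards [h.isOpen.mem_nhds hq] with y hy
    exact pullMetric_comp (h.differentiableAt hy) (hφ.differentiableAt (h.mapsTo hy))
  simp only [sff_apply, covHess_apply]
  rw [christoffelL_congr e, fderiv₂_comp ((h.contDiffAt hq).of_le (by simpa using ENat.LEInfty.out))
    ((hφ.contDiffAt (h.mapsTo hq)).of_le (by simpa using ENat.LEInfty.out)),
    fderiv_comp q (hφ.differentiableAt (h.mapsTo hq)) (h.differentiableAt hq)]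
  simp only [ContinuousLinearMap.comp_apply, map_sub, map_add, Function.comp_apply]
  abel

/-- The second fundamental form is normal to the image of the differential, which here is
everything. Applied to coordinate changes, it makes them contribute nothing in `sff_comp`. -/
theorem IsLocalImmersion.sff_eq_zero (hφ : IsLocalImmersion φ O' G U) {x : E'} (hx : x ∈ O')
    (hs : Function.Surjective (fderiv ℝ φ x)) : sff φ G x = 0 := by
  ext X Y
  refine (hφ.metric.inner _ (hφ.mapsTo hx)).ext fun Z => ?_
  obtain ⟨W, rfl⟩ := hs Z
  rw [hφ.apply_sff hx]
  simp

end Invariance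


/-! ### Product metrics and second fundamental forms in charts -/

section ProductCharts

variable {E H N : Type*} [NormedAddCommGroup E] [NormedSpace ℝ E] [TopologicalSpace H]
  [TopologicalSpace N] [ChartedSpace H N] {I : ModelWithCorners ℝ E H} [I.Boundaryless]
  [IsManifold I ∞ N]
  {E' H' N' : Type*} [NormedAddCommGroup E'] [NormedSpace ℝ E'] [TopologicalSpace H']
  [TopologicalSpace N'] [ChartedSpace H' N'] {I' : ModelWithCorners ℝ E' H'} [I'.Boundaryless]
  [IsManifold I' ∞ N']

theorem productMetric_form (g : MetricField I N) (g' : MetricField I' N') (x : N × N') :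
    MetricField.form (productMetric g g') x =
      prodForm (MetricField.form g x.1) (MetricField.form g' x.2) := rfl

theorem target_extChartAt_prod (r : N × N') :
    (extChartAt (I.prod I') r).target =
      (extChartAt I r.1).target ×ˢ (extChartAt I' r.2).target := by
  rw [extChartAt_prod]
  rfl

theorem differential_fst {M : Type*} {D K : Type*} [NormedAddCommGroup D] [NormedSpace ℝ D]
    [TopologicalSpace K] [TopologicalSpace M] [ChartedSpace K M] {J : ModelWithCorners ℝ D K}
    {F : M → N × N'} {p : M} (hF : MDifferentiableAt J (I.prod I') F p) (X : D) :
    differential J I (fun q => (F q).1) p X = (differential J (I.prod I') F p X).1 := by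
  have h₁ : differential J I (fun q => (F q).1) p =
      (differential (I.prod I') I Prod.fst (F p)).comp (differential J (I.prod I') F p) :=
    mfderiv_comp p mdifferentiableAt_fst hF
  have h₂ : differential (I.prod I') I Prod.fst (F p) = ContinuousLinearMap.fst ℝ E E' := mfderiv_fst
  rw [h₁, h₂]
  rfl

theorem differential_snd {M : Type*} {D K : Type*} [NormedAddCommGroup D] [NormedSpace ℝ D]
    [TopologicalSpace K] [TopologicalSpace M] [ChartedSpace K M] {J : ModelWithCorners ℝ D K}
    {F : M → N × N'} {p : M} (hF : MDifferentiableAt J (I.prod I') F p) (X : D) :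
    differential J I' (fun q => (F q).2) p X = (differential J (I.prod I') F p X).2 := by
  have h₁ : differential J I' (fun q => (F q).2) p =
      (differential (I.prod I') I' Prod.snd (F p)).comp (differential J (I.prod I') F p) :=
    mfderiv_comp p mdifferentiableAt_snd hF
  have h₂ : differential (I.prod I') I' Prod.snd (F p) = ContinuousLinearMap.snd ℝ E E' := mfderiv_snd
  rw [h₁, h₂]
  rfl

theorem extChartAt_prod_symm_apply (r : N × N') (z : E × E') :
    (extChartAt (I.prod I') r).symm z =
      ((extChartAt I r.1).symm z.1, (extChartAt I' r.2).symm z.2) := by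
  rw [extChartAt_prod]
  rfl

theorem differential_extChartAt_prod_symm (r : N × N') {y : E × E'}
    (hy : y ∈ (extChartAt (I.prod I') r).target) (X : E × E') :
    differential 𝓘(ℝ, E × E') (I.prod I') (extChartAt (I.prod I') r).symm y X =
      (differential 𝓘(ℝ, E) I (extChartAt I r.1).symm y.1 X.1,
        differential 𝓘(ℝ, E') I' (extChartAt I' r.2).symm y.2 X.2) := by
  have hd := mdifferentiableAt_extChartAt_symm (I := I.prod I') r hy
  rw [target_extChartAt_prod] at hy
  refine Prod.ext ?_ ?_
  · rw [← differential_fst hd]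
    simp only [extChartAt_prod_symm_apply]
    have h : differential 𝓘(ℝ, E × E') I (fun z : E × E' => (extChartAt I r.1).symm z.1) y =
        (differential 𝓘(ℝ, E) I (extChartAt I r.1).symm y.1).comp
          (differential 𝓘(ℝ, E × E') 𝓘(ℝ, E) Prod.fst y) :=
      mfderiv_comp y (mdifferentiableAt_extChartAt_symm r.1 hy.1)
        differentiableAt_fst.mdifferentiableAt
    rw [h, differential_eq_fderiv, fderiv_fst]
    rfl
  · rw [← differential_snd hd]
    simp only [extChartAt_prod_symm_apply]
    have h : differential 𝓘(ℝ, E × E') I' (fun z : E × E' => (extChartAt I' r.2).symm z.2) y =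
        (differential 𝓘(ℝ, E') I' (extChartAt I' r.2).symm y.2).comp
          (differential 𝓘(ℝ, E × E') 𝓘(ℝ, E') Prod.snd y) :=
      mfderiv_comp y (mdifferentiableAt_extChartAt_symm r.2 hy.2)
        differentiableAt_snd.mdifferentiableAt
    rw [h, differential_eq_fderiv, fderiv_snd]
    rfl

theorem localMetric_productMetric (g : MetricField I N) (g' : MetricField I' N') (r : N × N')
    {y : E × E'} (hy : y ∈ (extChartAt (I.prod I') r).target) :
    localMetric (I.prod I') (productMetric g g') r y =
      prodMetric (localMetric I g r.1) (localMetric I' g' r.2) y := by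
  refine ContinuousLinearMap.ext fun X => ContinuousLinearMap.ext fun Y => ?_
  rw [localMetric_eq, ContinuousLinearMap.bilinearComp_apply, productMetric_form, prodForm_apply,
    differential_extChartAt_prod_symm r hy, differential_extChartAt_prod_symm r hy,
    extChartAt_prod_symm_apply, prodMetric, prodForm_apply]
  rfl

end ProductCharts

/-! ### The second fundamental form in charts. -/

section SecondFundamentalForm

variable {E H N : Type*} [NormedAddCommGroup E] [NormedSpace ℝ E] [FiniteDimensional ℝ E]
  [TopologicalSpace H]
  [TopologicalSpace N] [ChartedSpace H N] {I : ModelWithCorners ℝ E H} [I.Boundaryless]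
  [IsManifold I ∞ N]
  {E' H' N' : Type*} [NormedAddCommGroup E'] [NormedSpace ℝ E'] [FiniteDimensional ℝ E']
  [TopologicalSpace H']
  [TopologicalSpace N'] [ChartedSpace H' N'] {I' : ModelWithCorners ℝ E' H'} [I'.Boundaryless]
  [IsManifold I' ∞ N']

theorem contMDiffOn_extChartAt_of_mem (r : N') :
    ContMDiffOn I' 𝓘(ℝ, E') ∞ (extChartAt I' r) (extChartAt I' r).source := by
  rw [extChartAt_source]
  exact contMDiffOn_extChartAt

/-- The points of the chart at `p` that `F` maps to the chart at `r`. -/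
def chartDomain (I : ModelWithCorners ℝ E H) (I' : ModelWithCorners ℝ E' H') (F : N → N') (p : N)
    (r : N') : Set E :=
  (extChartAt I p).target ∩ (extChartAt I p).symm ⁻¹' (F ⁻¹' (extChartAt I' r).source)

theorem isOpen_chartDomain {F : N → N'} (hF : Continuous F) (p : N) (r : N') :
    IsOpen (chartDomain I I' F p r) :=
  (continuousOn_extChartAt_symm p).isOpen_inter_preimage (isOpen_extChartAt_target p)
    ((isOpen_extChartAt_source r).preimage hF)

theorem extChartAt_mem_chartDomain {F : N → N'} {p p' : N} {r : N'}
    (hp : p' ∈ (extChartAt I p).source) (hr : F p' ∈ (extChartAt I' r).source) :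
    extChartAt I p p' ∈ chartDomain I I' F p r :=
  ⟨(extChartAt I p).map_source hp, by
    rwa [mem_preimage, mem_preimage, (extChartAt I p).left_inv hp]⟩

theorem contDiffOn_chartRep {F : N → N'} (hF : ContMDiff I I' ∞ F) (p : N) (r : N') :
    ContDiffOn ℝ ∞ (chartRep I I' F p r) (chartDomain I I' F p r) := by
  rw [← contMDiffOn_iff_contDiffOn]
  exact (contMDiffOn_extChartAt_of_mem r).comp (hF.comp_contMDiffOn
    ((contMDiffOn_extChartAt_symm p).mono inter_subset_left)) fun y hy => hy.2

theorem isLocalImmersion_chartRep {g : MetricField I' N'}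
    (hg : ∀ r, IsLocalMetric (localMetric I' g r) (extChartAt I' r).target)
    {F : N → N'} (hF : ContMDiff I I' ∞ F)
    (hF' : ∀ q, Function.Injective (differential I I' F q)) (p : N) (r : N') :
    IsLocalImmersion (chartRep I I' F p r) (chartDomain I I' F p r) (localMetric I' g r)
      (extChartAt I' r).target where
  metric := hg r
  isOpen := isOpen_chartDomain hF.continuous p r
  smooth := contDiffOn_chartRep hF p r
  mapsTo y hy := (extChartAt I' r).map_source hy.2
  injective y hy := by
    have h := differential_chartRep hy.1 hy.2 (hF.mdifferentiable (by simp) _)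
    have h2 : Function.Injective ((differential I I' F ((extChartAt I p).symm y)).comp
        (differential 𝓘(ℝ, E) I (extChartAt I p).symm y)) :=
      (hF' _).comp (injective_differential_extChartAt_symm p hy.1)
    rw [← h] at h2
    exact Function.Injective.of_comp h2

/-- The definition projects to the normal space by solving for a tangent vector; by `apply_covHess`
the solution is the Christoffel symbol of the induced metric, which is what `sff` subtracts. -/
theorem secondFundamentalForm_eq_sff {g : MetricField I' N'}
    (hg : ∀ r, IsLocalMetric (localMetric I' g r) (extChartAt I' r).target)
    {F : N → N'} (hF : ContMDiff I I' ∞ F)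
    (hF' : ∀ q, Function.Injective (differential I I' F q)) (p : N) (X Y : E) :
    secondFundamentalForm I g F p X Y =
      sff (chartRep I I' F p (F p)) (localMetric I' g (F p)) (extChartAt I p p) X Y := by
  have h := isLocalImmersion_chartRep hg hF hF' p (F p)
  have hq := extChartAt_mem_chartDomain (I := I) (I' := I') (F := F) (mem_extChartAt_source p)
    (mem_extChartAt_source (I := I') (F p))
  have e1 := differential_eq_fderiv_chart (hF.mdifferentiable (by simp) p)
  have e2 : chartRep I I' F p (F p) (extChartAt I p p) = extChartAt I' (F p) (F p) := by
    simp [chartRep]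
  have e3 : covariantHessian I g F p X Y =
      covHess (chartRep I I' F p (F p)) (localMetric I' g (F p)) (extChartAt I p p) X Y := by
    rw [covariantHessian, covHess_apply, e1, e2]
    rfl
  have e4 : MetricField.form (inducedMetric I g F) p =
      pullMetric (chartRep I I' F p (F p)) (localMetric I' g (F p)) (extChartAt I p p) := by
    rw [← localMetric_inducedMetric g hq.1 hq.2 (hF.mdifferentiable (by simp) _),
      localMetric_self]
  rw [secondFundamentalForm, normalPart, e3, sff_apply, e4, e1]
  congr 2
  refine (h.isLocalMetric.inner _ hq).inverse_eq fun Z => ?_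
  rw [← h.apply_covHess hq, e2, localMetric_self]
  rfl

end SecondFundamentalForm


/-! ### The mean curvature vector in arbitrary charts -/

section Laplacian

variable {n : ℕ} {S : Type*} [TopologicalSpace S] [ChartedSpace (EuclideanSpace ℝ (Fin n)) S]

theorem laplacian_eq {g : MetricField (𝓡 n) S} {w : S → ℝ} {p : S} {f : Euc n → ℝ}
    {G : Euc n → Euc n →L[ℝ] Euc n →L[ℝ] ℝ} [IsManifold (𝓡 n) ∞ S]
    (hw : w ∘ (extChartAt (𝓡 n) p).symm =ᶠ[𝓝 (extChartAt (𝓡 n) p p)] f)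
    (hG : localMetric (𝓡 n) g p =ᶠ[𝓝 (extChartAt (𝓡 n) p p)] G) {τ : Fin n → Euc n}
    (hτ : IsOrthonormal (G (extChartAt (𝓡 n) p p)) τ) :
    laplacian g w p = ∑ i, (fderiv ℝ (fderiv ℝ f) (extChartAt (𝓡 n) p p) (τ i) (τ i)
      - fderiv ℝ f (extChartAt (𝓡 n) p p)
          (christoffelL G (extChartAt (𝓡 n) p p) (τ i) (τ i))) := by
  rw [← hG.eq_of_nhds, localMetric_self] at hτ
  rw [laplacian]
  simp only [← christoffelL_apply]
  rw [hw.fderiv.fderiv_eq, hw.fderiv_eq, christoffelL_congr hG]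
  exact hτ.metricTrace_eq (fderiv ℝ (fderiv ℝ f) (extChartAt (𝓡 n) p p) -
    (ContinuousLinearMap.compL ℝ (Euc n) (Euc n) ℝ (fderiv ℝ f (extChartAt (𝓡 n) p p))).comp
      (christoffelL G (extChartAt (𝓡 n) p p)))

end Laplacian

/-! ### Coordinate changes as immersions. -/

section ChartImmersions

variable {E H N : Type*} [NormedAddCommGroup E] [NormedSpace ℝ E] [FiniteDimensional ℝ E]
  [TopologicalSpace H]
  [TopologicalSpace N] [ChartedSpace H N] {I : ModelWithCorners ℝ E H} [I.Boundaryless]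
  [IsManifold I ∞ N]
  {E' H' N' : Type*} [NormedAddCommGroup E'] [NormedSpace ℝ E'] [FiniteDimensional ℝ E']
  [TopologicalSpace H']
  [TopologicalSpace N'] [ChartedSpace H' N'] {I' : ModelWithCorners ℝ E' H'} [I'.Boundaryless]
  [IsManifold I' ∞ N']

/-- Coordinate changes are measured with pulled-back metrics, which are known to be metrics only on
part of a chart. The target is therefore an arbitrary local metric, and the domain shrinks
accordingly. -/
theorem isLocalImmersion_chartRep_of_metric {F : N → N'} (hF : ContMDiff I I' ∞ F)
    (hF' : ∀ q, Function.Injective (differential I I' F q)) (p : N) (r : N')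
    {G : E' → E' →L[ℝ] E' →L[ℝ] ℝ} {U : Set E'} (hG : IsLocalMetric G U) :
    IsLocalImmersion (chartRep I I' F p r)
      (chartDomain I I' F p r ∩ chartRep I I' F p r ⁻¹' U) G U where
  metric := hG
  isOpen := (contDiffOn_chartRep hF p r).continuousOn.isOpen_inter_preimage
    (isOpen_chartDomain hF.continuous p r) hG.isOpen
  smooth := (contDiffOn_chartRep hF p r).mono inter_subset_left
  mapsTo _ hy := hy.2
  injective y hy := by
    have h := differential_chartRep hy.1.1 hy.1.2 (hF.mdifferentiable (by simp) _)
    have h2 : Function.Injective ((differential I I' F ((extChartAt I p).symm y)).comp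
        (differential 𝓘(ℝ, E) I (extChartAt I p).symm y)) :=
      (hF' _).comp (injective_differential_extChartAt_symm p hy.1.1)
    rw [← h] at h2
    exact Function.Injective.of_comp h2

theorem differential_id (p : N) : differential I I (id : N → N) p = ContinuousLinearMap.id ℝ E :=
  mfderiv_id

theorem injective_differential_id (p : N) :
    Function.Injective (differential I I (id : N → N) p) := by
  rw [differential_id]
  exact Function.injective_id

theorem inducedMetric_id (g : MetricField I N) : inducedMetric I g (id : N → N) = g := by
  funext p
  refine ContinuousLinearMap.ext fun X => ContinuousLinearMap.ext fun Y => ?_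
  change MetricField.form g p (differential I I id p X) (differential I I id p Y) = _
  rw [differential_id]
  rfl

theorem pullMetric_chartRep_id (g : MetricField I N) {p r : N} {y : E}
    (hy : y ∈ chartDomain I I id p r) :
    pullMetric (chartRep I I id p r) (localMetric I g r) y = localMetric I g p y := by
  rw [← localMetric_inducedMetric g hy.1 hy.2 mdifferentiableAt_id, inducedMetric_id]

theorem surjective_fderiv_chartRep_id {p r : N} {y : E} (hy : y ∈ chartDomain I I id p r) :
    Function.Injective (fderiv ℝ (chartRep I I id p r) y) ∧
      Function.Surjective (fderiv ℝ (chartRep I I id p r) y) := by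
  have h := differential_chartRep (I' := I) (F := id) hy.1 hy.2 mdifferentiableAt_id
  have h2 : Function.Injective ((differential I I id ((extChartAt I p).symm y)).comp
      (differential 𝓘(ℝ, E) I (extChartAt I p).symm y)) :=
    (injective_differential_id _).comp (injective_differential_extChartAt_symm p hy.1)
  rw [← h] at h2
  have h3 : Function.Injective (fderiv ℝ (chartRep I I id p r) y) := Function.Injective.of_comp h2
  exact ⟨h3, (LinearMap.injective_iff_surjective
    (f := (fderiv ℝ (chartRep I I id p r) y : E →ₗ[ℝ] E))).1 h3⟩

theorem chartRep_id_comp_chartRep {F : N → N'} {p : N} {r r' : N'} {y : E}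
    (hy : y ∈ chartDomain I I' F p r) :
    chartRep I' I' id r r' (chartRep I I' F p r y) = chartRep I I' F p r' y := by
  simp only [chartRep, Function.comp_apply, id]
  rw [(extChartAt I' r).left_inv hy.2]

theorem chartRep_comp_chartRep_id {F : N → N'} {p p' : N} {r : N'} {y : E}
    (hy : y ∈ chartDomain I I id p p') :
    chartRep I I' F p' r (chartRep I I id p p' y) = chartRep I I' F p r y := by
  simp only [chartRep, Function.comp_apply, id]
  rw [(extChartAt I p').left_inv hy.2]

end ChartImmersions

/-! ### The mean curvature vector under coordinate changes. -/

section MeanCurvature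

variable {n : ℕ} {S : Type*} [TopologicalSpace S] [ChartedSpace (EuclideanSpace ℝ (Fin n)) S]
  [IsManifold (𝓡 n) ∞ S]
  {E' H' N' : Type*} [NormedAddCommGroup E'] [NormedSpace ℝ E'] [FiniteDimensional ℝ E']
  [TopologicalSpace H']
  [TopologicalSpace N'] [ChartedSpace H' N'] {I' : ModelWithCorners ℝ E' H'} [I'.Boundaryless]
  [IsManifold I' ∞ N']

/-- The representation `w` of `F` with source chart at `p` and target chart at `F p'` factors both
as `u' ∘ ψ` and as `φ ∘ u`, with coordinate changes `ψ` and `φ`. The definition at `p'` uses `u'`,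
the fixed charts use `u`, and comparison through `w` leaves only the factor `dφ`. -/
theorem meanCurvatureVector_eq {g : MetricField I' N'}
    (hg : ∀ r, IsLocalMetric (localMetric I' g r) (extChartAt I' r).target)
    {F : S → N'} (hF : ContMDiff (𝓡 n) I' ∞ F)
    (hF' : ∀ q, Function.Injective (differential (𝓡 n) I' F q)) {p p' : S} {r : N'} {y : Euc n}
    (hy : y ∈ chartDomain (𝓡 n) I' F p r) (hp' : (extChartAt (𝓡 n) p).symm y = p') :
    meanCurvatureVector n g F p' =
      fderiv ℝ (chartRep I' I' id r (F p')) (chartRep (𝓡 n) I' F p r y)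
        (metricTrace (pullMetric (chartRep (𝓡 n) I' F p r) (localMetric I' g r) y)
          fun X Y => sff (chartRep (𝓡 n) I' F p r) (localMetric I' g r) y X Y) := by
  set u := chartRep (𝓡 n) I' F p r with hu
  set u' := chartRep (𝓡 n) I' F p' (F p') with hu'
  set w := chartRep (𝓡 n) I' F p (F p') with hw
  set ψ := chartRep (𝓡 n) (𝓡 n) (id : S → S) p p' with hψ
  set φ := chartRep I' I' (id : N' → N') r (F p') with hφ
  set G := localMetric I' g r
  set G' := localMetric I' g (F p')
  have iφ : IsLocalImmersion φ (chartDomain I' I' id r (F p')) G' (extChartAt I' (F p')).target :=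
    isLocalImmersion_chartRep hg contMDiff_id injective_differential_id r (F p')
  have iu' : IsLocalImmersion u' (chartDomain (𝓡 n) I' F p' (F p')) G'
    (extChartAt I' (F p')).target := isLocalImmersion_chartRep hg hF hF' p' (F p')
  have iψ := isLocalImmersion_chartRep_of_metric (I' := 𝓡 n) (F := (id : S → S)) contMDiff_id
    injective_differential_id p p' iu'.isLocalMetric
  have iu := isLocalImmersion_chartRep_of_metric hF hF' p r iφ.isLocalMetric
  have hyψ' : y ∈ chartDomain (𝓡 n) (𝓡 n) (id : S → S) p p' :=
    ⟨hy.1, by rw [mem_preimage, hp']; exact mem_extChartAt_source p'⟩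
  have hψy : ψ y = extChartAt (𝓡 n) p' p' := by
    rw [hψ, chartRep, Function.comp_apply, Function.comp_apply, hp', id]
  have hyψ : y ∈ chartDomain (𝓡 n) (𝓡 n) (id : S → S) p p' ∩
      ψ ⁻¹' chartDomain (𝓡 n) I' F p' (F p') := by
    refine ⟨hyψ', ?_⟩
    rw [mem_preimage, hψy]
    exact extChartAt_mem_chartDomain (mem_extChartAt_source p') (mem_extChartAt_source (F p'))
  have huy : u y ∈ chartDomain I' I' id r (F p') := by
    refine ⟨(extChartAt I' r).map_source hy.2, ?_⟩
    have : (extChartAt I' r).symm (u y) = F p' := by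
      rw [hu, chartRep, Function.comp_apply, Function.comp_apply, (extChartAt I' r).left_inv hy.2,
        hp']
    rw [mem_preimage, this]
    exact mem_extChartAt_source (F p')
  have hyu : y ∈ chartDomain (𝓡 n) I' F p r ∩ u ⁻¹' chartDomain I' I' id r (F p') := ⟨hy, huy⟩
  have eψ : u' ∘ ψ =ᶠ[𝓝 y] w := by
    filter_upwards [iψ.isOpen.mem_nhds hyψ] with z hz
    exact chartRep_comp_chartRep_id hz.1
  have eφ : φ ∘ u =ᶠ[𝓝 y] w := by
    filter_upwards [iu.isOpen.mem_nhds hyu] with z hz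
    exact chartRep_id_comp_chartRep hz.1
  have eG : pullMetric φ G' =ᶠ[𝓝 (u y)] G := by
    filter_upwards [iφ.isOpen.mem_nhds huy] with z hz
    exact pullMetric_chartRep_id g hz
  have cψ : ContinuousAt (u' ∘ ψ) y :=
    ((iu'.differentiableAt hyψ.2).comp y (iψ.differentiableAt hyψ)).continuousAt
  have cφ : ContinuousAt (φ ∘ u) y :=
    ((iφ.differentiableAt huy).comp y (iu.differentiableAt hyu)).continuousAt
  have cu := (iu.differentiableAt hyu).continuousAt
  obtain ⟨injψ, surjψ⟩ := surjective_fderiv_chartRep_id hyψ'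
  obtain ⟨injφ, surjφ⟩ := surjective_fderiv_chartRep_id huy
  -- Changing the source chart only substitutes `dψ` in the arguments, as `ψ` has no second
  -- fundamental form for the pulled-back metric.
  have s₁ : ∀ X Y, sff w G' y X Y = sff u' G' (ψ y) (fderiv ℝ ψ y X) (fderiv ℝ ψ y Y) := by
    intro X Y
    rw [← sff_congr eψ cψ Filter.EventuallyEq.rfl, sff_comp iψ iu' hyψ, iψ.sff_eq_zero hyψ surjψ]
    simp only [zero_apply, map_zero, zero_add]
    rfl
  -- Changing the target chart applies `dφ` to the value.
  have s₂ : ∀ X Y, sff w G' y X Y = fderiv ℝ φ (u y) (sff u G y X Y) := by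
    intro X Y
    rw [← sff_congr eφ cφ Filter.EventuallyEq.rfl, sff_comp iu iφ hyu, iφ.sff_eq_zero huy surjφ,
      sff_congr Filter.EventuallyEq.rfl cu eG]
    simp only [zero_apply, add_zero]
    rfl
  have p₁ : pullMetric w G' y =
      (pullMetric u' G' (ψ y)).bilinearComp (fderiv ℝ ψ y) (fderiv ℝ ψ y) := by
    rw [← (pullMetric_congr eψ cψ Filter.EventuallyEq.rfl).eq_of_nhds,
      pullMetric_comp (iψ.differentiableAt hyψ) (iu'.differentiableAt hyψ.2)]
    rfl
  have p₂ : pullMetric w G' y = pullMetric u G y := by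
    rw [← (pullMetric_congr eφ cφ Filter.EventuallyEq.rfl).eq_of_nhds,
      pullMetric_comp (iu.differentiableAt hyu) (iφ.differentiableAt huy),
      (pullMetric_congr Filter.EventuallyEq.rfl cu eG).eq_of_nhds]
  have e4 : MetricField.form (inducedMetric (𝓡 n) g F) p' = pullMetric u' G' (ψ y) := by
    rw [hψy, ← localMetric_inducedMetric g (hψy ▸ hyψ.2.1) (hψy ▸ hyψ.2.2)
      (hF.mdifferentiable (by simp) _), localMetric_self]
  have e5 : secondFundamentalForm (𝓡 n) g F p' = fun X Y => sff u' G' (ψ y) X Y := by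
    funext X Y
    rw [secondFundamentalForm_eq_sff hg hF hF', hψy]
  rw [meanCurvatureVector, e4, e5, ← (iu'.isLocalMetric.inner _ hyψ.2).metricTrace_bilinearComp
    injψ, ← p₁, p₂]
  refine (congrArg (metricTrace _) (funext fun X => funext fun Y => (s₁ X Y).symm)).trans ?_
  simp only [s₂, metricTrace, map_sum, map_smul]

end MeanCurvature


/-! ### Local graphs in a Riemannian product -/

section Graphs

variable {n m : ℕ} {S S₁ S₂ : Type*} [TopologicalSpace S] [TopologicalSpace S₁]
  [TopologicalSpace S₂] [ChartedSpace (EuclideanSpace ℝ (Fin n)) S]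
  [ChartedSpace (EuclideanSpace ℝ (Fin n)) S₁] [ChartedSpace (EuclideanSpace ℝ (Fin m)) S₂]
  [IsManifold (𝓡 n) ∞ S] [IsManifold (𝓡 n) ∞ S₁] [IsManifold (𝓡 m) ∞ S₂]

theorem IsGraphNear.snd_eq {F : S → S₁ × S₂} {p : S} {U : Set S} {V : Set S₁} {f : S₁ → S₂}
    (h : IsGraphNear n m F p U V f) {q : S} (hq : q ∈ U) :
    (F q).1 ∈ V ∧ (F q).2 = f (F q).1 := by
  have : F q ∈ (fun x => (x, f x)) '' V := h.image_eq ▸ mem_image_of_mem F hq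
  obtain ⟨x, hx, hxq⟩ := this
  rw [← hxq]
  exact ⟨hx, rfl⟩

theorem IsGraphNear.differential_snd {F : S → S₁ × S₂} {p : S} {U : Set S} {V : Set S₁}
    {f : S₁ → S₂} (h : IsGraphNear n m F p U V f)
    (hF : MDifferentiableAt (𝓡 n) ((𝓡 n).prod (𝓡 m)) F p) (X : Euc n) :
    (differential (𝓡 n) ((𝓡 n).prod (𝓡 m)) F p X).2 =
      differential (𝓡 n) (𝓡 m) f (F p).1 (differential (𝓡 n) ((𝓡 n).prod (𝓡 m)) F p X).1 := by
  have hf : MDifferentiableAt (𝓡 n) (𝓡 m) f (F p).1 :=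
    (h.smooth.contMDiffAt (h.isOpen_V.mem_nhds (h.snd_eq h.mem_U).1)).mdifferentiableAt (by simp)
  rw [← GraphFlow.differential_snd hF, ← differential_fst hF]
  have e : (fun q => (F q).2) =ᶠ[𝓝 p] f ∘ fun q => (F q).1 := by
    filter_upwards [h.isOpen_U.mem_nhds h.mem_U] with q hq
    exact (h.snd_eq hq).2
  rw [differential_congr e, differential_comp (f := fun q => (F q).1) p hf
    (mdifferentiableAt_fst.comp p hF)]
  rfl

/-- On a graph the second component of `dF X` is `df` of the first, so a tangent vector is
determined by its projection. This is what makes `jac` invertible. -/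
theorem IsLocallyGraph.injective_fst {F : S → S₁ × S₂} (h : IsLocallyGraph n m F)
    (hF : MDifferentiable (𝓡 n) ((𝓡 n).prod (𝓡 m)) F)
    (hF' : ∀ q, Function.Injective (differential (𝓡 n) ((𝓡 n).prod (𝓡 m)) F q)) (q : S) :
    Function.Injective ((ContinuousLinearMap.fst ℝ (Euc n) (Euc m)).comp
      (differential (𝓡 n) ((𝓡 n).prod (𝓡 m)) F q)) := by
  obtain ⟨U, V, f, hU⟩ := h q
  intro X Y hXY
  apply hF' q
  refine Prod.ext hXY ?_
  rw [hU.differential_snd (hF q), hU.differential_snd (hF q)]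
  exact congrArg _ hXY

variable {g₁ : MetricField (𝓡 n) S₁} {g₂ : MetricField (𝓡 m) S₂}

theorem isLocalMetric_productMetric
    (h₁ : ∀ r, IsLocalMetric (localMetric (𝓡 n) g₁ r) (extChartAt (𝓡 n) r).target)
    (h₂ : ∀ r, IsLocalMetric (localMetric (𝓡 m) g₂ r) (extChartAt (𝓡 m) r).target)
    (r : S₁ × S₂) :
    IsLocalMetric (localMetric ((𝓡 n).prod (𝓡 m)) (productMetric g₁ g₂) r)
      (extChartAt ((𝓡 n).prod (𝓡 m)) r).target := by
  have h := (h₁ r.1).prodMetric (h₂ r.2)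
  rw [← target_extChartAt_prod] at h
  exact h.congr fun y hy => localMetric_productMetric g₁ g₂ r hy

theorem isLocalGraphImmersion_chartRep
    (h₁ : ∀ r, IsLocalMetric (localMetric (𝓡 n) g₁ r) (extChartAt (𝓡 n) r).target)
    (h₂ : ∀ r, IsLocalMetric (localMetric (𝓡 m) g₂ r) (extChartAt (𝓡 m) r).target)
    {F : S → S₁ × S₂} (hF : ContMDiff (𝓡 n) ((𝓡 n).prod (𝓡 m)) ∞ F)
    (hF' : ∀ q, Function.Injective ((ContinuousLinearMap.fst ℝ (Euc n) (Euc m)).comp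
      (differential (𝓡 n) ((𝓡 n).prod (𝓡 m)) F q))) (p : S) (r : S₁ × S₂) :
    IsLocalGraphImmersion (chartRep (𝓡 n) ((𝓡 n).prod (𝓡 m)) F p r)
      (chartDomain (𝓡 n) ((𝓡 n).prod (𝓡 m)) F p r) (localMetric (𝓡 n) g₁ r.1)
      (localMetric (𝓡 m) g₂ r.2) (extChartAt (𝓡 n) r.1).target
      (extChartAt (𝓡 m) r.2).target where
  metric₁ := h₁ r.1
  metric₂ := h₂ r.2
  isOpen := isOpen_chartDomain hF.continuous p r
  smooth := contDiffOn_chartRep hF p r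
  mapsTo y hy := by
    rw [← target_extChartAt_prod]
    exact (extChartAt _ r).map_source hy.2
  injective_jac y hy := by
    have hy' : chartRep (𝓡 n) ((𝓡 n).prod (𝓡 m)) F p r y ∈
        (extChartAt ((𝓡 n).prod (𝓡 m)) r).target :=
      (extChartAt ((𝓡 n).prod (𝓡 m)) r).map_source hy.2
    have h := differential_chartRep hy.1 hy.2 (hF.mdifferentiable (by simp) _)
    intro X Y hXY
    apply injective_differential_extChartAt_symm p hy.1
    apply hF' ((extChartAt (𝓡 n) p).symm y)
    change ((differential (𝓡 n) ((𝓡 n).prod (𝓡 m)) F ((extChartAt (𝓡 n) p).symm y)).comp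
      (differential 𝓘(ℝ, Euc n) (𝓡 n) (extChartAt (𝓡 n) p).symm y) X).1 =
      ((differential (𝓡 n) ((𝓡 n).prod (𝓡 m)) F ((extChartAt (𝓡 n) p).symm y)).comp
      (differential 𝓘(ℝ, Euc n) (𝓡 n) (extChartAt (𝓡 n) p).symm y) Y).1
    rw [← h, ContinuousLinearMap.comp_apply, ContinuousLinearMap.comp_apply,
      differential_extChartAt_prod_symm r hy', differential_extChartAt_prod_symm r hy']
    exact congrArg (differential 𝓘(ℝ, Euc n) (𝓡 n) (extChartAt (𝓡 n) r.1).symm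
      (chartRep (𝓡 n) ((𝓡 n).prod (𝓡 m)) F p r y).1) hXY

/-- The volume form evaluates to `√(det g) · det K`, and the Gram determinant of the pull-back is
`(det K)² det g`; the absolute value removes the orientation. -/
theorem abs_volumeForm_map (B : Euc n →L[ℝ] Euc n →L[ℝ] ℝ) (K : Euc n →L[ℝ] Euc n) :
    |volumeForm B fun i => K (EuclideanSpace.basisFun (Fin n) ℝ i)| =
      √(gram (B.bilinearComp K K)).det := by
  have h : ((EuclideanSpace.basisFun (Fin n) ℝ).toBasis.det
      fun i => K (EuclideanSpace.basisFun (Fin n) ℝ i)) = LinearMap.det (K : Euc n →ₗ[ℝ] Euc n) := by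
    have := (EuclideanSpace.basisFun (Fin n) ℝ).toBasis.det_comp (K : Euc n →ₗ[ℝ] Euc n)
      (EuclideanSpace.basisFun (Fin n) ℝ).toBasis
    rw [Module.Basis.det_self, mul_one] at this
    rw [← this]
    congr 1
  rw [volumeForm, AlternatingMap.smul_apply, h, gram_bilinearComp_det, Real.sqrt_mul (sq_nonneg _),
    Real.sqrt_sq_eq_abs, smul_eq_mul, abs_mul, abs_of_nonneg (Real.sqrt_nonneg _), mul_comm]

theorem det_ne_zero_of_injective {K : Euc n →L[ℝ] Euc n} (hK : Function.Injective K) :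
    LinearMap.det (K : Euc n →ₗ[ℝ] Euc n) ≠ 0 :=
  (LinearEquiv.ofInjectiveEndo (K : Euc n →ₗ[ℝ] Euc n) hK).isUnit_det'.ne_zero

/-- Away from the chart's centre, passing to coordinates multiplies both Gram determinants by the
square of the same nonzero Jacobian, which cancels in the quotient. -/
theorem starOmega_eq (g₁ : MetricField (𝓡 n) S₁) (g₂ : MetricField (𝓡 m) S₂) {F : S → S₁ × S₂}
    {p : S} {r : S₁ × S₂} {y : Euc n} (hy : y ∈ chartDomain (𝓡 n) ((𝓡 n).prod (𝓡 m)) F p r)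
    (hF : MDifferentiableAt (𝓡 n) ((𝓡 n).prod (𝓡 m)) F ((extChartAt (𝓡 n) p).symm y))
    (hB : 0 ≤ (gram (MetricField.form (inducedMetric (𝓡 n) (productMetric g₁ g₂) F)
      ((extChartAt (𝓡 n) p).symm y))).det) :
    starOmega g₁ g₂ F ((extChartAt (𝓡 n) p).symm y) =
      projJacobian (chartRep (𝓡 n) ((𝓡 n).prod (𝓡 m)) F p r) (localMetric (𝓡 n) g₁ r.1)
        (localMetric (𝓡 m) g₂ r.2) y := by
  have hy' : chartRep (𝓡 n) ((𝓡 n).prod (𝓡 m)) F p r y ∈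
      (extChartAt ((𝓡 n).prod (𝓡 m)) r).target :=
    (extChartAt ((𝓡 n).prod (𝓡 m)) r).map_source hy.2
  have hr : F ((extChartAt (𝓡 n) p).symm y) ∈
      (extChartAt (𝓡 n) r.1).source ×ˢ (extChartAt (𝓡 m) r.2).source := by
    have := hy.2
    rw [extChartAt_prod] at this
    exact this
  have e₁ : pullMetric (fun z => (chartRep (𝓡 n) ((𝓡 n).prod (𝓡 m)) F p r z).1)
      (localMetric (𝓡 n) g₁ r.1) y =
      localMetric (𝓡 n) (inducedMetric (𝓡 n) g₁ fun q => (F q).1) p y := by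
    rw [localMetric_inducedMetric (F := fun q => (F q).1) (r := r.1) g₁ hy.1 hr.1
      (mdifferentiableAt_fst.comp _ hF)]
    rfl
  have e₂ : pullMetric (chartRep (𝓡 n) ((𝓡 n).prod (𝓡 m)) F p r)
      (prodMetric (localMetric (𝓡 n) g₁ r.1) (localMetric (𝓡 m) g₂ r.2)) y =
      localMetric (𝓡 n) (inducedMetric (𝓡 n) (productMetric g₁ g₂) F) p y := by
    rw [localMetric_inducedMetric (r := r) _ hy.1 hy.2 hF, pullMetric, pullMetric,
      localMetric_productMetric g₁ g₂ r hy']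
  have e₃ : MetricField.form (inducedMetric (𝓡 n) g₁ fun q => (F q).1)
      ((extChartAt (𝓡 n) p).symm y) =
      (MetricField.form g₁ (F ((extChartAt (𝓡 n) p).symm y)).1).bilinearComp
        ((ContinuousLinearMap.fst ℝ (Euc n) (Euc m)).comp
          (differential (𝓡 n) ((𝓡 n).prod (𝓡 m)) F ((extChartAt (𝓡 n) p).symm y)))
        ((ContinuousLinearMap.fst ℝ (Euc n) (Euc m)).comp
          (differential (𝓡 n) ((𝓡 n).prod (𝓡 m)) F ((extChartAt (𝓡 n) p).symm y))) := by
    refine ContinuousLinearMap.ext fun X => ContinuousLinearMap.ext fun Y => ?_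
    change MetricField.form g₁ _ (differential (𝓡 n) (𝓡 n) (fun q => (F q).1) _ X)
      (differential (𝓡 n) (𝓡 n) (fun q => (F q).1) _ Y) = _
    rw [differential_fst hF, differential_fst hF]
    rfl
  have hK := det_ne_zero_of_injective (injective_differential_extChartAt_symm (I := 𝓡 n) p hy.1)
  rw [projJacobian, e₁, e₂, localMetric_eq, localMetric_eq, gram_bilinearComp_det,
    gram_bilinearComp_det, mul_div_mul_left _ _ (pow_ne_zero 2 hK), Real.sqrt_div' _ hB, e₃,
    ← abs_volumeForm_map]
  rfl

end Graphs


/-! ### Families of maps depending smoothly on time -/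

section MixedDerivatives

variable {E E' : Type*} [NormedAddCommGroup E] [NormedSpace ℝ E]
  [NormedAddCommGroup E'] [NormedSpace ℝ E'] {W : ℝ × E → E'} {J : Set ℝ} {t : ℝ} {q : E}

theorem uniqueDiffOn_prod_univ (hJ : UniqueDiffOn ℝ J) : UniqueDiffOn ℝ (J ×ˢ (univ : Set E)) :=
  hJ.prod uniqueDiffOn_univ

theorem hasFDerivWithinAt_of_smooth (hW : ContDiffWithinAt ℝ ∞ W (J ×ˢ univ) (t, q)) :
    HasFDerivWithinAt W (fderivWithin ℝ W (J ×ˢ univ) (t, q)) (J ×ˢ univ) (t, q) :=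
  (hW.differentiableWithinAt (by simp)).hasFDerivWithinAt

theorem hasDerivWithinAt_slice {Z : Type*} [NormedAddCommGroup Z] [NormedSpace ℝ Z]
    {W : ℝ × E → Z} {D : ℝ × E →L[ℝ] Z}
    (hW : HasFDerivWithinAt W D (J ×ˢ univ) (t, q)) :
    HasDerivWithinAt (fun s => W (s, q)) (D (1, 0)) J t :=
  HasFDerivWithinAt.comp_hasDerivWithinAt (f := fun s => (s, q)) t hW
    ((hasDerivWithinAt_id t J).prodMk (hasDerivWithinAt_const t J q))
    fun _ hs => ⟨hs, mem_univ _⟩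

theorem hasFDerivAt_slice {Z : Type*} [NormedAddCommGroup Z] [NormedSpace ℝ Z]
    {W : ℝ × E → Z} {D : ℝ × E →L[ℝ] Z} (ht : t ∈ J)
    (hW : HasFDerivWithinAt W D (J ×ˢ univ) (t, q)) :
    HasFDerivAt (fun y => W (t, y)) (D.comp (ContinuousLinearMap.inr ℝ ℝ E)) q := by
  rw [← hasFDerivWithinAt_univ]
  have h : HasFDerivWithinAt (fun y : E => (t, y)) (ContinuousLinearMap.inr ℝ ℝ E) univ q :=
    (hasFDerivAt_prodMk_right t q).hasFDerivWithinAt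
  exact HasFDerivWithinAt.comp (f := fun y => (t, y)) q hW h fun y _ => ⟨ht, mem_univ _⟩

theorem eventually_hasFDerivAt_right (ht : t ∈ J)
    (hW : ContDiffWithinAt ℝ ∞ W (J ×ˢ univ) (t, q)) :
    ∀ᶠ s in 𝓝[J] t, HasFDerivAt (fun y => W (s, y))
      ((fderivWithin ℝ W (J ×ˢ univ) (s, q)).comp (ContinuousLinearMap.inr ℝ ℝ E)) q := by
  have h1 : ContDiffWithinAt ℝ 1 W (J ×ˢ univ) (t, q) := hW.of_le (by simp)
  have h2 := h1.eventually (by simp)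
  rw [insert_eq_of_mem (show (t, q) ∈ J ×ˢ univ from ⟨ht, mem_univ _⟩)] at h2
  have h3 : Filter.Tendsto (fun s : ℝ => (s, q)) (𝓝[J] t) (𝓝[J ×ˢ univ] (t, q)) := by
    refine tendsto_nhdsWithin_iff.2 ⟨?_, ?_⟩
    · exact ((continuous_id.prodMk continuous_const).tendsto' t (t, q) rfl).mono_left
        nhdsWithin_le_nhds
    · filter_upwards [self_mem_nhdsWithin] with s hs using ⟨hs, mem_univ _⟩
  filter_upwards [h3.eventually h2, self_mem_nhdsWithin] with s hs hsJ
  exact hasFDerivAt_slice hsJ (hs.differentiableWithinAt (by simp)).hasFDerivWithinAt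

theorem hasFDerivWithinAt_fderivWithin (hJ : UniqueDiffOn ℝ J) (ht : t ∈ J)
    (hW : ContDiffWithinAt ℝ ∞ W (J ×ˢ univ) (t, q)) :
    HasFDerivWithinAt (fderivWithin ℝ W (J ×ˢ univ))
      (fderivWithin ℝ (fderivWithin ℝ W (J ×ˢ univ)) (J ×ˢ univ) (t, q)) (J ×ˢ univ) (t, q) :=
  ((hW.fderivWithin_right (m := ∞) (uniqueDiffOn_prod_univ hJ) (by simp)
    ⟨ht, mem_univ _⟩).differentiableWithinAt (by simp)).hasFDerivWithinAt

theorem differentiableAt_velocity (hJ : UniqueDiffOn ℝ J) (ht : t ∈ J)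
    (hW : ContDiffWithinAt ℝ ∞ W (J ×ˢ univ) (t, q)) :
    HasFDerivAt (fun y => fderivWithin ℝ W (J ×ˢ univ) (t, y) (1, 0))
      (((fderivWithin ℝ (fderivWithin ℝ W (J ×ˢ univ)) (J ×ˢ univ) (t, q)).comp
        (ContinuousLinearMap.inr ℝ ℝ E)).flip (1, 0)) q := by
  have h := (hasFDerivAt_slice ht (hasFDerivWithinAt_fderivWithin hJ ht hW)).clm_apply
    (hasFDerivAt_const ((1 : ℝ), (0 : E)) q)
  simpa using h

/-- Symmetry of the second derivative of `W` within the strip. At an endpoint of `J` it still holds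
by approximation from the interior, whence the closure hypothesis. -/
theorem hasDerivWithinAt_fderiv (hJ : UniqueDiffOn ℝ J) (ht : t ∈ J)
    (ht' : t ∈ closure (interior J)) (hW : ContDiffWithinAt ℝ ∞ W (J ×ˢ univ) (t, q)) :
    HasDerivWithinAt (fun s => fderiv ℝ (fun y => W (s, y)) q)
      (fderiv ℝ (fun y => fderivWithin ℝ W (J ×ˢ univ) (t, y) (1, 0)) q) J t := by
  have h1 := hasDerivWithinAt_slice (hasFDerivWithinAt_fderivWithin hJ ht hW)
  have h2 := (((ContinuousLinearMap.compL ℝ E (ℝ × E) E').flip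
    (ContinuousLinearMap.inr ℝ ℝ E)).hasFDerivAt).comp_hasDerivWithinAt t h1
  have hsymm : IsSymmSndFDerivWithinAt ℝ W (J ×ˢ univ) (t, q) :=
    hW.isSymmSndFDerivWithinAt (by simpa using ENat.LEInfty.out) (uniqueDiffOn_prod_univ hJ)
      (by rw [interior_prod_eq, interior_univ, closure_prod_eq, closure_univ]; exact ⟨ht', mem_univ _⟩)
      ⟨ht, mem_univ _⟩
  have e : (((fderivWithin ℝ (fderivWithin ℝ W (J ×ˢ univ)) (J ×ˢ univ) (t, q)).comp
        (ContinuousLinearMap.inr ℝ ℝ E)).flip (1, 0)) =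
      (ContinuousLinearMap.compL ℝ E (ℝ × E) E').flip (ContinuousLinearMap.inr ℝ ℝ E)
        (fderivWithin ℝ (fderivWithin ℝ W (J ×ˢ univ)) (J ×ˢ univ) (t, q) (1, 0)) := by
    ext Y
    exact hsymm _ _
  rw [(differentiableAt_velocity hJ ht hW).fderiv, e]
  refine h2.congr_of_eventuallyEq ?_ ?_
  · filter_upwards [eventually_hasFDerivAt_right ht hW] with s hs using hs.fderiv
  · exact (hasFDerivAt_slice ht (hasFDerivWithinAt_of_smooth hW)).fderiv

end MixedDerivatives


/-! ### Mean curvature flow in charts -/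

section FlowCharts

variable {n : ℕ} {S : Type*} [TopologicalSpace S] [ChartedSpace (EuclideanSpace ℝ (Fin n)) S]
  [IsManifold (𝓡 n) ∞ S]
  {E' H' N' : Type*} [NormedAddCommGroup E'] [NormedSpace ℝ E'] [FiniteDimensional ℝ E']
  [TopologicalSpace H']
  [TopologicalSpace N'] [ChartedSpace H' N'] {I' : ModelWithCorners ℝ E' H'} [I'.Boundaryless]
  [IsManifold I' ∞ N'] {g : MetricField I' N'} {F : ℝ → S → N'} {ε t : ℝ}

theorem IsMeanCurvatureFlow.contMDiff (hF : IsMeanCurvatureFlow n g F ε) (ht : t ∈ Ico 0 ε) :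
    ContMDiff (𝓡 n) I' ∞ (F t) := by
  have h : ContMDiff (𝓡 n) (𝓘(ℝ, ℝ).prod (𝓡 n)) ∞ fun q : S => (t, q) :=
    contMDiff_const.prodMk contMDiff_id
  exact hF.smooth.comp_contMDiff h fun q => ⟨ht, mem_univ _⟩

/-- Smoothness is asserted at single points of the strip: the points and times that `F` maps into
the chart at `r` need not form a product set. -/
theorem IsMeanCurvatureFlow.contDiffWithinAt (hF : IsMeanCurvatureFlow n g F ε)
    (ht : t ∈ Ico 0 ε) {p : S} {r : N'} {y : Euc n} (hy : y ∈ chartDomain (𝓡 n) I' (F t) p r) :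
    ContDiffWithinAt ℝ ∞ (fun z : ℝ × Euc n => chartRep (𝓡 n) I' (F z.1) p r z.2)
      (Ico 0 ε ×ˢ univ) (t, y) := by
  rw [← contMDiffWithinAt_iff_contDiffWithinAt]
  have h1 : ContMDiffAt I' 𝓘(ℝ, E') ∞ (extChartAt I' r) (F t ((extChartAt (𝓡 n) p).symm y)) :=
    (contMDiffOn_extChartAt_of_mem r).contMDiffAt ((isOpen_extChartAt_source r).mem_nhds hy.2)
  have h2 : ContMDiffAt 𝓘(ℝ, Euc n) (𝓡 n) ∞ (extChartAt (𝓡 n) p).symm y :=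
    (contMDiffOn_extChartAt_symm p).contMDiffAt ((isOpen_extChartAt_target p).mem_nhds hy.1)
  have h3 : ContMDiffWithinAt 𝓘(ℝ, ℝ × Euc n) (𝓘(ℝ, ℝ).prod (𝓡 n)) ∞
      (fun z : ℝ × Euc n => (z.1, (extChartAt (𝓡 n) p).symm z.2)) (Ico 0 ε ×ˢ univ) (t, y) := by
    refine ContMDiffWithinAt.prodMk ?_ ?_
    · exact contDiff_fst.contDiffWithinAt.contMDiffWithinAt
    · exact ContMDiffAt.comp_contMDiffWithinAt (f := fun z : ℝ × Euc n => z.2) (t, y) h2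
        contDiff_snd.contDiffWithinAt.contMDiffWithinAt
  have h4 := ContMDiffWithinAt.comp (g := Function.uncurry F)
    (f := fun z : ℝ × Euc n => (z.1, (extChartAt (𝓡 n) p).symm z.2)) (t, y)
    (hF.smooth (t, (extChartAt (𝓡 n) p).symm y) ⟨ht, mem_univ _⟩) h3
    fun z hz => ⟨hz.1, mem_univ _⟩
  exact ContMDiffAt.comp_contMDiffWithinAt (g := extChartAt I' r) (t, y) h1 h4

/-- The flow equation at the moving point `p'` is expressed in the chart at `F t p'`. Both sides are
carried there by the injective differential of the coordinate change and compared with it. -/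
theorem IsMeanCurvatureFlow.velocity_chartRep (hF : IsMeanCurvatureFlow n g F ε)
    (hg : ∀ r, IsLocalMetric (localMetric I' g r) (extChartAt I' r).target)
    (ht : t ∈ Ico 0 ε) {p : S} {r : N'} {y : Euc n} (hy : y ∈ chartDomain (𝓡 n) I' (F t) p r) :
    fderivWithin ℝ (fun z : ℝ × Euc n => chartRep (𝓡 n) I' (F z.1) p r z.2)
        (Ico 0 ε ×ˢ univ) (t, y) (1, 0) =
      metricTrace (pullMetric (chartRep (𝓡 n) I' (F t) p r) (localMetric I' g r) y)
        fun X Y => sff (chartRep (𝓡 n) I' (F t) p r) (localMetric I' g r) y X Y := by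
  set p' := (extChartAt (𝓡 n) p).symm y with hp'
  have hu : chartRep (𝓡 n) I' (F t) p r y ∈ chartDomain I' I' id r (F t p') := by
    refine ⟨(extChartAt I' r).map_source hy.2, ?_⟩
    have : (extChartAt I' r).symm (chartRep (𝓡 n) I' (F t) p r y) = F t p' := by
      rw [chartRep, Function.comp_apply, Function.comp_apply, (extChartAt I' r).left_inv hy.2]
    rw [mem_preimage, this]
    exact mem_extChartAt_source (F t p')
  apply (surjective_fderiv_chartRep_id hu).1
  rw [← meanCurvatureVector_eq hg (hF.contMDiff ht) (hF.immersion t ht) hy hp'.symm,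
    ← hF.velocity t ht p']
  have hm : MDifferentiableWithinAt 𝓘(ℝ, ℝ) I' (fun s => F s p') (Ico 0 ε) t := by
    have h : ContMDiff 𝓘(ℝ, ℝ) (𝓘(ℝ, ℝ).prod (𝓡 n)) ∞ fun s : ℝ => (s, p') :=
      contMDiff_id.prodMk contMDiff_const
    exact ((hF.smooth.comp h.contMDiffOn (fun s hs => ⟨hs, mem_univ _⟩)) t ht).mdifferentiableWithinAt
      (by simp)
  have hd := hasDerivWithinAt_slice (hasFDerivWithinAt_of_smooth (hF.contDiffWithinAt ht hy))
  have hφ : DifferentiableAt ℝ (chartRep I' I' id r (F t p')) (chartRep (𝓡 n) I' (F t) p r y) :=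
    differentiableAt_chartRep hu.1 hu.2 mdifferentiableAt_id
  have h1 := hφ.hasFDerivAt.comp_hasDerivWithinAt t hd
  have h2 : ∀ᶠ s in 𝓝[Ico 0 ε] t, F s p' ∈ (extChartAt I' r).source :=
    hm.continuousWithinAt.preimage_mem_nhdsWithin ((isOpen_extChartAt_source r).mem_nhds hy.2)
  have h3 : HasDerivWithinAt (fun s => extChartAt I' (F t p') (F s p')) _ (Ico 0 ε) t :=
    h1.congr_of_eventuallyEq (by
      filter_upwards [h2] with s hs
      simp only [chartRep, Function.comp_apply, id]
      rw [(extChartAt I' r).left_inv hs]) (by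
      simp only [chartRep, Function.comp_apply, id]
      rw [(extChartAt I' r).left_inv hy.2])
  have h4 : (mfderivWithin 𝓘(ℝ, ℝ) I' (fun s => F s p') (Ico 0 ε) t : ℝ →L[ℝ] E') =
      fderivWithin ℝ (fun s => extChartAt I' (F t p') (F s p')) (Ico 0 ε) t := by
    have := hm.mfderivWithin
    simp only [mfld_simps] at this
    exact this
  rw [h4, h3.hasFDerivWithinAt.fderivWithin (uniqueDiffOn_Ico 0 ε t ht)]
  exact (one_smul ℝ _).symm

end FlowCharts


/-! ### Singular value decomposition -/

section SingularValues

variable {n m : ℕ}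

/-- Take an eigenbasis of `T* T` and `lam` the square roots of the eigenvalues. The vectors `T aᵢ /
λᵢ` with `λᵢ ≠ 0` are orthonormal, and they are completed to an orthonormal basis. -/
theorem exists_singular_vectors (T : Euc n →ₗ[ℝ] Euc m) :
    ∃ (a : Fin n → Euc n) (b : Fin m → Euc m) (lam : Fin n → ℝ),
      Orthonormal ℝ a ∧ Orthonormal ℝ b ∧ (∀ i, 0 ≤ lam i) ∧
      (∀ i : Fin n, m ≤ (i : ℕ) → lam i = 0) ∧ ∀ i, T (a i) = lam i • extendZero b i := by
  have hn : Module.finrank ℝ (Euc n) = n := by simp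
  have hA := T.isSymmetric_adjoint_comp_self
  have hpos := T.isPositive_adjoint_comp_self.nonneg_eigenvalues hn
  set a := hA.eigenvectorBasis hn with ha
  set μ := hA.eigenvalues hn with hμ
  set lam : Fin n → ℝ := fun i => √(μ i) with hlam
  have hlam0 : ∀ i, 0 ≤ lam i := fun i => Real.sqrt_nonneg _
  have hT : ∀ i j, inner ℝ (T (a i)) (T (a j)) = if i = j then lam i ^ 2 else 0 := fun i j => by
    have h1 : inner ℝ (T (a i)) (T (a j)) = inner ℝ ((LinearMap.adjoint T ∘ₗ T) (a i)) (a j) := by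
      rw [LinearMap.comp_apply, LinearMap.adjoint_inner_left]
    rw [h1, ha, hA.apply_eigenvectorBasis hn, ← ha, inner_smul_left,
      orthonormal_iff_ite.1 a.orthonormal]
    simp only [hlam, Real.sq_sqrt (hpos i)]
    simp [hμ]
  have hT0 : ∀ i, lam i = 0 → T (a i) = 0 := fun i hi => by
    have := hT i i
    rw [hi] at this
    simpa using this
  set v : Fin n → Euc m := fun i => (lam i)⁻¹ • T (a i) with hv
  have hvi : ∀ i j, lam i ≠ 0 → lam j ≠ 0 → inner ℝ (v i) (v j) = if i = j then (1 : ℝ) else 0 := by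
    intro i j hi hj
    simp only [hv, inner_smul_left, inner_smul_right, hT]
    by_cases hij : i = j
    · subst hij
      simp only [if_true, RCLike.conj_to_real]
      field_simp
    · simp [hij]
  -- The decreasing order of the eigenvalues matters: if `λᵢ ≠ 0` with `i ≥ m`, then all `i + 1`
  -- values up to `λᵢ` are nonzero, giving more than `m` orthonormal vectors in `ℝᵐ`.
  have hanti : Antitone lam := fun i j hij => Real.sqrt_le_sqrt (hA.eigenvalues_antitone hn hij)
  have hzero : ∀ i : Fin n, m ≤ (i : ℕ) → lam i = 0 := by
    intro i hi
    by_contra hne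
    have hlt : ∀ j : Fin (i + 1), lam (Fin.castLE i.2 j) ≠ 0 := fun j => by
      have : lam i ≤ lam (Fin.castLE i.2 j) := hanti (Fin.le_def.2 (Nat.lt_succ_iff.1 j.2))
      have : 0 < lam i := lt_of_le_of_ne (hlam0 i) (Ne.symm hne)
      linarith
    have ho : Orthonormal ℝ fun j : Fin (i + 1) => v (Fin.castLE i.2 j) := by
      rw [orthonormal_iff_ite]
      intro j k
      rw [hvi _ _ (hlt j) (hlt k)]
      simp [Fin.ext_iff]
    have := ho.linearIndependent.fintype_card_le_finrank
    simp at this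
    omega
  have hb : Orthonormal ℝ ({α : Fin m | extendZero lam α ≠ 0}.domRestrict
      fun α : Fin m => extendZero v α) := by
    rw [orthonormal_iff_ite]
    rintro ⟨α, hα⟩ ⟨β, hβ⟩
    have hαn : (α : ℕ) < n := by
      by_contra h
      exact hα (extendZero_of_le lam (not_lt.1 h))
    have hβn : (β : ℕ) < n := by
      by_contra h
      exact hβ (extendZero_of_le lam (not_lt.1 h))
    rw [mem_ofPred_eq, extendZero_of_lt _ hαn] at hα
    rw [mem_ofPred_eq, extendZero_of_lt _ hβn] at hβ
    simp only [domRestrict_apply, extendZero_of_lt v hαn, extendZero_of_lt v hβn, hvi _ _ hα hβ]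
    simp [Fin.ext_iff]
  obtain ⟨b, hb⟩ := hb.exists_orthonormalBasis_extension_of_card_eq (by simp)
  refine ⟨a, b, lam, a.orthonormal, b.orthonormal, hlam0, hzero, fun i => ?_⟩
  by_cases hi : lam i = 0
  · rw [hT0 i hi, hi, zero_smul]
  · have him : (i : ℕ) < m := by
      by_contra h
      exact hi (hzero i (not_lt.1 h))
    have := hb ⟨i, him⟩ (by simpa using hi)
    rw [extendZero_of_lt _ him, this, extendZero_val v i]
    simp only [hv, smul_smul]
    rw [mul_inv_cancel₀ hi, one_smul]

theorem IsInner.exists_linearEquiv {B : Euc n →L[ℝ] Euc n →L[ℝ] ℝ} (hB : IsInner B) :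
    ∃ P : Euc n ≃ₗ[ℝ] Euc n, ∀ x y, B (P x) (P y) = inner ℝ x y := by
  obtain ⟨c, hc⟩ := hB.exists_isOrthonormal
  let e := (EuclideanSpace.basisFun (Fin n) ℝ)
  let P := e.toBasis.equiv hc.basis (Equiv.refl _)
  have hP : ∀ x, P x = ∑ i, x i • c i := fun x => by
    conv_lhs => rw [← e.sum_repr x, map_sum]
    refine Finset.sum_congr rfl fun i _ => ?_
    rw [map_smul]
    congr 1
    rw [← OrthonormalBasis.coe_toBasis, Module.Basis.equiv_apply]
    simp
  refine ⟨P, fun x y => ?_⟩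
  rw [hP, hP]
  simp [hc _ _, PiLp.inner_apply, mul_comm]

/-- Reduces to the standard inner products by conjugating `T` with linear isometries. -/
theorem exists_singular_frame {B₁ : Euc n →L[ℝ] Euc n →L[ℝ] ℝ} {B₂ : Euc m →L[ℝ] Euc m →L[ℝ] ℝ}
    (h₁ : IsInner B₁) (h₂ : IsInner B₂) (T : Euc n →L[ℝ] Euc m) :
    ∃ (a : Fin n → Euc n) (b : Fin m → Euc m) (lam : Fin n → ℝ),
      IsOrthonormal B₁ a ∧ IsOrthonormal B₂ b ∧ (∀ i, 0 ≤ lam i) ∧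
      (∀ i : Fin n, m ≤ (i : ℕ) → lam i = 0) ∧ ∀ i, T (a i) = lam i • extendZero b i := by
  obtain ⟨P, hP⟩ := h₁.exists_linearEquiv
  obtain ⟨Q, hQ⟩ := h₂.exists_linearEquiv
  obtain ⟨a, b, lam, ha, hb, h0, hm, hT⟩ :=
    exists_singular_vectors (Q.symm.toLinearMap ∘ₗ (T : Euc n →ₗ[ℝ] Euc m) ∘ₗ P.toLinearMap)
  refine ⟨fun i => P (a i), fun α => Q (b α), lam, fun i j => ?_, fun i j => ?_, h0, hm,
    fun i => ?_⟩
  · rw [hP]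
    exact orthonormal_iff_ite.1 ha i j
  · rw [hQ]
    exact orthonormal_iff_ite.1 hb i j
  · have h := congrArg Q (hT i)
    rw [map_smul] at h
    simp only [LinearMap.comp_apply, LinearEquiv.coe_coe, LinearEquiv.apply_symm_apply] at h
    have e : extendZero (fun α => Q (b α)) i = Q (extendZero b i) := by
      rcases lt_or_ge (i : ℕ) m with hi | hi
      · rw [extendZero_of_lt _ hi, extendZero_of_lt _ hi]
      · rw [extendZero_of_le _ hi, extendZero_of_le _ hi, map_zero]
    rw [e, ← h]
    rfl

end SingularValues


/-! ### The evolution equation in an adapted frame -/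

section LocalEvolution

variable {n m : ℕ}

/-- The factor in the evolution equation of `*Ω₁`, in terms of the second fundamental form
`h α i k`. -/
def reaction (m : ℕ) (k₁ k₂ : ℝ) (lam : Fin n → ℝ) (h : ℕ → Fin n → Fin n → ℝ) : ℝ :=
  (∑ α : Fin m, ∑ i, ∑ k, h α i k ^ 2)
    - 2 * (∑ k, ∑ i, ∑ j ∈ Finset.Ioi i, lam i * lam j * h i i k * h j j k)
    + 2 * (∑ k, ∑ i, ∑ j ∈ Finset.Ioi i, lam i * lam j * h j i k * h i j k)
    + ∑ i, lam i ^ 2 / (1 + lam i ^ 2) *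
        (k₁ * (∑ j ∈ Finset.univ.erase i, 1 / (1 + lam j ^ 2))
          + k₂ * (1 - (n : ℝ) + ∑ j ∈ Finset.univ.erase i, 1 / (1 + lam j ^ 2)))

theorem hasDerivWithinAt_projJacobian_frame {u : ℝ → Euc n → Euc n × Euc m} {O : Set (Euc n)}
    {G₁ : Euc n → Euc n →L[ℝ] Euc n →L[ℝ] ℝ} {G₂ : Euc m → Euc m →L[ℝ] Euc m →L[ℝ] ℝ}
    {U₁ : Set (Euc n)} {U₂ : Set (Euc m)} {q : Euc n} {I : Set ℝ} {t : ℝ}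
    (h : IsLocalGraphImmersion (u t) O G₁ G₂ U₁ U₂) (hq : q ∈ O) {V : Euc n → Euc n × Euc m}
    (hu : ∀ᶠ s in 𝓝[I] t, DifferentiableAt ℝ (u s) q) (ht : t ∈ I)
    (hV : ∀ᶠ y in 𝓝 q, V y = metricTrace (pullMetric (u t) (prodMetric G₁ G₂) y)
      fun X Y => sff (u t) (prodMetric G₁ G₂) y X Y)
    (hVd : DifferentiableAt ℝ V q)
    (hut : HasDerivWithinAt (fun s => u s q) (V q) I t)
    (hut' : HasDerivWithinAt (fun s => fderiv ℝ (u s) q) (fderiv ℝ V q) I t)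
    {a : Fin n → Euc n} {b : Fin m → Euc m} {lam : Fin n → ℝ} {τ : Fin n → Euc n}
    (hf : IsFrame (G₁ (u t q).1) (G₂ (u t q).2) (fderiv ℝ (u t) q) a b lam τ) {k₁ k₂ : ℝ}
    (hk₁ : ∀ v w z, curvature G₁ (u t q).1 v w z =
      k₁ • (G₁ (u t q).1 w z • v - G₁ (u t q).1 v z • w))
    (hk₂ : ∀ v w z, curvature G₂ (u t q).2 v w z =
      k₂ • (G₂ (u t q).2 w z • v - G₂ (u t q).2 v z • w)) :
    HasDerivWithinAt (fun s => projJacobian (u s) G₁ G₂ q)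
      (∑ i, (fderiv ℝ (fderiv ℝ (projJacobian (u t) G₁ G₂)) q (τ i) (τ i)
          - fderiv ℝ (projJacobian (u t) G₁ G₂) q
              (christoffelL (pullMetric (u t) (prodMetric G₁ G₂)) q (τ i) (τ i)))
        + projJacobian (u t) G₁ G₂ q * reaction m k₁ k₂ lam fun α i k =>
            normalComponent (G₁ (u t q).1) (G₂ (u t q).2) a b lam
              (sff (u t) (prodMetric G₁ G₂) q (τ i) (τ k)) α)
      I t := by
  have him := h.isLocalImmersion
  have hA : ∀ X Y Z, prodForm (G₁ (u t q).1) (G₂ (u t q).2)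
      (sff (u t) (prodMetric G₁ G₂) q X Y) (fderiv ℝ (u t) q Z) = 0 := him.apply_sff hq
  have key := hasDerivWithinAt_projJacobian h hq hu ht hV hVd hut hut' hf.isOrthonormal_τ
  convert key using 3
  rw [reaction]
  congr 1
  · have e₁ : ∑ i, ∑ k, prodMetric G₁ G₂ (u t q) (sff (u t) (prodMetric G₁ G₂) q (τ i) (τ k))
        (sff (u t) (prodMetric G₁ G₂) q (τ i) (τ k)) =
        ∑ α : Fin m, ∑ i, ∑ k, normalComponent (G₁ (u t q).1) (G₂ (u t q).2) a b lam
          (sff (u t) (prodMetric G₁ G₂) q (τ i) (τ k)) α ^ 2 := by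
      rw [Finset.sum_comm (s := (Finset.univ : Finset (Fin m)))]
      refine Finset.sum_congr rfl fun i _ => ?_
      rw [Finset.sum_comm (s := (Finset.univ : Finset (Fin m)))]
      exact Finset.sum_congr rfl fun k _ => hf.prodForm_self _ (hA _ _)
    have e₂ := fun k => hf.trace_comp_sub_sq (him.sff_symm hq) hA
      (shape_apply (u t) (prodMetric G₁ G₂) q) k
    rw [e₁, Finset.sum_congr rfl fun k _ => e₂ k, Finset.sum_add_distrib,
      Finset.sum_neg_distrib, ← Finset.mul_sum, ← Finset.mul_sum]
    ring
  · exact (hf.curvature_sum (R := curvature (prodMetric G₁ G₂) (u t q)) fun v w z => by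
      rw [h.metric₁.curvature_prodMetric h.metric₂ (h.mapsTo hq), hk₁, hk₂]).symm

end LocalEvolution

/-! ### The evolution equation on manifolds -/

section Evolution

variable {n m : ℕ} {S S₁ S₂ : Type*} [TopologicalSpace S] [TopologicalSpace S₁]
  [TopologicalSpace S₂] [ChartedSpace (EuclideanSpace ℝ (Fin n)) S]
  [ChartedSpace (EuclideanSpace ℝ (Fin n)) S₁] [ChartedSpace (EuclideanSpace ℝ (Fin m)) S₂]
  [IsManifold (𝓡 n) ∞ S] [IsManifold (𝓡 n) ∞ S₁] [IsManifold (𝓡 m) ∞ S₂]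
  (g₁ : Bundle.ContMDiffRiemannianMetric (𝓡 n) ∞ (EuclideanSpace ℝ (Fin n))
    (fun x : S₁ => TangentSpace (𝓡 n) x))
  (g₂ : Bundle.ContMDiffRiemannianMetric (𝓡 m) ∞ (EuclideanSpace ℝ (Fin m))
    (fun x : S₂ => TangentSpace (𝓡 m) x))

theorem isInner_form {E H N : Type*} [NormedAddCommGroup E] [NormedSpace ℝ E] [TopologicalSpace H]
    [TopologicalSpace N] [ChartedSpace H N] {I : ModelWithCorners ℝ E H} [IsManifold I 1 N]
    (g : Bundle.ContMDiffRiemannianMetric I ∞ E (fun x : N => TangentSpace I x)) (x : N) :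
    IsInner (MetricField.form g.inner x) :=
  ⟨fun _ _ => g.symm _ _ _, fun _ hv => g.pos _ _ hv⟩

theorem starOmega_eq_projJacobian {F : S → S₁ × S₂} {p : S} {r : S₁ × S₂} {y : Euc n}
    (hy : y ∈ chartDomain (𝓡 n) ((𝓡 n).prod (𝓡 m)) F p r)
    (hF : ContMDiff (𝓡 n) ((𝓡 n).prod (𝓡 m)) ∞ F)
    (hF' : ∀ q, Function.Injective (differential (𝓡 n) ((𝓡 n).prod (𝓡 m)) F q)) :
    starOmega g₁.inner g₂.inner F ((extChartAt (𝓡 n) p).symm y) =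
      projJacobian (chartRep (𝓡 n) ((𝓡 n).prod (𝓡 m)) F p r) (localMetric (𝓡 n) g₁.inner r.1)
        (localMetric (𝓡 m) g₂.inner r.2) y := by
  have : IsManifold (𝓡 n) 1 S₁ := isManifold_one (I := 𝓡 n)
  have : IsManifold (𝓡 m) 1 S₂ := isManifold_one (I := 𝓡 m)
  refine starOmega_eq _ _ hy (hF.mdifferentiable (by simp) _) (IsInner.gram_det_pos ?_).le
  exact (IsInner.prodForm (isInner_form g₁ _) (isInner_form g₂ _)).bilinearComp (hF' _)

theorem contMDiff_starOmega {F : S → S₁ × S₂}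
    (hF : ContMDiff (𝓡 n) ((𝓡 n).prod (𝓡 m)) ∞ F)
    (hF' : ∀ q, Function.Injective (differential (𝓡 n) ((𝓡 n).prod (𝓡 m)) F q))
    (hgraph : IsLocallyGraph n m F) :
    ContMDiff (𝓡 n) 𝓘(ℝ, ℝ) ∞ (starOmega g₁.inner g₂.inner F) ∧
      ∀ p, 0 < starOmega g₁.inner g₂.inner F p := by
  have hloc := isLocalGraphImmersion_chartRep (isLocalMetric_localMetric g₁)
    (isLocalMetric_localMetric g₂) hF
    (hgraph.injective_fst (hF.mdifferentiable (by simp)) hF')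
  have hmem : ∀ p, extChartAt (𝓡 n) p p ∈ chartDomain (𝓡 n) ((𝓡 n).prod (𝓡 m)) F p (F p) :=
    fun p => extChartAt_mem_chartDomain (mem_extChartAt_source p) (mem_extChartAt_source (F p))
  refine ⟨fun p => ?_, fun p => ?_⟩
  · have h1 := (hloc p (F p)).smooth_projJacobian.contDiffAt
      ((hloc p (F p)).isOpen.mem_nhds (hmem p))
    have h2 : ContMDiffAt (𝓡 n) 𝓘(ℝ, Euc n) ∞ (extChartAt (𝓡 n) p) p := contMDiffAt_extChartAt
    refine (h1.contMDiffAt.comp p h2).congr_of_eventuallyEq ?_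
    filter_upwards [extChartAt_source_mem_nhds (I := 𝓡 n) p,
      (hF.continuous.continuousAt (x := p)).preimage_mem_nhds
        (extChartAt_source_mem_nhds (I := (𝓡 n).prod (𝓡 m)) (F p))] with q hq hq'
    have := starOmega_eq_projJacobian g₁ g₂ (extChartAt_mem_chartDomain hq hq') hF hF'
    rwa [(extChartAt (𝓡 n) p).left_inv hq] at this
  · have := starOmega_eq_projJacobian g₁ g₂ (hmem p) hF hF'
    rw [extChartAt_to_inv] at this
    rw [this]
    exact (hloc p (F p)).projJacobian_pos (hmem p)

/-- Invertibility of the projection yields `τᵢ` with the prescribed first component; the second is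
then correct because the image is a graph. -/
theorem IsGraphNear.exists_isAdaptedFrame {F : S → S₁ × S₂} {p : S} {U : Set S} {V : Set S₁}
    {f : S₁ → S₂} (h : IsGraphNear n m F p U V f)
    (hF : MDifferentiableAt (𝓡 n) ((𝓡 n).prod (𝓡 m)) F p)
    (hF' : Function.Injective ((ContinuousLinearMap.fst ℝ (Euc n) (Euc m)).comp
      (differential (𝓡 n) ((𝓡 n).prod (𝓡 m)) F p))) :
    ∃ a b lam τ, IsAdaptedFrame g₁.inner g₂.inner F p f a b lam τ := by
  have : IsManifold (𝓡 n) 1 S₁ := isManifold_one (I := 𝓡 n)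
  have : IsManifold (𝓡 m) 1 S₂ := isManifold_one (I := 𝓡 m)
  obtain ⟨a, b, lam, ha, hb, h0, hm, hT⟩ := exists_singular_frame (isInner_form g₁ (F p).1)
    (isInner_form g₂ (f (F p).1)) (differential (𝓡 n) (𝓡 m) f (F p).1)
  choose τ hτ using fun i => (isInvertible_of_injective hF').surjective
    ((1 / √(1 + lam i ^ 2)) • a i)
  refine ⟨a, b, lam, τ, ha, hb, h0, hm, hT, fun i => ?_⟩
  have e : (differential (𝓡 n) ((𝓡 n).prod (𝓡 m)) F p (τ i)).1 = (1 / √(1 + lam i ^ 2)) • a i := hτ i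
  refine Prod.ext e ?_
  rw [h.differential_snd hF, e, map_smul]
  rfl

theorem IsAdaptedFrame.isFrame {F : S → S₁ × S₂} {p : S} {U : Set S} {V : Set S₁}
    {f : S₁ → S₂} (h : IsGraphNear n m F p U V f)
    (hF' : Function.Injective ((ContinuousLinearMap.fst ℝ (Euc n) (Euc m)).comp
      (differential (𝓡 n) ((𝓡 n).prod (𝓡 m)) F p))) {a : Fin n → Euc n} {b : Fin m → Euc m}
    {lam : Fin n → ℝ} {τ : Fin n → Euc n}
    (hf : IsAdaptedFrame g₁.inner g₂.inner F p f a b lam τ) :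
    IsFrame (MetricField.form g₁.inner (F p).1) (MetricField.form g₂.inner (F p).2)
      (differential (𝓡 n) ((𝓡 n).prod (𝓡 m)) F p) a b lam τ := by
  refine ⟨hf.orthonormal_a, ?_, hf.lam_eq_zero, fun i => ?_,
    hF'⟩
  · rw [(h.snd_eq h.mem_U).2]
    exact hf.orthonormal_b
  · rw [hf.dF_τ, hf.df_a]

end Evolution


/-! ### The time derivative of `*Ω₁` on the manifold. -/

section Evolution

variable {n m : ℕ} {S S₁ S₂ : Type*} [TopologicalSpace S] [TopologicalSpace S₁]
  [TopologicalSpace S₂] [ChartedSpace (EuclideanSpace ℝ (Fin n)) S]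
  [ChartedSpace (EuclideanSpace ℝ (Fin n)) S₁] [ChartedSpace (EuclideanSpace ℝ (Fin m)) S₂]
  [IsManifold (𝓡 n) ∞ S] [IsManifold (𝓡 n) ∞ S₁] [IsManifold (𝓡 m) ∞ S₂]
  (g₁ : Bundle.ContMDiffRiemannianMetric (𝓡 n) ∞ (EuclideanSpace ℝ (Fin n))
    (fun x : S₁ => TangentSpace (𝓡 n) x))
  (g₂ : Bundle.ContMDiffRiemannianMetric (𝓡 m) ∞ (EuclideanSpace ℝ (Fin m))
    (fun x : S₂ => TangentSpace (𝓡 m) x))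

/-- The charts at `p` and at `r = F t p` are kept fixed while `s` varies near `t`. In them the flow
becomes a smooth family `u s`, to which the coordinate formula applies. -/
theorem hasDerivWithinAt_starOmega {k₁ k₂ : ℝ}
    (hk₁ : HasConstantCurvature (𝓡 n) g₁.inner k₁)
    (hk₂ : HasConstantCurvature (𝓡 m) g₂.inner k₂) {ε : ℝ} {F : ℝ → S → S₁ × S₂}
    (hF : IsMeanCurvatureFlow n (productMetric g₁.inner g₂.inner) F ε) {t : ℝ}
    (ht : t ∈ Ico 0 ε) (hgraph : IsLocallyGraph n m (F t)) {p : S} {U : Set S} {V : Set S₁}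
    {f : S₁ → S₂} (h : IsGraphNear n m (F t) p U V f) {a : Fin n → Euc n} {b : Fin m → Euc m}
    {lam : Fin n → ℝ} {τ : Fin n → Euc n}
    (hf : IsAdaptedFrame g₁.inner g₂.inner (F t) p f a b lam τ) :
    HasDerivWithinAt (fun s => starOmega g₁.inner g₂.inner (F s) p)
      (laplacian (inducedMetric (𝓡 n) (productMetric g₁.inner g₂.inner) (F t))
          (starOmega g₁.inner g₂.inner (F t)) p
        + starOmega g₁.inner g₂.inner (F t) p *
          reaction m k₁ k₂ lam (frameSFF g₁.inner g₂.inner (F t) p a b lam τ))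
      (Ico 0 ε) t := by
  set J := (𝓡 n).prod (𝓡 m) with hJ
  set r := F t p with hr
  set q := extChartAt (𝓡 n) p p with hq_def
  set G₁ := localMetric (𝓡 n) g₁.inner r.1 with hG₁
  set G₂ := localMetric (𝓡 m) g₂.inner r.2 with hG₂
  set u : ℝ → Euc n → Euc n × Euc m := fun s => chartRep (𝓡 n) J (F s) p r with hu
  have l₁ := isLocalMetric_localMetric g₁
  have l₂ := isLocalMetric_localMetric g₂
  have hg := isLocalMetric_productMetric l₁ l₂
  have hFt := hF.contMDiff ht
  have hinj := hgraph.injective_fst (hFt.mdifferentiable (by simp)) (hF.immersion t ht)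
  have hloc : IsLocalGraphImmersion (u t) (chartDomain (𝓡 n) J (F t) p r) G₁ G₂
      (extChartAt (𝓡 n) r.1).target (extChartAt (𝓡 m) r.2).target :=
    isLocalGraphImmersion_chartRep l₁ l₂ hFt hinj p r
  have hq : q ∈ chartDomain (𝓡 n) J (F t) p r :=
    extChartAt_mem_chartDomain (mem_extChartAt_source p) (mem_extChartAt_source r)
  have huq : u t q = extChartAt J r r := by
    simp only [hu, chartRep, Function.comp_apply, hq_def, extChartAt_to_inv, ← hr]
  have hu₁ : (u t q).1 = extChartAt (𝓡 n) r.1 r.1 := by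
    rw [huq, hJ, extChartAt_prod]
    rfl
  have hu₂ : (u t q).2 = extChartAt (𝓡 m) r.2 r.2 := by
    rw [huq, hJ, extChartAt_prod]
    rfl
  have hB₁ : G₁ (u t q).1 = MetricField.form g₁.inner r.1 := by rw [hu₁, hG₁, localMetric_self]
  have hB₂ : G₂ (u t q).2 = MetricField.form g₂.inner r.2 := by rw [hu₂, hG₂, localMetric_self]
  have hL : differential (𝓡 n) J (F t) p = fderiv ℝ (u t) q :=
    differential_eq_fderiv_chart (hFt.mdifferentiable (by simp) p)
  have hprod : ∀ y ∈ chartDomain (𝓡 n) J (F t) p r,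
      localMetric J (productMetric g₁.inner g₂.inner) r =ᶠ[𝓝 (u t y)] prodMetric G₁ G₂ := by
    intro y hy
    filter_upwards [(isOpen_extChartAt_target (I := J) r).mem_nhds
      ((extChartAt J r).map_source hy.2)] with z hz
    exact localMetric_productMetric _ _ r hz
  have hcont : ∀ y ∈ chartDomain (𝓡 n) J (F t) p r, ContinuousAt (u t) y := fun y hy =>
    (hloc.isLocalImmersion.differentiableAt hy).continuousAt
  have hpull : ∀ y ∈ chartDomain (𝓡 n) J (F t) p r,
      pullMetric (u t) (localMetric J (productMetric g₁.inner g₂.inner) r) y =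
        pullMetric (u t) (prodMetric G₁ G₂) y := fun y hy =>
    (pullMetric_congr Filter.EventuallyEq.rfl (hcont y hy) (hprod y hy)).eq_of_nhds
  have hsff : ∀ y ∈ chartDomain (𝓡 n) J (F t) p r,
      sff (u t) (localMetric J (productMetric g₁.inner g₂.inner) r) y =
        sff (u t) (prodMetric G₁ G₂) y := fun y hy =>
    sff_congr Filter.EventuallyEq.rfl (hcont y hy) (hprod y hy)
  have hframe : IsFrame (G₁ (u t q).1) (G₂ (u t q).2) (fderiv ℝ (u t) q) a b lam τ := by
    rw [hB₁, hB₂, ← hL]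
    exact IsAdaptedFrame.isFrame g₁ g₂ h (hinj p) hf
  have hJu : UniqueDiffOn ℝ (Ico 0 ε) := uniqueDiffOn_Ico 0 ε
  -- The closure of the interior is `Icc 0 ε`, so the initial time is included.
  have ht' : t ∈ closure (interior (Ico 0 ε)) := by
    rw [interior_Ico, closure_Ioo (ht.1.trans_lt ht.2).ne]
    exact Ico_subset_Icc_self ht
  have hW := hF.contDiffWithinAt ht hq
  have key := hasDerivWithinAt_projJacobian_frame (u := u) (k₁ := k₁) (k₂ := k₂)
    (V := fun y => fderivWithin ℝ (fun z : ℝ × Euc n => u z.1 z.2) (Ico 0 ε ×ˢ univ) (t, y) (1, 0))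
    hloc hq
    ((eventually_hasFDerivAt_right ht hW).mono fun s hs => hs.differentiableAt) ht
    (by
      filter_upwards [hloc.isOpen.mem_nhds hq] with y hy
      rw [← hpull y hy, ← hsff y hy]
      exact hF.velocity_chartRep hg ht hy)
    (differentiableAt_velocity hJu ht hW).differentiableAt
    (hasDerivWithinAt_slice (hasFDerivWithinAt_of_smooth hW))
    (hasDerivWithinAt_fderiv hJu ht ht' hW) hframe
    (fun v w z => by
      rw [hB₁, hu₁]
      exact hk₁ r.1 v w z)
    (fun v w z => by
      rw [hB₂, hu₂]
      exact hk₂ r.2 v w z)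
  have hstar : ∀ s ∈ Ico 0 ε, ∀ y ∈ chartDomain (𝓡 n) J (F s) p r,
      starOmega g₁.inner g₂.inner (F s) ((extChartAt (𝓡 n) p).symm y) =
        projJacobian (u s) G₁ G₂ y := fun s hs y hy =>
    starOmega_eq_projJacobian g₁ g₂ hy (hF.contMDiff hs) (hF.immersion s hs)
  have hstar_p : ∀ s ∈ Ico 0 ε, F s p ∈ (extChartAt J r).source →
      starOmega g₁.inner g₂.inner (F s) p = projJacobian (u s) G₁ G₂ q := fun s hs hsr => by
    have := hstar s hs q (extChartAt_mem_chartDomain (mem_extChartAt_source p) hsr)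
    rwa [hq_def, extChartAt_to_inv] at this
  have hlap : laplacian (inducedMetric (𝓡 n) (productMetric g₁.inner g₂.inner) (F t))
      (starOmega g₁.inner g₂.inner (F t)) p =
      ∑ i, (fderiv ℝ (fderiv ℝ (projJacobian (u t) G₁ G₂)) q (τ i) (τ i)
        - fderiv ℝ (projJacobian (u t) G₁ G₂) q
            (christoffelL (pullMetric (u t) (prodMetric G₁ G₂)) q (τ i) (τ i))) := by
    refine laplacian_eq ?_ ?_ hframe.isOrthonormal_τ
    · filter_upwards [hloc.isOpen.mem_nhds hq] with y hy using hstar t ht y hy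
    · filter_upwards [hloc.isOpen.mem_nhds hq] with y hy
      rw [localMetric_inducedMetric (r := r) _ hy.1 hy.2 (hFt.mdifferentiable (by simp) _)]
      exact hpull y hy
  have hframeSFF : frameSFF g₁.inner g₂.inner (F t) p a b lam τ = fun α i k =>
      normalComponent (G₁ (u t q).1) (G₂ (u t q).2) a b lam
        (sff (u t) (prodMetric G₁ G₂) q (τ i) (τ k)) α := by
    funext α i k
    rw [hB₁, hB₂, ← hsff q hq, frameSFF, secondFundamentalForm_eq_sff hg hFt (hF.immersion t ht)]
    rfl
  rw [hlap, hframeSFF, hstar_p t ht (mem_extChartAt_source r)]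
  refine key.congr_of_eventuallyEq ?_ (hstar_p t ht (mem_extChartAt_source r))
  -- By continuity `F s p` stays in the chart at `r` for `s` near `t`, which is all that a
  -- derivative at `t` requires.
  have hm : ContinuousWithinAt (fun s => F s p) (Ico 0 ε) t :=
    ContinuousWithinAt.comp (f := fun s : ℝ => (s, p)) (g := Function.uncurry F)
      (t := Ico 0 ε ×ˢ univ) (hF.smooth (t, p) ⟨ht, mem_univ _⟩).continuousWithinAt
      (continuous_id.prodMk continuous_const).continuousWithinAt fun s hs => ⟨hs, mem_univ _⟩
  filter_upwards [hm.preimage_mem_nhdsWithin (extChartAt_source_mem_nhds (I := J) r),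
    self_mem_nhdsWithin] with s hs hsI
  exact hstar_p s hsI hs

end Evolution

end GraphFlow

end

open GraphFlow
theorem mainTheorem4 {n m : ℕ}
    {S : Type*} [TopologicalSpace S] [ChartedSpace (EuclideanSpace ℝ (Fin n)) S]
    [IsManifold (𝓡 n) ∞ S]
    {S₁ : Type*} [TopologicalSpace S₁] [ChartedSpace (EuclideanSpace ℝ (Fin n)) S₁]
    [IsManifold (𝓡 n) ∞ S₁]
    {S₂ : Type*} [TopologicalSpace S₂] [ChartedSpace (EuclideanSpace ℝ (Fin m)) S₂]
    [IsManifold (𝓡 m) ∞ S₂]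
    (g₁ : Bundle.ContMDiffRiemannianMetric (𝓡 n) ∞ (EuclideanSpace ℝ (Fin n))
      (fun x : S₁ => TangentSpace (𝓡 n) x))
    (g₂ : Bundle.ContMDiffRiemannianMetric (𝓡 m) ∞ (EuclideanSpace ℝ (Fin m))
      (fun x : S₂ => TangentSpace (𝓡 m) x))
    (k₁ k₂ : ℝ)
    (hk₁ : HasConstantCurvature (𝓡 n) g₁.inner k₁)
    (hk₂ : HasConstantCurvature (𝓡 m) g₂.inner k₂)
    (ε : ℝ) (hε : 0 < ε) (F : ℝ → S → S₁ × S₂)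
    (hF₀ : IsSmoothEmbedding (𝓡 n) ((𝓡 n).prod (𝓡 m)) ∞ (F 0))
    (hF : IsMeanCurvatureFlow n (productMetric g₁.inner g₂.inner) F ε)
    (hgraph : ∀ t ∈ Ico 0 ε, IsLocallyGraph n m (F t)) :
    ∀ t ∈ Ico 0 ε,
      ContMDiff (𝓡 n) 𝓘(ℝ, ℝ) ∞ (starOmega g₁.inner g₂.inner (F t)) ∧
      ∀ (p : S) (U : Set S) (V : Set S₁) (f : S₁ → S₂), IsGraphNear n m (F t) p U V f →
        0 < starOmega g₁.inner g₂.inner (F t) p ∧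
        (∃ a b lam τ, IsAdaptedFrame g₁.inner g₂.inner (F t) p f a b lam τ) ∧
        ∀ a b lam τ, IsAdaptedFrame g₁.inner g₂.inner (F t) p f a b lam τ →
          HasDerivWithinAt (fun s => starOmega g₁.inner g₂.inner (F s) p)
            (laplacian (inducedMetric (𝓡 n) (productMetric g₁.inner g₂.inner) (F t))
                (starOmega g₁.inner g₂.inner (F t)) p
              + starOmega g₁.inner g₂.inner (F t) p *
                ((∑ α : Fin m, ∑ i, ∑ k,
                    frameSFF g₁.inner g₂.inner (F t) p a b lam τ α i k ^ 2)
                - 2 * (∑ k, ∑ i, ∑ j ∈ Finset.Ioi i, lam i * lam j *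
                    frameSFF g₁.inner g₂.inner (F t) p a b lam τ i i k *
                    frameSFF g₁.inner g₂.inner (F t) p a b lam τ j j k)
                + 2 * (∑ k, ∑ i, ∑ j ∈ Finset.Ioi i, lam i * lam j *
                    frameSFF g₁.inner g₂.inner (F t) p a b lam τ j i k *
                    frameSFF g₁.inner g₂.inner (F t) p a b lam τ i j k)
                + ∑ i, lam i ^ 2 / (1 + lam i ^ 2) *
                    (k₁ * (∑ j ∈ Finset.univ.erase i, 1 / (1 + lam j ^ 2))
                      + k₂ * (1 - (n : ℝ)
                          + ∑ j ∈ Finset.univ.erase i, 1 / (1 + lam j ^ 2)))))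
            (Ico 0 ε) t := by
  intro t ht
  have hFt := hF.contMDiff ht
  obtain ⟨h1, h2⟩ := contMDiff_starOmega g₁ g₂ hFt (hF.immersion t ht) (hgraph t ht)
  refine ⟨h1, fun p U V f h => ⟨h2 p, ?_, fun a b lam τ hf => ?_⟩⟩
  · exact h.exists_isAdaptedFrame g₁ g₂ (hFt.mdifferentiable (by simp) p)
      ((hgraph t ht).injective_fst (hFt.mdifferentiable (by simp)) (hF.immersion t ht) p)
  -- The factor in braces is `reaction` unfolded, so the two statements agree definitionally.
  · exact hasDerivWithinAt_starOmega g₁ g₂ hk₁ hk₂ hF ht (hgraph t ht) h hf
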